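/- Let $d\ge 3$, $\lambda\in(0,1)$ and $C_0\in\mathbb{R}$. There is a constant $C=C(d,\lambda,C_0)>0$ with the following property. Let $A:\mathbb{R}^d\to\mathbb{R}^{d\times d}$ be a measurable coefficient field that is uniformly elliptic, i.e. $\int \nabla\varphi\cdot A\nabla\varphi\ge\lambda\int|\nabla\varphi|^2$ for all $\varphi\in C_c^\infty(\mathbb{R}^d)$ and $|A(x)\xi|\le|\xi|$ for a.e. $x$ and all $\xi\in\mathbb{R}^d$; let $A^t$ be the adjoint (transposed) field. For a uniformly elliptic field $B$ and a point $x$, a number $r_*(B,x)\ge 1$ is called a minimal radius of $B$ at $x$ if for all $R\ge r\ge r_*(B,x)$ and every $u\in H^1(B_R(x))$ that solves $-\nabla\cdot B\nabla u=0$ weakly in $B_R(x)$ $$\frac1{|B_r|}\int_{B_r(x)}|\nabla u|^2\le C_0\,\frac1{|B_R|}\int_{B_R(x)}|\nabla u|^2 .$$ Let $G=G(A;x,y)$ be the Green's function, assumed to exist for a.e. $y$: $G$ is measurable in $(x,y)$ and for a.e. $y$ the function $G(A;\cdot,y)\in W^{1,1}_{\rm loc}(\mathbb{R}^d)$ solves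 $-\nabla_x\cdot A\nabla_xG(A;\cdot,y)=\delta(\cdot-y)$ in the sense of distributions, with $\nabla_xG(A;\cdot,y)\in L^2(\mathbb{R}^d\setminus B_r(y))$ and $G(A;\cdot,y)\in L^{2d/(d-2)}(\mathbb{R}^d\setminus B_r(y))$ for every $r>0$. Let $x_0,y_0\in\mathbb{R}^d$ with $|x_0-y_0|\ge 10$. Then $G$ has weak derivatives $\nabla_xG$, $\nabla_yG$, $\nabla_x\nabla_yG$ on $B_1(x_0)\times B_1(y_0)$, and if $r_*(x_0)$, $r_*(y_0)$ are minimal radii of $A$ at $x_0$, $y_0$ and $r_*'(x_0)$, $r_*'(y_0)$ are minimal radii of $A^t$ at $x_0$, $y_0$, then $$\int_{x\in B_1(x_0)}\int_{y\in B_1(y_0)}|\nabla_x\nabla_yG(A;x,y)|^2\,dy\,dx\le C\Big(\frac{r_*(x_0)\,r_*'(y_0)}{|x_0-y_0|^2}\Big)^d,$$ $$\int_{x\in B_1(x_0)}\int_{y\in B_1(y_0)}|\nabla_yG(A;x,y)|^2\,dy\,dx\le C|x_0-y_0|^2\Big(\frac{r_*(x_0)\,r_*'(y_0)}{|x_0-y_0|^2}\Big)^d,$$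 $$\int_{x\in B_1(x_0)}\int_{y\in B_1(y_0)}|\nabla_xG(A;x,y)|^2\,dy\,dx\le C|x_0-y_0|^2\Big(\frac{r_*(x_0)\,r_*'(y_0)}{|x_0-y_0|^2}\Big)^d,$$ $$\int_{x\in B_1(x_0)}\int_{y\in B_1(y_0)}|G(A;x,y)|^2\,dy\,dx\le C|x_0-y_0|^4\Big(\frac{r_*(x_0)\,r_*'(y_0)+r_*'(x_0)\,r_*(y_0)}{|x_0-y_0|^2}\Big)^d .$$ The first three estimates need only the radii $r_*(x_0)$ and $r_*'(y_0)$. -/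

import Mathlib

open MeasureTheory Metric
open scoped ContDiff

namespace GreenEstimates

/-- Euclidean space `ℝ^d`. -/
abbrev Space (d : ℕ) := EuclideanSpace ℝ (Fin d)

/-- The standard basis vector `e_i` of `ℝ^d`. -/
noncomputable def basisVec {d : ℕ} (i : Fin d) : Space d := EuclideanSpace.single i 1

/-- `φ ∈ C_c^∞(U)`: smooth functions with compact support contained in `U`. -/
def IsTestFunction {V : Type*} [NormedAddCommGroup V] [NormedSpace ℝ V]
    (U : Set V) (φ : V → ℝ) : Prop :=
  ContDiff ℝ ∞ φ ∧ HasCompactSupport φ ∧ tsupport φ ⊆ U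

/-- `w` is the weak (distributional) derivative of `u` in the direction `v` on the open set `U`;
both functions are required to be locally integrable on `U`. -/
def HasWeakDeriv {V : Type*} [NormedAddCommGroup V] [NormedSpace ℝ V] [MeasureSpace V]
    (U : Set V) (v : V) (u w : V → ℝ) : Prop :=
  LocallyIntegrableOn u U ∧ LocallyIntegrableOn w U ∧
    ∀ φ : V → ℝ, IsTestFunction U φ →
      ∫ z in U, u z * fderiv ℝ φ z v = - ∫ z in U, w z * φ z

/-- `g` is the weak gradient of `u` on the open set `U ⊆ ℝ^d`. -/
def HasWeakGradient {d : ℕ} (U : Set (Space d)) (u : Space d → ℝ) (g : Space d → Space d) :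
    Prop :=
  ∀ i : Fin d, HasWeakDeriv U (basisVec i) u (fun x => g x i)

/-- Uniformly elliptic coefficient fields with ellipticity contrast `lam`: `A` is measurable,
`∫ ∇φ · A ∇φ ≥ lam ∫ |∇φ|²` for all `φ ∈ C_c^∞(ℝ^d)`, and `|A(x) ξ| ≤ |ξ|` for a.e. `x`
and all `ξ`. -/
structure IsUniformlyElliptic {d : ℕ} (lam : ℝ) (A : Space d → Space d →L[ℝ] Space d) :
    Prop where
  aestronglyMeasurable : AEStronglyMeasurable A volume
  coercive : ∀ φ : Space d → ℝ, IsTestFunction Set.univ φ →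
    lam * ∫ x, ‖gradient φ x‖ ^ 2 ≤ ∫ x, inner ℝ (gradient φ x) (A x (gradient φ x))
  bounded : ∀ᵐ x, ∀ ξ : Space d, ‖A x ξ‖ ≤ ‖ξ‖

/-- The adjoint (pointwise transposed) coefficient field `A^t`. -/
noncomputable def adjointField {d : ℕ} (A : Space d → Space d →L[ℝ] Space d) :
    Space d → Space d →L[ℝ] Space d :=
  fun x => ContinuousLinearMap.adjoint (A x)

/-- `u ∈ H¹(U)`, with weak gradient `Du`, is a weak solution of `-∇ · A ∇u = 0` in `U`. -/
structure IsHarmonicOn {d : ℕ} (A : Space d → Space d →L[ℝ] Space d) (U : Set (Space d))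
    (u : Space d → ℝ) (Du : Space d → Space d) : Prop where
  hasWeakGradient : HasWeakGradient U u Du
  memLp : MemLp u 2 (volume.restrict U)
  memLp_grad : MemLp Du 2 (volume.restrict U)
  eq_zero : ∀ φ : Space d → ℝ, IsTestFunction U φ →
    ∫ x in U, inner ℝ (A x (Du x)) (gradient φ x) = 0

/-- `rstar ≥ 1` is an admissible minimal radius of `A` at `x`: the energy of `A`-harmonic functions
has the mean value property (with constant `C₀`) on balls around `x` of radii above `rstar`. -/
def IsMinimalRadius {d : ℕ} (C₀ : ℝ) (A : Space d → Space d →L[ℝ] Space d) (x : Space d)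
    (rstar : ℝ) : Prop :=
  1 ≤ rstar ∧
    ∀ r R : ℝ, rstar ≤ r → r ≤ R →
      ∀ (u : Space d → ℝ) (Du : Space d → Space d), IsHarmonicOn A (ball x R) u Du →
        ⨍ z in ball x r, ‖Du z‖ ^ 2 ≤ C₀ * ⨍ z in ball x R, ‖Du z‖ ^ 2

/-- `g = G(A; ·, y)` is a Green's function with pole `y` (in dimension `d ≥ 3`): `g` is weakly
differentiable on `ℝ^d`, solves `-∇ · A ∇g = δ_y`, and, away from the pole, has finite energy
and vanishes at infinity in the sense of `L^{2d/(d-2)}`. -/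
def IsGreenAt {d : ℕ} (A : Space d → Space d →L[ℝ] Space d) (y : Space d) (g : Space d → ℝ) :
    Prop :=
  ∃ Dg : Space d → Space d,
    HasWeakGradient Set.univ g Dg ∧
    (∀ φ : Space d → ℝ, IsTestFunction Set.univ φ →
      ∫ x, inner ℝ (A x (Dg x)) (gradient φ x) = φ y) ∧
    ∀ r : ℝ, 0 < r →
      MemLp Dg 2 (volume.restrict (ball y r)ᶜ) ∧
      MemLp g (ENNReal.ofReal (2 * d / (d - 2))) (volume.restrict (ball y r)ᶜ)

/-- `G = G(A; x, y)` is the Green's function of `-∇ · A ∇`: it is measurable in `(x, y)` and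
`G(A; ·, y)` is a Green's function with pole `y` for a.e. `y`. -/
structure IsGreenFunction {d : ℕ} (A : Space d → Space d →L[ℝ] Space d)
    (G : Space d → Space d → ℝ) : Prop where
  aestronglyMeasurable :
    AEStronglyMeasurable (fun p : Space d × Space d => G p.1 p.2) volume
  green : ∀ᵐ y, IsGreenAt A y (fun x => G x y)

/-- `g = ∇_x F` weakly on the open set `W` of pairs `(x, y)`. -/
def HasWeakGradientFst {d : ℕ} (W : Set (Space d × Space d)) (F : Space d × Space d → ℝ)
    (g : Space d × Space d → Space d) : Prop :=
  ∀ i : Fin d, HasWeakDeriv W ((basisVec i, 0) : Space d × Space d) F (fun p => g p i)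

/-- `g = ∇_y F` weakly on the open set `W` of pairs `(x, y)`. -/
def HasWeakGradientSnd {d : ℕ} (W : Set (Space d × Space d)) (F : Space d × Space d → ℝ)
    (g : Space d × Space d → Space d) : Prop :=
  ∀ i : Fin d, HasWeakDeriv W ((0, basisVec i) : Space d × Space d) F (fun p => g p i)

end GreenEstimates

open scoped Topology

/-! Write `R = ‖x₀ - y₀‖`. On a product of two disjoint balls, `G` is the Hilbert-Schmidt kernel of
the solution operator of `-∇ · A ∇` between these balls. Estimates for harmonic functions, which are
operator inequalities, then become estimates for kernels.

The solution operator. The energy space is the `L²` closure of the gradients of test functions.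
Coercivity is assumed only in integrated form and passes to this closure, so Lax-Milgram yields
`solOp`; its Hilbert space adjoint is the solution operator of `A^t`. Sobolev's inequality attaches
a `potential` to each element of the energy space.

The link with `G` (`IsGreenFunction.ae_integral_mul_eq_potential`). If `f` lives in a ball away from
`y`, then `∫ f G(·, y)` is the value at `y` of the solution of the adjoint equation with right-hand
side `f`. To see this, test each of the two equations with the other solution, cut off near the
pole. The errors live on an annulus of radius `r` about `y` and are bounded by `r^{-d/2}
‖F‖_{L²(B_{10r})} ‖∇G‖_{L¹(B_{13r})}`, where `F` is the gradient of the adjoint solution. At a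
Lebesgue point of `|F|²` the first two factors stay bounded together, and the last tends to zero.
Near the pole only `W^{1,1}` regularity is needed.

The size of `G` (`exists_lintegral_green_sq_le`). By this link and the energy estimate, the integral
of `G(·, y)` over any small ball is controlled in `L²(dy)`. For harmonic functions such control
upgrades to control of the function itself: the distance to a moving average at scale `ε` is at most
`ε` times the gradient, which Caccioppoli's inequality bounds by the function on a larger ball, and
this is absorbed (`exists_interior_family_bound`). The result is `∬ |G|² ≤ C R⁴` on balls of radius
`R / 8`.

The minimal radius (`exists_minimalRadius_bound`). Passing from a ball of radius `ρ` to the unit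
ball gains a factor `(r_* / ρ)^d` in the squared `L²` norm of a harmonic function, and a further
`ρ⁻²` for its gradient.

The transfer (`IsKernel.exists_kernel`, `exists_kernel_conj`). The squared norm of the kernel of `T`
is `∑ ‖T b_k‖²` over an orthonormal basis, so `‖M e‖² ≤ β ‖T e‖²` for all `e` gives `M` a kernel
whose squared norm is larger by at most the factor `β`. Used in `x` for `A` and, after
transposition, in `y` for `A^t`, this multiplies the two gains and `R⁴`. The new kernels are the
weak derivatives of `G`. -/

namespace GreenEstimates


/-! ### Jensen's and Minkowski's integral inequalities -/

section Jensen

lemma rpow_lintegral_enorm_le {Z F : Type*} [MeasurableSpace Z] [NormedAddCommGroup F]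
    {m : Measure Z} [IsProbabilityMeasure m] {f : Z → F} (hf : AEStronglyMeasurable f m) {q : ℝ}
    (hq : 1 ≤ q) : (∫⁻ z, ‖f z‖ₑ ∂m) ^ q ≤ ∫⁻ z, ‖f z‖ₑ ^ q ∂m := by
  have h := eLpNorm'_le_eLpNorm'_of_exponent_le (p := 1) (q := q) one_pos hq m hf
  have hq0 : 0 < q := by linarith
  simp only [eLpNorm', ENNReal.rpow_one, one_div, inv_one] at h
  calc (∫⁻ z, ‖f z‖ₑ ∂m) ^ q ≤ ((∫⁻ z, ‖f z‖ₑ ^ q ∂m) ^ q⁻¹) ^ q := by gcongr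
    _ = _ := by rw [← ENNReal.rpow_mul, inv_mul_cancel₀ hq0.ne', ENNReal.rpow_one]

/-- Minkowski's integral inequality with respect to a probability measure. -/
lemma eLpNorm_integral_le {Z X F : Type*} [MeasurableSpace Z] [MeasurableSpace X]
    [NormedAddCommGroup F] [NormedSpace ℝ F] {m : Measure Z} [IsProbabilityMeasure m]
    {μ : Measure X} [SFinite μ] {p : ENNReal} (hp1 : 1 ≤ p) (hp : p ≠ ⊤) {f : Z → X → F}
    (hf : AEStronglyMeasurable (Function.uncurry f) (m.prod μ)) {C : ENNReal}
    (h : ∀ᵐ z ∂m, eLpNorm (f z) p μ ≤ C) :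
    eLpNorm (fun x => ∫ z, f z x ∂m) p μ ≤ C := by
  have hp0 : p ≠ 0 := (zero_lt_one.trans_le hp1).ne'
  have hq : 1 ≤ p.toReal := by
    rw [← ENNReal.toReal_one]; exact ENNReal.toReal_mono hp hp1
  have hq0 : 0 < p.toReal := by linarith
  have key : ∀ g : X → F, eLpNorm g p μ ≤ C ↔ ∫⁻ x, ‖g x‖ₑ ^ p.toReal ∂μ ≤ C ^ p.toReal := by
    intro g
    rw [eLpNorm_eq_lintegral_rpow_enorm_toReal hp0 hp, one_div, ENNReal.rpow_inv_le_iff hq0]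
  rw [key]
  have hsec : ∀ᵐ x ∂μ, AEStronglyMeasurable (fun z => f z x) m := by
    have := hf.prod_swap
    exact this.prodMk_left
  calc ∫⁻ x, ‖∫ z, f z x ∂m‖ₑ ^ p.toReal ∂μ
      ≤ ∫⁻ x, ∫⁻ z, ‖f z x‖ₑ ^ p.toReal ∂m ∂μ := by
        refine lintegral_mono_ae ?_
        filter_upwards [hsec] with x hx
        calc ‖∫ z, f z x ∂m‖ₑ ^ p.toReal ≤ (∫⁻ z, ‖f z x‖ₑ ∂m) ^ p.toReal := by
              gcongr; exact enorm_integral_le_lintegral_enorm _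
          _ ≤ _ := rpow_lintegral_enorm_le hx hq
    _ = ∫⁻ z, ∫⁻ x, ‖f z x‖ₑ ^ p.toReal ∂μ ∂m := by
        rw [lintegral_lintegral_swap]
        exact (hf.enorm.pow_const _).prod_swap
    _ ≤ ∫⁻ z, C ^ p.toReal ∂m := by
        refine lintegral_mono_ae ?_
        filter_upwards [h] with z hz
        exact (key _).1 hz
    _ = C ^ p.toReal := by simp

end Jensen

/-! ### Test functions and weak derivatives -/

section WeakDerivatives

variable {V : Type*} [NormedAddCommGroup V] [NormedSpace ℝ V]

lemma IsTestFunction.mono {U U' : Set V} {φ : V → ℝ} (h : IsTestFunction U φ) (hU : U ⊆ U') :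
    IsTestFunction U' φ := ⟨h.1, h.2.1, h.2.2.trans hU⟩

lemma IsTestFunction.mul_left {U : Set V} {η φ : V → ℝ} (hη : IsTestFunction U η)
    (hφ : ContDiff ℝ ∞ φ) : IsTestFunction U (fun x => η x * φ x) :=
  ⟨hη.1.mul hφ, hη.2.1.mul_right, (tsupport_mul_subset_left).trans hη.2.2⟩

lemma IsTestFunction.differentiable {U : Set V} {φ : V → ℝ} (h : IsTestFunction U φ) :
    Differentiable ℝ φ := h.1.differentiable (by simp)

lemma IsTestFunction.continuous {U : Set V} {φ : V → ℝ} (h : IsTestFunction U φ) :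
    Continuous φ := h.1.continuous

lemma IsTestFunction.contDiff_fderiv_apply {U : Set V} {φ : V → ℝ} (h : IsTestFunction U φ)
    (v : V) : ContDiff ℝ ∞ (fun x => fderiv ℝ φ x v) :=
  (h.1.fderiv_right (m := ∞) (by simp)).clm_apply contDiff_const

lemma tsupport_fderiv_apply_subset {φ : V → ℝ} (v : V) :
    tsupport (fun x => fderiv ℝ φ x v) ⊆ tsupport φ := by
  refine closure_minimal ?_ (isClosed_tsupport φ)
  intro x hx
  by_contra hx'
  have : fderiv ℝ φ x = 0 := by
    have := support_fderiv_subset ℝ (f := φ)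
    by_contra hne
    exact hx' (this hne)
  simp [this] at hx

lemma IsTestFunction.fderiv_apply {U : Set V} {φ : V → ℝ} (h : IsTestFunction U φ)
    (v : V) : IsTestFunction U (fun x => fderiv ℝ φ x v) :=
  ⟨h.contDiff_fderiv_apply v,
    h.2.1.of_isClosed_subset (isClosed_tsupport _) (tsupport_fderiv_apply_subset v),
    (tsupport_fderiv_apply_subset v).trans h.2.2⟩

lemma IsTestFunction.eq_zero {U : Set V} {φ : V → ℝ} (h : IsTestFunction U φ) {x : V}
    (hx : x ∉ U) : φ x = 0 :=
  image_eq_zero_of_notMem_tsupport fun h' => hx (h.2.2 h')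

variable [MeasureSpace V]

omit [NormedSpace ℝ V] in
lemma integrable_mul_of_locallyIntegrableOn [BorelSpace V] {U : Set V} {u k : V → ℝ}
    (hu : LocallyIntegrableOn u U) (hk : Continuous k) (hc : HasCompactSupport k)
    (hs : tsupport k ⊆ U) : Integrable (fun x => u x * k x) := by
  have h1 : IntegrableOn u (tsupport k) := hu.integrableOn_compact_subset hs hc
  have h2 : IntegrableOn (fun x => u x * k x) (tsupport k) :=
    h1.mul_continuousOn hk.continuousOn hc
  refine (integrableOn_iff_integrable_of_support_subset ?_).1 h2
  intro x hx
  refine subset_tsupport _ ?_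
  simp only [Function.mem_support, ne_eq, mul_eq_zero, not_or] at hx
  exact hx.2

lemma setIntegral_mul_eq {V : Type*} [MeasureSpace V] {U : Set V} {u k : V → ℝ} (hs : ∀ x ∉ U, k x = 0) :
    ∫ x in U, u x * k x = ∫ x, u x * k x := by
  refine setIntegral_eq_integral_of_forall_compl_eq_zero ?_
  intro x hx; simp [hs x hx]

/-- Test functions and their derivatives vanish off `U`, so integrals over `U` may be replaced by
integrals over the whole space and the domain no longer has to be tracked. -/
lemma HasWeakDeriv.integral_eq {U : Set V} {v : V} {u w : V → ℝ} (h : HasWeakDeriv U v u w)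
    {φ : V → ℝ} (hφ : IsTestFunction U φ) :
    ∫ x, u x * fderiv ℝ φ x v = - ∫ x, w x * φ x := by
  rw [← setIntegral_mul_eq (U := U) (k := φ) (fun x hx => hφ.eq_zero hx),
    ← setIntegral_mul_eq (U := U) (k := fun x => fderiv ℝ φ x v)
      (fun x hx => (hφ.fderiv_apply v).eq_zero hx)]
  exact h.2.2 φ hφ

lemma hasWeakDeriv_of_integral_eq {U : Set V} {v : V} {u w : V → ℝ}
    (hu : LocallyIntegrableOn u U) (hw : LocallyIntegrableOn w U)
    (h : ∀ φ : V → ℝ, IsTestFunction U φ → ∫ x, u x * fderiv ℝ φ x v = - ∫ x, w x * φ x) :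
    HasWeakDeriv U v u w := by
  refine ⟨hu, hw, fun φ hφ => ?_⟩
  rw [setIntegral_mul_eq (U := U) (k := φ) (fun x hx => hφ.eq_zero hx),
    setIntegral_mul_eq (U := U) (k := fun x => fderiv ℝ φ x v)
      (fun x hx => (hφ.fderiv_apply v).eq_zero hx)]
  exact h φ hφ

lemma HasWeakDeriv.mono {U U' : Set V} {v : V} {u w : V → ℝ} (h : HasWeakDeriv U v u w)
    (hU : U' ⊆ U) : HasWeakDeriv U' v u w :=
  hasWeakDeriv_of_integral_eq (h.1.mono_set hU) (h.2.1.mono_set hU)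
    fun _ hφ => h.integral_eq (hφ.mono hU)

lemma HasWeakDeriv.congr_ae {U : Set V} {v : V} {u w u' w' : V → ℝ} (h : HasWeakDeriv U v u w)
    (hu : u =ᵐ[volume.restrict U] u') (hw : w =ᵐ[volume.restrict U] w') :
    HasWeakDeriv U v u' w' := by
  have aux : ∀ {f g : V → ℝ}, f =ᵐ[volume.restrict U] g → LocallyIntegrableOn f U →
      LocallyIntegrableOn g U := by
    intro f g hfg hf x hx
    obtain ⟨s, hs, hs'⟩ := hf x hx
    refine ⟨s ∩ U, Filter.inter_mem hs self_mem_nhdsWithin, ?_⟩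
    refine (hs'.mono_set Set.inter_subset_left).congr ?_
    exact ae_restrict_of_ae_restrict_of_subset Set.inter_subset_right hfg
  refine ⟨aux hu h.1, aux hw h.2.1, fun φ hφ => ?_⟩
  have e1 : ∫ x in U, u x * fderiv ℝ φ x v = ∫ x in U, u' x * fderiv ℝ φ x v :=
    integral_congr_ae (hu.mono fun x hx => by simp only [hx])
  have e2 : ∫ x in U, w x * φ x = ∫ x in U, w' x * φ x :=
    integral_congr_ae (hw.mono fun x hx => by simp only [hx])
  rw [← e1, ← e2]
  exact h.2.2 φ hφ

/-- Product rule with a cutoff function. -/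
lemma HasWeakDeriv.mul_test [BorelSpace V] {U : Set V} {v : V} {u w η : V → ℝ} (h : HasWeakDeriv U v u w)
    (hη : IsTestFunction U η) :
    HasWeakDeriv Set.univ v (fun x => u x * η x)
      (fun x => w x * η x + u x * fderiv ℝ η x v) := by
  have hηv := hη.fderiv_apply v
  have i1 := integrable_mul_of_locallyIntegrableOn h.1 hη.continuous hη.2.1 hη.2.2
  have i2 := integrable_mul_of_locallyIntegrableOn h.2.1 hη.continuous hη.2.1 hη.2.2
  have i3 := integrable_mul_of_locallyIntegrableOn h.1 hηv.continuous hηv.2.1 hηv.2.2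
  refine hasWeakDeriv_of_integral_eq (i1.locallyIntegrable.locallyIntegrableOn _)
    ((i2.add i3).locallyIntegrable.locallyIntegrableOn _) ?_
  intro φ hφ
  -- The product is admissible in `U` although `φ` alone need not be supported there; this turns a
  -- local weak derivative into a global one.
  have hηφ : IsTestFunction U (fun x => η x * φ x) := hη.mul_left hφ.1
  have e := h.integral_eq hηφ
  have hd : ∀ x, fderiv ℝ (fun x => η x * φ x) x v = η x * fderiv ℝ φ x v + φ x * fderiv ℝ η x v := by
    intro x
    rw [fderiv_fun_mul (hη.differentiable x) (hφ.differentiable x)]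
    simp
  simp only [hd] at e
  have hη1 : IsTestFunction U (fun x => η x * fderiv ℝ φ x v) :=
    hη.mul_left (hφ.contDiff_fderiv_apply v)
  have hη2 : IsTestFunction U (fun x => fderiv ℝ η x v * φ x) := hηv.mul_left hφ.1
  have j1 := integrable_mul_of_locallyIntegrableOn h.1 hη1.continuous hη1.2.1 hη1.2.2
  have j2 := integrable_mul_of_locallyIntegrableOn h.1 hη2.continuous hη2.2.1 hη2.2.2
  have j3 := integrable_mul_of_locallyIntegrableOn h.2.1 hηφ.continuous hηφ.2.1 hηφ.2.2
  have e1 : ∫ x, u x * (η x * fderiv ℝ φ x v + φ x * fderiv ℝ η x v)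
      = (∫ x, u x * (η x * fderiv ℝ φ x v)) + ∫ x, u x * (fderiv ℝ η x v * φ x) := by
    rw [← integral_add j1 j2]; congr 1; ext x; ring
  have e2 : ∫ x, (w x * η x + u x * fderiv ℝ η x v) * φ x
      = (∫ x, w x * (η x * φ x)) + ∫ x, u x * (fderiv ℝ η x v * φ x) := by
    rw [← integral_add j3 j2]; congr 1; ext x; ring
  rw [e2]
  rw [e1] at e
  have : ∫ x, u x * η x * fderiv ℝ φ x v = ∫ x, u x * (η x * fderiv ℝ φ x v) := by
    congr 1; ext x; ring
  rw [this]; linarith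

end WeakDerivatives

end GreenEstimates

namespace GreenEstimates


/-! ### Mollification in `L^p` -/

section Mollification

variable {d : ℕ}

/-- Translation acts strongly continuously on `L^p` for finite `p`: composition of a fixed class
with a continuous family of measure preserving maps is continuous, and continuity is read off at `t
= 0`. -/
lemma exists_eLpNorm_translate_sub_le {p : ENNReal} (hp1 : 1 ≤ p) (hp : p ≠ ⊤)
    {u : Space d → ℝ} (hu : MemLp u p) {ε : ENNReal} (hε : 0 < ε) :
    ∃ δ > 0, ∀ t : Space d, ‖t‖ < δ → eLpNorm (fun x => u (x - t) - u x) p volume ≤ ε := by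
  have : Fact (1 ≤ p) := ⟨hp1⟩
  have hmp : ∀ t : Space d, MeasurePreserving (fun x => x - t) volume volume :=
    fun t => measurePreserving_sub_right volume t
  let g : Space d → C(Space d, Space d) := fun t => ⟨fun x => x - t, by fun_prop⟩
  have hg : Continuous g :=
    (ContinuousMap.curry ⟨fun q : Space d × Space d => q.2 - q.1, by fun_prop⟩).continuous
  have hc : Continuous fun t => Lp.compMeasurePreserving (g t) (hmp t) hu.toLp :=
    Continuous.compMeasurePreservingLp continuous_const hg hmp hp
  have h0 := hc.tendsto 0
  rw [EMetric.tendsto_nhds_nhds] at h0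
  obtain ⟨δ, hδ, h⟩ := h0 ε hε
  obtain ⟨δ', hδ', hle⟩ : ∃ δ' : ℝ, 0 < δ' ∧ ENNReal.ofReal δ' ≤ δ := by
    by_cases ht : δ = ⊤
    · exact ⟨1, one_pos, by simp [ht]⟩
    · exact ⟨δ.toReal, ENNReal.toReal_pos hδ.ne' ht, by rw [ENNReal.ofReal_toReal ht]⟩
  refine ⟨δ', hδ', fun t ht => ?_⟩
  have := (h (x := t) (by
    rw [edist_dist, dist_zero_right]
    exact ((ENNReal.ofReal_lt_ofReal_iff hδ').2 ht).trans_le hle)).le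
  rw [Lp.edist_def] at this
  refine le_trans (le_of_eq ?_) this
  refine eLpNorm_congr_ae ?_
  have e1 := Lp.coeFn_compMeasurePreserving hu.toLp (hmp t)
  have e2 := Lp.coeFn_compMeasurePreserving hu.toLp (hmp 0)
  have e3 := (hmp t).quasiMeasurePreserving.ae_eq_comp hu.coeFn_toLp
  have e4 := (hmp 0).quasiMeasurePreserving.ae_eq_comp hu.coeFn_toLp
  filter_upwards [e1, e2, e3, e4] with x h1 h2 h3 h4
  have h1' : (Lp.compMeasurePreserving (g t) (hmp t) hu.toLp) x = u (x - t) := h1.trans h3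
  have h2' : (Lp.compMeasurePreserving (g 0) (hmp 0) hu.toLp) x = u (x - 0) := h2.trans h4
  simp only [Pi.sub_apply]
  rw [h1', h2', sub_zero]

/-- The mollification `ρ ⋆ u`. -/
noncomputable def mollify (ρ : ContDiffBump (0 : Space d)) (u : Space d → ℝ) : Space d → ℝ :=
  convolution (ρ.normed volume) u (ContinuousLinearMap.lsmul ℝ ℝ) volume

lemma mollify_apply (ρ : ContDiffBump (0 : Space d)) (u : Space d → ℝ) (x : Space d) :
    mollify ρ u x = ∫ t, ρ.normed volume t * u (x - t) := by
  simp [mollify, convolution_def]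

lemma mollify_apply' (ρ : ContDiffBump (0 : Space d)) (u : Space d → ℝ) (x : Space d) :
    mollify ρ u x = ∫ t, ρ.normed volume (x - t) * u t := by
  simp [mollify, convolution_eq_swap]

lemma contDiff_mollify (ρ : ContDiffBump (0 : Space d)) {u : Space d → ℝ}
    (hu : LocallyIntegrable u) : ContDiff ℝ ∞ (mollify ρ u) :=
  ρ.hasCompactSupport_normed.contDiff_convolution_left _ (ρ.contDiff_normed (n := ⊤)) hu

/-- The derivative falls on the mollifier. Since `s ↦ ρ (x - s)` is a test function, the definition
of the weak derivative moves it onto `u`; the reflection and the integration by parts each give a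
sign, and these cancel. -/
lemma fderiv_mollify (ρ : ContDiffBump (0 : Space d)) {v : Space d} {u w : Space d → ℝ}
    (h : HasWeakDeriv Set.univ v u w) (x : Space d) :
    fderiv ℝ (mollify ρ u) x v = mollify ρ w x := by
  have hu : LocallyIntegrable u := locallyIntegrableOn_univ.1 h.1
  have hρ1 : ContDiff ℝ ∞ (ρ.normed volume) := ρ.contDiff_normed (n := ⊤)
  have hd := (ρ.hasCompactSupport_normed (μ := volume)).hasFDerivAt_convolution_left
    (ContinuousLinearMap.lsmul ℝ ℝ) (hρ1.of_le (by simp)) hu x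
  have hφ : IsTestFunction Set.univ (fun s => ρ.normed volume (x - s)) := by
    refine ⟨hρ1.comp (contDiff_const.sub contDiff_id), ?_, Set.subset_univ _⟩
    exact (ρ.hasCompactSupport_normed (μ := volume)).comp_homeomorph (Homeomorph.subLeft x)
  have e := h.integral_eq hφ
  have hfd : ∀ s, fderiv ℝ (fun s => ρ.normed volume (x - s)) s v
      = - fderiv ℝ (ρ.normed volume) (x - s) v := by
    intro s
    have h1 : HasFDerivAt (fun s => ρ.normed volume (x - s))
      ((fderiv ℝ (ρ.normed volume) (x - s)).comp (-ContinuousLinearMap.id ℝ (Space d))) s := by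
      refine HasFDerivAt.comp s ((hρ1.differentiable (by simp) _).hasFDerivAt) ?_
      simpa using (hasFDerivAt_id s).const_sub x
    rw [h1.fderiv]; simp
  simp only [hfd] at e
  have hint : ConvolutionExistsAt (fderiv ℝ (ρ.normed volume)) u x
      ((ContinuousLinearMap.lsmul ℝ ℝ).precompL (Space d)) volume := by
    refine HasCompactSupport.convolutionExists_left _ (ρ.hasCompactSupport_normed.fderiv ℝ)
      (hρ1.continuous_fderiv (by simp)) hu x
  have e2 : fderiv ℝ (mollify ρ u) x v
      = ∫ t, fderiv ℝ (ρ.normed volume) (x - t) v * u t := by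
    have hint' := hint.integrable_swap
    unfold mollify
    rw [hd.fderiv, convolution_eq_swap, ContinuousLinearMap.integral_apply]
    · simp
    · exact hint'
  rw [e2, mollify_apply']
  have : ∫ t, fderiv ℝ (ρ.normed volume) (x - t) v * u t
      = - ∫ s, u s * -fderiv ℝ (ρ.normed volume) (x - s) v := by
    rw [← integral_neg]; congr 1; ext s; ring
  rw [this, e, neg_neg]
  congr 1; ext s; ring

/-- The difference is the mean of `u (· - t) - u` under the probability measure `ρ(t) dt`, which
charges only `‖t‖ < ρ.rOut`; Minkowski's inequality does the rest. -/
lemma eLpNorm_mollify_sub_le (ρ : ContDiffBump (0 : Space d)) {u : Space d → ℝ}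
    {p : ENNReal} (hp1 : 1 ≤ p) (hp : p ≠ ⊤) (hu : MemLp u p) {C : ENNReal}
    (h : ∀ t : Space d, ‖t‖ < ρ.rOut → eLpNorm (fun x => u (x - t) - u x) p volume ≤ C) :
    eLpNorm (fun x => mollify ρ u x - u x) p volume ≤ C := by
  set k : Space d → NNReal := fun t => (ρ.normed volume t).toNNReal with hk
  have hkm : Measurable k := (ρ.continuous_normed (μ := volume)).measurable.real_toNNReal
  set m : Measure (Space d) := volume.withDensity (fun t => (k t : ENNReal)) with hm
  have hprob : IsProbabilityMeasure m := by
    refine ⟨?_⟩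
    rw [hm, withDensity_apply _ MeasurableSet.univ, Measure.restrict_univ]
    have := ofReal_integral_eq_lintegral_ofReal (ρ.integrable_normed (μ := volume))
      (Filter.Eventually.of_forall ρ.nonneg_normed)
    rw [ρ.integral_normed, ENNReal.ofReal_one] at this
    exact this.symm
  have hloc : LocallyIntegrable u := hu.locallyIntegrable hp1
  have hrep : ∀ x, mollify ρ u x - u x = ∫ t, (u (x - t) - u x) ∂m := by
    intro x
    rw [hm, integral_withDensity_eq_integral_smul hkm]
    have hkk : ∀ t, k t • (u (x - t) - u x)
        = ρ.normed volume t * u (x - t) - ρ.normed volume t * u x := by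
      intro t
      rw [NNReal.smul_def, hk, Real.coe_toNNReal _ (ρ.nonneg_normed t), smul_eq_mul, mul_sub]
    simp only [hkk]
    rw [integral_sub, mollify_apply, integral_mul_const, ρ.integral_normed, one_mul]
    · have := HasCompactSupport.convolutionExists_left (ContinuousLinearMap.lsmul ℝ ℝ)
        (ρ.hasCompactSupport_normed (μ := volume)) ρ.continuous_normed hloc x
      simpa [ConvolutionExistsAt] using this
    · exact ρ.integrable_normed.mul_const _
  simp only [hrep]
  refine eLpNorm_integral_le hp1 hp ?_ ?_
  · have hac : m ≪ volume := withDensity_absolutelyContinuous _ _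
    refine AEStronglyMeasurable.mono_ac (hac.prod Measure.AbsolutelyContinuous.rfl) ?_
    refine AEStronglyMeasurable.sub ?_ ?_
    · have hq : Measure.QuasiMeasurePreserving (fun q : Space d × Space d => q.2 - q.1)
          (volume.prod volume) volume := by
        have := (quasiMeasurePreserving_sub (volume : Measure (Space d)) volume)
        exact this.comp (Measure.measurePreserving_swap.quasiMeasurePreserving)
      exact hu.1.comp_quasiMeasurePreserving hq
    · exact hu.1.comp_snd
  · rw [hm, ae_withDensity_iff hkm.coe_nnreal_ennreal]
    refine Filter.Eventually.of_forall fun t ht => h t ?_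
    have : t ∈ Function.support (ρ.normed volume) := by
      intro h0; exact ht (by simp [hk, h0])
    rw [ρ.support_normed_eq] at this
    simpa using this

lemma tsupport_mollify_subset (ρ : ContDiffBump (0 : Space d)) {u : Space d → ℝ} {z : Space d}
    {r : ℝ} (hu : ∀ x, x ∉ closedBall z r → u x = 0) :
    tsupport (mollify ρ u) ⊆ closedBall z (r + ρ.rOut) := by
  refine closure_minimal ?_ isClosed_closedBall
  intro x hx
  by_contra hx'
  refine hx ?_
  rw [mollify_apply]
  refine integral_eq_zero_of_ae (Filter.Eventually.of_forall fun t => ?_)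
  by_cases ht : ‖t‖ < ρ.rOut
  · change ρ.normed volume t * u (x - t) = 0
    rw [hu (x - t)]; · simp
    intro hmem
    refine hx' ?_
    rw [mem_closedBall, dist_eq_norm] at hmem ⊢
    calc ‖x - z‖ = ‖(x - t - z) + t‖ := by congr 1; abel
      _ ≤ ‖x - t - z‖ + ‖t‖ := norm_add_le _ _
      _ ≤ r + ρ.rOut := by linarith
  · have : t ∉ Function.support (ρ.normed volume) := by
      rw [ρ.support_normed_eq]; simpa using ht
    simp only [Function.mem_support, ne_eq, not_not] at this
    simp [this]

end Mollification

end GreenEstimates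

namespace GreenEstimates


/-! ### Gradients, and density of test functions -/

variable {d : ℕ}

lemma inner_gradient (φ : Space d → ℝ) (x v : Space d) :
    inner ℝ (gradient φ x) v = fderiv ℝ φ x v := by
  simp [gradient]

lemma gradient_apply (φ : Space d → ℝ) (x : Space d) (i : Fin d) :
    gradient φ x i = fderiv ℝ φ x (basisVec i) := by
  rw [← inner_gradient, basisVec, EuclideanSpace.inner_single_right]
  simp

lemma norm_gradient (φ : Space d → ℝ) (x : Space d) : ‖gradient φ x‖ = ‖fderiv ℝ φ x‖ := by
  simp [gradient]

lemma continuous_gradient {φ : Space d → ℝ} (h : ContDiff ℝ ∞ φ) : Continuous (gradient φ) :=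
  (InnerProductSpace.toDual ℝ (Space d)).symm.continuous.comp (h.continuous_fderiv (by simp))

lemma tsupport_gradient_subset (φ : Space d → ℝ) : tsupport (gradient φ) ⊆ tsupport φ := by
  refine closure_minimal ?_ (isClosed_tsupport φ)
  intro x hx
  by_contra hx'
  have : fderiv ℝ φ x = 0 := by
    by_contra hne
    exact hx' (support_fderiv_subset ℝ hne)
  simp [gradient, this] at hx

lemma IsTestFunction.hasCompactSupport_gradient {U : Set (Space d)} {φ : Space d → ℝ}
    (h : IsTestFunction U φ) : HasCompactSupport (gradient φ) :=
  h.2.1.of_isClosed_subset (isClosed_tsupport _) (tsupport_gradient_subset φ)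

lemma gradient_eq_zero_of_notMem_tsupport {φ : Space d → ℝ} {x : Space d}
    (h : x ∉ tsupport φ) : gradient φ x = 0 :=
  image_eq_zero_of_notMem_tsupport fun h' => h (tsupport_gradient_subset φ h')

lemma IsTestFunction.gradient_eq_zero {U : Set (Space d)} {φ : Space d → ℝ}
    (h : IsTestFunction U φ) {x : Space d} (hx : x ∉ U) : gradient φ x = 0 :=
  gradient_eq_zero_of_notMem_tsupport fun h' => hx (h.2.2 h')

lemma IsTestFunction.memLp {U : Set (Space d)} {φ : Space d → ℝ}
    (h : IsTestFunction U φ) (p : ENNReal) (μ : Measure (Space d)) [IsFiniteMeasureOnCompacts μ] :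
    MemLp φ p μ :=
  h.continuous.memLp_of_hasCompactSupport h.2.1

lemma IsTestFunction.memLp_gradient {U : Set (Space d)} {φ : Space d → ℝ}
    (h : IsTestFunction U φ) (p : ENNReal) (μ : Measure (Space d)) [IsFiniteMeasureOnCompacts μ] :
    MemLp (gradient φ) p μ :=
  (continuous_gradient h.1).memLp_of_hasCompactSupport h.hasCompactSupport_gradient

lemma gradient_mul {φ η : Space d → ℝ} {x : Space d} (hφ : DifferentiableAt ℝ φ x)
    (hη : DifferentiableAt ℝ η x) :
    gradient (fun x => φ x * η x) x = η x • gradient φ x + φ x • gradient η x := by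
  refine ext_inner_right ℝ fun v => ?_
  rw [inner_gradient, fderiv_fun_mul hφ hη, inner_add_left, inner_smul_left, inner_smul_left,
    inner_gradient, inner_gradient]
  simp; ring

lemma eLpNorm_le_sum_coord {p : ENNReal} (hp1 : 1 ≤ p) {μ : Measure (Space d)}
    {F : Space d → Space d} (hF : AEStronglyMeasurable F μ) :
    eLpNorm F p μ ≤ ∑ i, eLpNorm (fun x => F x i) p μ := by
  have hm : ∀ i, AEStronglyMeasurable (fun x => F x i) μ := fun i =>
    (EuclideanSpace.proj (𝕜 := ℝ) i).continuous.comp_aestronglyMeasurable hF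
  calc eLpNorm F p μ ≤ eLpNorm (∑ i, fun x => ‖F x i‖) p μ := by
        refine eLpNorm_mono fun x => ?_
        rw [Finset.sum_apply, Real.norm_of_nonneg (Finset.sum_nonneg fun i _ => norm_nonneg _)]
        have : F x = ∑ i, F x i • EuclideanSpace.single i (1 : ℝ) := by
          ext j; simp [Finset.sum_apply, Pi.single_apply]
        conv_lhs => rw [this]
        refine (norm_sum_le _ _).trans (Finset.sum_le_sum fun i _ => ?_)
        rw [norm_smul]; simp
    _ ≤ ∑ i, eLpNorm (fun x => ‖F x i‖) p μ := eLpNorm_sum_le (fun i _ => (hm i).norm) hp1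
    _ = _ := by simp only [eLpNorm_norm]

lemma memLp_coord {p : ENNReal} {μ : Measure (Space d)} {F : Space d → Space d}
    (hF : MemLp F p μ) (i : Fin d) : MemLp (fun x => F x i) p μ :=
  (EuclideanSpace.proj (𝕜 := ℝ) i).comp_memLp' hF

/-- Test functions are dense in `W^{1,p}` functions with compact support. -/
lemma exists_test_approx {z : Space d} {r s : ℝ} (hrs : r < s) {ψ : Space d → ℝ}
    {Dψ : Space d → Space d} (h : HasWeakGradient Set.univ ψ Dψ)
    (hz : ∀ x, x ∉ closedBall z r → ψ x = 0) {p : ENNReal} (hp1 : 1 ≤ p) (hp : p ≠ ⊤)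
    (hψ : MemLp ψ p) (hD : MemLp Dψ p) {ε : ENNReal} (hε : 0 < ε) :
    ∃ φ, IsTestFunction (ball z s) φ ∧ eLpNorm (fun x => ψ x - φ x) p volume ≤ ε ∧
      eLpNorm (fun x => Dψ x - gradient φ x) p volume ≤ ε := by
  -- Each of the `d` components of the gradient is allowed an error `ε'`. Dividing by `d + 1`
  -- instead of `d` keeps `ε' ≤ ε` for the function itself and is harmless for `d = 0`.
  set ε' : ENNReal := ε / (d + 1) with hε'
  have hε'0 : 0 < ε' := ENNReal.div_pos hε.ne' (by simp)
  have hε'1 : ε' ≤ ε := by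
    refine ENNReal.div_le_of_le_mul ?_
    exact le_mul_of_one_le_right (zero_le) (by simp)
  obtain ⟨δ, hδ, hδ'⟩ := exists_eLpNorm_translate_sub_le hp1 hp hψ hε'0
  choose δi hδi hδi' using fun i => exists_eLpNorm_translate_sub_le hp1 hp (memLp_coord hD i) hε'0
  obtain ⟨δ₀, hδ₀, hle⟩ : ∃ δ₀ > 0, ∀ i, δ₀ ≤ δi i := by
    rcases isEmpty_or_nonempty (Fin d) with hd | hd
    · exact ⟨1, one_pos, fun i => (hd.false i).elim⟩
    · obtain ⟨i, hi⟩ := Finite.exists_min δi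
      exact ⟨δi i, hδi i, hi⟩
  -- Below the translation moduli of `ψ` and of all components of `Dψ`, and small enough for the
  -- support, enlarged by `R`, to stay inside `ball z s`.
  set R := min (min δ δ₀) ((s - r) / 2) with hR
  have hR0 : 0 < R := by
    refine lt_min (lt_min hδ hδ₀) (by linarith)
  let ρ : ContDiffBump (0 : Space d) := ⟨R / 2, R, by linarith, by linarith⟩
  have hφ : ContDiff ℝ ∞ (mollify ρ ψ) := contDiff_mollify ρ (hψ.locallyIntegrable hp1)
  have hsupp : tsupport (mollify ρ ψ) ⊆ closedBall z (r + R) := tsupport_mollify_subset ρ hz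
  have hsub : closedBall z (r + R) ⊆ ball z s := by
    refine closedBall_subset_ball ?_
    have : R ≤ (s - r) / 2 := min_le_right _ _
    linarith
  have hsymm : ∀ {f g : Space d → ℝ}, eLpNorm (fun x => f x - g x) p volume
      = eLpNorm (fun x => g x - f x) p volume := fun {f g} => eLpNorm_sub_comm f g p volume
  refine ⟨mollify ρ ψ, ⟨hφ, ?_, hsupp.trans hsub⟩, ?_, ?_⟩
  · exact (isCompact_closedBall z (r + R)).of_isClosed_subset (isClosed_tsupport _) hsupp
  · rw [hsymm]
    refine (eLpNorm_mollify_sub_le ρ hp1 hp hψ fun t ht => hδ' t ?_).trans hε'1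
    exact ht.trans_le ((min_le_left _ _).trans (min_le_left _ _))
  · have hm : AEStronglyMeasurable (fun x => Dψ x - gradient (mollify ρ ψ) x) volume :=
      hD.1.sub (continuous_gradient hφ).aestronglyMeasurable
    refine (eLpNorm_le_sum_coord hp1 hm).trans ?_
    have hb : ∀ i, eLpNorm (fun x => (Dψ x - gradient (mollify ρ ψ) x) i) p volume ≤ ε' := by
      intro i
      have e : (fun x => (Dψ x - gradient (mollify ρ ψ) x) i)
          = fun x => Dψ x i - mollify ρ (fun x => Dψ x i) x := by
        ext x
        rw [← fderiv_mollify ρ (h i) x, ← gradient_apply]; rfl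
      rw [e, hsymm]
      refine eLpNorm_mollify_sub_le ρ hp1 hp (memLp_coord hD i) fun t ht => hδi' i t ?_
      exact ht.trans_le ((min_le_left _ _).trans ((min_le_right _ _).trans (hle i)))
    calc _ ≤ ∑ _i : Fin d, ε' := Finset.sum_le_sum fun i _ => hb i
      _ = d * ε' := by simp
      _ ≤ (d + 1) * ε' := by gcongr; simp
      _ = ε := ENNReal.mul_div_cancel (by simp) (by finiteness)

/-! ### Radial cutoff functions -/

section Cutoff

/-- The derivative is continuous, hence bounded on `[0, 1]`, and it vanishes elsewhere. This
one-dimensional constant makes the cutoff bounds independent of the dimension. -/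
lemma exists_lipschitzWith_smoothTransition : ∃ K : NNReal, LipschitzWith K Real.smoothTransition := by
  have hc : Continuous (deriv Real.smoothTransition) :=
    (Real.smoothTransition.contDiff (n := 1)).continuous_deriv (by simp)
  obtain ⟨K, hK⟩ := isCompact_Icc.exists_bound_of_continuousOn (s := Set.Icc (0:ℝ) 1) hc.continuousOn
  refine ⟨K.toNNReal, lipschitzWith_of_nnnorm_deriv_le
    ((Real.smoothTransition.contDiff (n := 1)).differentiable (by simp)) fun x => ?_⟩
  rw [← NNReal.coe_le_coe, coe_nnnorm]
  by_cases hx : x ∈ Set.Icc (0 : ℝ) 1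
  · exact (hK x hx).trans (Real.le_coe_toNNReal _)
  · have : deriv Real.smoothTransition x = 0 := by
      rw [Set.mem_Icc, not_and_or, not_le, not_le] at hx
      rcases hx with hx | hx
      · have : Real.smoothTransition =ᶠ[𝓝 x] fun _ => 0 := by
          filter_upwards [Iio_mem_nhds hx] with y hy
          exact Real.smoothTransition.zero_of_nonpos (le_of_lt hy)
        rw [this.deriv_eq]; simp
      · have : Real.smoothTransition =ᶠ[𝓝 x] fun _ => 1 := by
          filter_upwards [Ioi_mem_nhds hx] with y hy
          exact Real.smoothTransition.one_of_one_le (le_of_lt hy)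
        rw [this.deriv_eq]; simp
    simp [this]

/-- Radial cutoff functions with the natural gradient bound. -/
lemma exists_cutoff : ∃ c : ℝ, 0 < c ∧ ∀ (d : ℕ) (z : Space d) (r s : ℝ), 0 < r → r < s →
    ∃ η : Space d → ℝ, ContDiff ℝ ∞ η ∧ (∀ x, 0 ≤ η x) ∧ (∀ x, η x ≤ 1) ∧
      (∀ x ∈ closedBall z r, η x = 1) ∧ (∀ x, x ∉ ball z s → η x = 0) ∧
      (∀ x, ‖gradient η x‖ ≤ c / (s - r)) ∧ tsupport η ⊆ closedBall z s ∧
      (∀ x, gradient η x ≠ 0 → x ∈ closedBall z s \ ball z r) := by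
  obtain ⟨K, hK⟩ := exists_lipschitzWith_smoothTransition
  refine ⟨K + 1, by positivity, fun d z r s hr hrs => ?_⟩
  have hsr : 0 < s - r := by linarith
  -- The argument of the profile is at least `1` for `‖x - z‖ ≤ r` and at most `0` for `‖x - z‖ ≥
  -- s`.
  set η : Space d → ℝ := fun x => Real.smoothTransition ((s - ‖x - z‖) / (s - r)) with hη
  have h1 : ∀ x ∈ closedBall z r, η x = 1 := by
    intro x hx
    rw [mem_closedBall, dist_eq_norm] at hx
    exact Real.smoothTransition.one_of_one_le ((one_le_div hsr).2 (by linarith))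
  have h0 : ∀ x, x ∉ ball z s → η x = 0 := by
    intro x hx
    rw [mem_ball, dist_eq_norm, not_lt] at hx
    exact Real.smoothTransition.zero_of_nonpos (div_nonpos_of_nonpos_of_nonneg (by linarith) hsr.le)
  have hsupp : tsupport η ⊆ closedBall z s := by
    refine closure_minimal ?_ isClosed_closedBall
    intro x hx
    by_contra hx'
    exact hx (h0 x fun h => hx' (ball_subset_closedBall h))
  have hlip : LipschitzWith (K * (s - r)⁻¹.toNNReal) η := by
    refine hK.comp ?_
    refine LipschitzWith.of_dist_le_mul fun x y => ?_
    rw [Real.coe_toNNReal _ (by positivity), Real.dist_eq, ← sub_div, abs_div, abs_of_pos hsr,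
      div_eq_inv_mul, dist_eq_norm]
    gcongr
    have := abs_norm_sub_norm_le (y - z) (x - z)
    rw [show s - ‖x - z‖ - (s - ‖y - z‖) = ‖y - z‖ - ‖x - z‖ by ring]
    rw [show x - y = -((y - z) - (x - z)) by abel, norm_neg]
    exact this
  have hconst : ∀ x ∈ ball z r, η =ᶠ[𝓝 x] fun _ => 1 := by
    intro x hx
    filter_upwards [isOpen_ball.mem_nhds hx] with y hy
    exact h1 y (ball_subset_closedBall hy)
  refine ⟨η, ?_, fun x => Real.smoothTransition.nonneg _, fun x => Real.smoothTransition.le_one _,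
    h1, h0, ?_, hsupp, ?_⟩
  · rw [contDiff_iff_contDiffAt]
    intro x
    -- Near the centre `η` is locally constant, so that the singularity of the norm at `z` is never
    -- met.
    by_cases hx : x ∈ ball z r
    · exact contDiffAt_const.congr_of_eventuallyEq (hconst x hx)
    · have hne : x - z ≠ 0 := by
        intro h
        rw [mem_ball, dist_eq_norm, h, norm_zero] at hx
        exact hx hr
      refine Real.smoothTransition.contDiff.contDiffAt.comp x ?_
      refine ContDiffAt.div_const (contDiffAt_const.sub ?_) _
      exact (contDiffAt_norm ℝ hne).comp x (contDiffAt_id.sub contDiffAt_const)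
  · intro x
    rw [norm_gradient]
    refine (norm_fderiv_le_of_lipschitz ℝ hlip).trans ?_
    rw [NNReal.coe_mul, Real.coe_toNNReal _ (by positivity), div_eq_mul_inv]
    gcongr; linarith
  · intro x hx
    refine ⟨?_, fun h => hx ?_⟩
    · by_contra h
      exact hx (gradient_eq_zero_of_notMem_tsupport fun h' => h (hsupp h'))
    · have : fderiv ℝ η x = 0 := by rw [(hconst x h).fderiv_eq]; simp
      simp [gradient, this]

end Cutoff

end GreenEstimates

namespace GreenEstimates


/-! ### Local approximation by test functions -/

variable {d : ℕ}

lemma memLp_smul_of_support {X F : Type*} [TopologicalSpace X] [MeasurableSpace X]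
    [OpensMeasurableSpace X] [SecondCountableTopology X]
    [NormedAddCommGroup F] [NormedSpace ℝ F] {μ : Measure X} {U : Set X} (hU : MeasurableSet U)
    {p : ENNReal} {f : X → F} (hf : MemLp f p (μ.restrict U)) {k : X → ℝ} (hk : Continuous k)
    (hc : HasCompactSupport k) (hs : ∀ x ∉ U, k x = 0) : MemLp (fun x => k x • f x) p μ := by
  obtain ⟨C, hC⟩ := hc.exists_bound_of_continuous hk
  have e : (fun x => k x • f x) = U.indicator (fun x => k x • f x) := by
    ext x; by_cases hx : x ∈ U
    · simp [hx]
    · simp [hx, hs x hx]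
  rw [e, memLp_indicator_iff_restrict hU]
  refine hf.of_le_mul (c := C) (hk.aestronglyMeasurable.smul hf.1) (Filter.Eventually.of_forall ?_)
  intro x
  rw [norm_smul]
  gcongr; exact hC x

lemma memLp_smul_of_support' {X F : Type*} [TopologicalSpace X] [MeasurableSpace X]
    [BorelSpace X] [SecondCountableTopology X]
    [NormedAddCommGroup F] [NormedSpace ℝ F] {μ : Measure X} {U : Set X} (hU : MeasurableSet U)
    {p : ENNReal} {f : X → ℝ} (hf : MemLp f p (μ.restrict U)) {k : X → F} (hk : Continuous k)
    (hc : HasCompactSupport k) (hs : ∀ x ∉ U, k x = 0) : MemLp (fun x => f x • k x) p μ := by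
  obtain ⟨C, hC⟩ := hc.exists_bound_of_continuous hk
  have e : (fun x => f x • k x) = U.indicator (fun x => f x • k x) := by
    ext x; by_cases hx : x ∈ U
    · simp [hx]
    · simp [hx, hs x hx]
  rw [e, memLp_indicator_iff_restrict hU]
  refine hf.of_le_mul (c := C) (hf.1.smul hk.aestronglyMeasurable) (Filter.Eventually.of_forall ?_)
  intro x
  rw [norm_smul, mul_comm]
  gcongr; exact hC x

lemma HasWeakGradient.mono {U U' : Set (Space d)} {u : Space d → ℝ} {Du : Space d → Space d}
    (h : HasWeakGradient U u Du) (hU : U' ⊆ U) : HasWeakGradient U' u Du :=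
  fun i => (h i).mono hU

lemma HasWeakGradient.mul_test {U : Set (Space d)} {u η : Space d → ℝ} {Du : Space d → Space d}
    (h : HasWeakGradient U u Du) (hη : IsTestFunction U η) :
    HasWeakGradient Set.univ (fun x => u x * η x)
      (fun x => η x • Du x + u x • gradient η x) := by
  intro i
  have := (h i).mul_test hη
  convert this using 2 with x
  simp only [PiLp.add_apply, PiLp.smul_apply, smul_eq_mul, gradient_apply]
  ring

/-- Multiply by a cutoff supported strictly inside `ball z s` and approximate the compactly
supported product. On `ball z r` the cutoff is `1` with vanishing gradient, so neither the function
nor its gradient has changed there. -/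
lemma exists_local_approx {z : Space d} {r s : ℝ} (hr : 0 < r) (hrs : r < s) {u : Space d → ℝ}
    {Du : Space d → Space d} (h : HasWeakGradient (ball z s) u Du)
    {p : ENNReal} (hp1 : 1 ≤ p) (hp : p ≠ ⊤)
    (hu : MemLp u p (volume.restrict (ball z s))) (hD : MemLp Du p (volume.restrict (ball z s)))
    {ε : ENNReal} (hε : 0 < ε) :
    ∃ φ, IsTestFunction (ball z s) φ ∧
      eLpNorm (fun x => u x - φ x) p (volume.restrict (ball z r)) ≤ ε ∧
      eLpNorm (fun x => Du x - gradient φ x) p (volume.restrict (ball z r)) ≤ ε := by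
  obtain ⟨c, -, hc⟩ := exists_cutoff
  obtain ⟨η, h1, -, -, h4, h5, -, h7, h8⟩ := hc d z r ((r + s) / 2) hr (by linarith)
  have hsub : closedBall z ((r + s) / 2) ⊆ ball z s := closedBall_subset_ball (by linarith)
  have hη : IsTestFunction (ball z s) η := by
    refine ⟨h1, ?_, h7.trans hsub⟩
    exact (isCompact_closedBall z _).of_isClosed_subset (isClosed_tsupport _) h7
  obtain ⟨φ, hφ, e1, e2⟩ := exists_test_approx (z := z) (r := (r + s) / 2) (s := s) (by linarith)
    (h.mul_test hη) (fun x hx => by rw [h5 x fun h => hx (ball_subset_closedBall h), mul_zero])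
    hp1 hp (by
      have := memLp_smul_of_support measurableSet_ball hu hη.continuous hη.2.1
        (fun x hx => hη.eq_zero hx)
      simpa [mul_comm] using this)
    ((memLp_smul_of_support measurableSet_ball hD hη.continuous hη.2.1
        (fun x hx => hη.eq_zero hx)).add
      (memLp_smul_of_support' measurableSet_ball hu (continuous_gradient h1)
        hη.hasCompactSupport_gradient (fun x hx => hη.gradient_eq_zero hx))) hε
  refine ⟨φ, hφ, ?_, ?_⟩
  · refine le_trans (le_of_eq (eLpNorm_congr_ae ?_)) ((eLpNorm_restrict_le _ p volume (ball z r)).trans e1)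
    filter_upwards [ae_restrict_mem measurableSet_ball] with x hx
    rw [h4 x (ball_subset_closedBall hx), mul_one]
  · refine le_trans (le_of_eq (eLpNorm_congr_ae ?_)) ((eLpNorm_restrict_le _ p volume (ball z r)).trans e2)
    filter_upwards [ae_restrict_mem measurableSet_ball] with x hx
    have : gradient η x = 0 := by
      by_contra hne
      exact (h8 x hne).2 hx
    rw [h4 x (ball_subset_closedBall hx), this]
    simp

/-! ### Translations are controlled by the gradient -/

section Translation

lemma eLpNorm_fun_sub_comm {X F : Type*} [MeasurableSpace X] [NormedAddCommGroup F]
    {p : ENNReal} {μ : Measure X} (f g : X → F) :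
    eLpNorm (fun x => f x - g x) p μ = eLpNorm (fun x => g x - f x) p μ :=
  eLpNorm_sub_comm f g p μ

lemma measurePreserving_add_right_restrict_ball (z w : Space d) (r : ℝ) :
    MeasurePreserving (fun x => x + w) (volume.restrict (ball z r))
      (volume.restrict (ball (z + w) r)) := by
  have := (measurePreserving_add_right volume w).restrict_preimage
    (measurableSet_ball (x := z + w) (ε := r))
  have hpre : (fun x => x + w) ⁻¹' ball (z + w) r = ball z r := by
    ext x; simp
  rwa [hpre] at this

lemma ball_add_subset {z w : Space d} {r s : ℝ} (h : r + ‖w‖ ≤ s) : ball (z + w) r ⊆ ball z s :=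
  ball_subset_ball' (by simpa using h)

lemma eLpNorm_translate_le {F : Type*} [NormedAddCommGroup F] {p : ENNReal} {z w : Space d}
    {r s : ℝ} (h : r + ‖w‖ ≤ s) {g : Space d → F}
    (hg : AEStronglyMeasurable g (volume.restrict (ball z s))) :
    eLpNorm (fun x => g (x + w)) p (volume.restrict (ball z r))
      ≤ eLpNorm g p (volume.restrict (ball z s)) := by
  have hsub := ball_add_subset (z := z) h
  have := eLpNorm_comp_measurePreserving (p := p) (hg.mono_measure (Measure.restrict_mono_set volume hsub))
    (measurePreserving_add_right_restrict_ball z w r)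
  calc _ = eLpNorm g p (volume.restrict (ball (z + w) r)) := this
    _ ≤ _ := eLpNorm_mono_measure g (Measure.restrict_mono_set volume hsub)

/-- The increment is the mean over `t ∈ (0, 1]` of the derivative at `x + t • w` in the direction
`w`. Minkowski's inequality takes the norm inside, and every translate of `ball z r` that occurs
lies in `ball z s`. -/
lemma eLpNorm_translate_sub_le_of_contDiff {p : ENNReal} (hp1 : 1 ≤ p) (hp : p ≠ ⊤)
    {z w : Space d} {r s : ℝ} (h : r + ‖w‖ ≤ s) {φ : Space d → ℝ} (hφ : ContDiff ℝ ∞ φ) :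
    eLpNorm (fun x => φ (x + w) - φ x) p (volume.restrict (ball z r))
      ≤ ENNReal.ofReal ‖w‖ * eLpNorm (gradient φ) p (volume.restrict (ball z s)) := by
  have hcf : Continuous (fderiv ℝ φ) := hφ.continuous_fderiv (by simp)
  have hc2 : Continuous (fun q : ℝ × Space d => fderiv ℝ φ (q.2 + q.1 • w) w) := by fun_prop
  have hrep : ∀ x, φ (x + w) - φ x
      = ∫ t in Set.Ioc (0 : ℝ) 1, fderiv ℝ φ (x + t • w) w := by
    intro x
    rw [← intervalIntegral.integral_of_le zero_le_one]
    have hd : ∀ t ∈ Set.uIcc (0 : ℝ) 1, HasDerivAt (fun t : ℝ => φ (x + t • w))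
        (fderiv ℝ φ (x + t • w) w) t := by
      intro t _
      have h1 : HasDerivAt (fun t : ℝ => x + t • w) w t := by
        simpa using ((hasDerivAt_id t).smul_const w).const_add x
      exact ((hφ.differentiable (by simp) _).hasFDerivAt).comp_hasDerivAt t h1
    rw [intervalIntegral.integral_eq_sub_of_hasDerivAt hd]
    · simp
    · exact (by fun_prop : Continuous fun t : ℝ => fderiv ℝ φ (x + t • w) w).intervalIntegrable _ _
  have hprob : IsProbabilityMeasure (volume.restrict (Set.Ioc (0 : ℝ) 1)) := ⟨by simp⟩
  simp only [hrep]
  refine eLpNorm_integral_le hp1 hp hc2.aestronglyMeasurable ?_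
  filter_upwards [ae_restrict_mem measurableSet_Ioc] with t ht
  have hle : r + ‖t • w‖ ≤ s := by
    rw [norm_smul, Real.norm_of_nonneg ht.1.le]
    have : t * ‖w‖ ≤ 1 * ‖w‖ := by gcongr; exact ht.2
    linarith
  calc eLpNorm (fun x => fderiv ℝ φ (x + t • w) w) p (volume.restrict (ball z r))
      ≤ eLpNorm (fun y => fderiv ℝ φ y w) p (volume.restrict (ball z s)) :=
        eLpNorm_translate_le (g := fun y => fderiv ℝ φ y w) hle
          (by fun_prop : Continuous fun y => fderiv ℝ φ y w).aestronglyMeasurable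
    _ ≤ _ := by
        refine eLpNorm_le_mul_eLpNorm_of_ae_le_mul (Filter.Eventually.of_forall fun x => ?_) p
        rw [norm_gradient, mul_comm]
        exact (fderiv ℝ φ x).le_opNorm w

/-- The smooth case, by local approximation. The strict inequality `r + ‖w‖ < s` leaves room to
approximate on the ball of radius `a = r + ‖w‖`, which contains both `x` and `x + w`. -/
lemma eLpNorm_translate_sub_le {p : ENNReal} (hp1 : 1 ≤ p) (hp : p ≠ ⊤) {z w : Space d}
    {r s : ℝ} (hr : 0 < r) (h : r + ‖w‖ < s) {u : Space d → ℝ} {Du : Space d → Space d}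
    (hw : HasWeakGradient (ball z s) u Du) (hu : MemLp u p (volume.restrict (ball z s)))
    (hD : MemLp Du p (volume.restrict (ball z s))) :
    eLpNorm (fun x => u (x + w) - u x) p (volume.restrict (ball z r))
      ≤ ENNReal.ofReal ‖w‖ * eLpNorm Du p (volume.restrict (ball z s)) := by
  set a := r + ‖w‖ with ha
  have ha0 : 0 < a := by positivity
  have hsub : ball z a ⊆ ball z s := ball_subset_ball h.le
  have hsub' : ball z r ⊆ ball z a := ball_subset_ball (by rw [ha]; simp)
  have hua : AEStronglyMeasurable u (volume.restrict (ball z a)) :=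
    hu.1.mono_measure (Measure.restrict_mono_set volume hsub)
  have hDa : AEStronglyMeasurable Du (volume.restrict (ball z a)) :=
    hD.1.mono_measure (Measure.restrict_mono_set volume hsub)
  have key : ∀ ε : ENNReal, 0 < ε →
      eLpNorm (fun x => u (x + w) - u x) p (volume.restrict (ball z r))
      ≤ (ε + ENNReal.ofReal ‖w‖ * (eLpNorm Du p (volume.restrict (ball z s)) + ε)) + ε := by
    intro ε hε
    obtain ⟨φ, hφ, e1, e2⟩ := exists_local_approx ha0 h hw hp1 hp hu hD hε
    have m1 : AEStronglyMeasurable (fun x => u x - φ x) (volume.restrict (ball z a)) :=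
      hua.sub hφ.continuous.aestronglyMeasurable
    have m1' : AEStronglyMeasurable (fun x => u (x + w) - φ (x + w)) (volume.restrict (ball z r)) := by
      have : AEStronglyMeasurable (fun x => u x - φ x) (volume.restrict (ball (z + w) r)) :=
        m1.mono_measure (Measure.restrict_mono_set volume (ball_add_subset le_rfl))
      exact this.comp_measurePreserving (measurePreserving_add_right_restrict_ball z w r)
    have m2 : AEStronglyMeasurable (fun x => φ (x + w) - φ x) (volume.restrict (ball z r)) := by
      have := hφ.continuous
      exact (by fun_prop : Continuous (fun x => φ (x + w) - φ x)).aestronglyMeasurable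
    have m3 : AEStronglyMeasurable (fun x => φ x - u x) (volume.restrict (ball z r)) :=
      (hφ.continuous.aestronglyMeasurable).sub
        (hua.mono_measure (Measure.restrict_mono_set volume hsub'))
    have e : (fun x => u (x + w) - u x) = (fun x => u (x + w) - φ (x + w))
        + (fun x => φ (x + w) - φ x) + (fun x => φ x - u x) := by
      ext x; simp
    rw [e]
    refine (eLpNorm_add_le (m1'.add m2) m3 hp1).trans ?_
    gcongr
    · refine (eLpNorm_add_le m1' m2 hp1).trans ?_
      gcongr
      · exact (eLpNorm_translate_le (g := fun x => u x - φ x) le_rfl m1).trans e1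
      · refine (eLpNorm_translate_sub_le_of_contDiff hp1 hp le_rfl hφ.1).trans ?_
        gcongr
        have e' : gradient φ = Du + fun x => gradient φ x - Du x := by ext x; simp
        rw [e']
        refine (eLpNorm_add_le hDa ((continuous_gradient hφ.1).aestronglyMeasurable.sub hDa) hp1).trans ?_
        gcongr
        exact (eLpNorm_fun_sub_comm _ _).trans_le e2
    · refine (eLpNorm_fun_sub_comm _ _).trans_le ?_
      exact (eLpNorm_mono_measure _ (Measure.restrict_mono_set volume hsub')).trans e1
  have hlim : Filter.Tendsto (fun ε : ENNReal => (ε + ENNReal.ofReal ‖w‖ *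
      (eLpNorm Du p (volume.restrict (ball z s)) + ε)) + ε) (𝓝[>] 0)
      (𝓝 ((0 + ENNReal.ofReal ‖w‖ * (eLpNorm Du p (volume.restrict (ball z s)) + 0)) + 0)) := by
    have hid : Filter.Tendsto (fun ε : ENNReal => ε) (𝓝[>] 0) (𝓝 0) := nhdsWithin_le_nhds
    refine (hid.add (ENNReal.Tendsto.const_mul (hid.const_add _) (Or.inr ENNReal.ofReal_ne_top))).add hid
  simp only [zero_add, add_zero] at hlim
  refine ge_of_tendsto hlim ?_
  filter_upwards [self_mem_nhdsWithin] with ε hε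
  have := key ε hε
  simpa using this

end Translation

end GreenEstimates

namespace GreenEstimates


/-! ### Ball averages and Poincaré inequalities -/

variable {d : ℕ}

lemma volume_ball_eq (hd : 0 < d) (z : Space d) {r : ℝ} (hr : 0 ≤ r) :
    volume (ball z r) = ENNReal.ofReal (r ^ d) * volume (ball (0 : Space d) 1) := by
  have : Nonempty (Fin d) := ⟨⟨0, hd⟩⟩
  rw [Measure.addHaar_ball volume z hr]
  simp

lemma setAverage_ball_eq (u : Space d → ℝ) (x : Space d) (h : ℝ) :
    ⨍ t in ball x h, u t = ⨍ t in ball 0 h, u (t + x) := by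
  have hmp := measurePreserving_add_right_restrict_ball (0 : Space d) x h
  rw [zero_add] at hmp
  rw [setAverage_eq, setAverage_eq]
  congr 1
  · rw [Measure.real, Measure.real, Measure.addHaar_ball_center]
  · rw [← hmp.map_eq, (measurableEmbedding_addRight x).integral_map]

/-- The deviation from the moving average is the mean over `‖t‖ < h` of `u x - u (x + t)`, so
Minkowski's inequality reduces it to translations by less than `h`. -/
lemma eLpNorm_sub_average_le {p : ENNReal} (hp1 : 1 ≤ p) (hp : p ≠ ⊤) {z : Space d}
    {r h s : ℝ} (hr : 0 < r) (hh : 0 < h) (hs : r + h < s) {u : Space d → ℝ}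
    {Du : Space d → Space d}
    (hw : HasWeakGradient (ball z s) u Du) (hu : MemLp u p (volume.restrict (ball z s)))
    (hD : MemLp Du p (volume.restrict (ball z s))) :
    eLpNorm (fun x => u x - ⨍ t in ball x h, u t) p (volume.restrict (ball z r))
      ≤ ENNReal.ofReal h * eLpNorm Du p (volume.restrict (ball z s)) := by
  have hv0 : volume (ball (0 : Space d) h) ≠ 0 := (measure_ball_pos volume 0 hh).ne'
  have hvt : volume (ball (0 : Space d) h) ≠ ⊤ := measure_ball_lt_top.ne
  set m : Measure (Space d) := (volume (ball (0 : Space d) h))⁻¹ • volume.restrict (ball 0 h) with hm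
  have hprob : IsProbabilityMeasure m :=
    ⟨by simp [hm, ENNReal.inv_mul_cancel hv0 hvt]⟩
  set ũ : Space d → ℝ := (ball z s).indicator u with hũ
  have hũL : MemLp ũ p volume := (memLp_indicator_iff_restrict measurableSet_ball).2 hu
  have hrep : ∀ x ∈ ball z r, u x - ⨍ t in ball x h, u t = ∫ t, (ũ x - ũ (x + t)) ∂m := by
    intro x hx
    have hsub : ball x h ⊆ ball z s := ball_subset_ball' (by
      rw [mem_ball] at hx; linarith)
    have hxs : x ∈ ball z s := ball_subset_ball (by linarith) hx
    have hint : Integrable (fun t => ũ (x + t)) m := by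
      have h1 : IntegrableOn ũ (ball x h) :=
        (hũL.locallyIntegrable hp1).integrableOn_isCompact (isCompact_closedBall x h)
          |>.mono_set ball_subset_closedBall
      have hmp := measurePreserving_add_right_restrict_ball (0 : Space d) x h
      rw [zero_add] at hmp
      have h2 := hmp.integrable_comp_of_integrable h1
      refine Integrable.smul_measure ?_ (by simp [hv0])
      simpa [Function.comp_def, add_comm] using h2
    rw [integral_sub (integrable_const _) hint]
    have e1 : ∫ _t : Space d, ũ x ∂m = u x := by simp [hũ, hxs]
    rw [e1, setAverage_ball_eq]
    congr 1
    rw [average_eq', hm]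
    simp only [Measure.restrict_apply_univ]
    rw [integral_smul_measure, integral_smul_measure]
    congr 1
    refine setIntegral_congr_fun measurableSet_ball fun t ht => ?_
    have : x + t ∈ ball z s := hsub (by simpa using ht)
    simp only [hũ, Set.indicator_of_mem this, add_comm t x]
  have e0 : eLpNorm (fun x => u x - ⨍ t in ball x h, u t) p (volume.restrict (ball z r))
      = eLpNorm (fun x => ∫ t, (ũ x - ũ (x + t)) ∂m) p (volume.restrict (ball z r)) := by
    refine eLpNorm_congr_ae ?_
    filter_upwards [ae_restrict_mem measurableSet_ball] with x hx using hrep x hx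
  rw [e0]
  refine eLpNorm_integral_le hp1 hp ?_ ?_
  · have hac : m ≪ volume :=
      (Measure.smul_absolutelyContinuous).trans Measure.restrict_le_self.absolutelyContinuous
    refine AEStronglyMeasurable.mono_ac
      (hac.prod (Measure.restrict_le_self.absolutelyContinuous : volume.restrict (ball z r) ≪ volume)) ?_
    refine AEStronglyMeasurable.sub hũL.1.comp_snd ?_
    have hq : Measure.QuasiMeasurePreserving (fun q : Space d × Space d => q.2 + q.1)
        (volume.prod volume) volume := by
      have := (quasiMeasurePreserving_add (volume : Measure (Space d)) volume)
      exact this.comp (Measure.measurePreserving_swap.quasiMeasurePreserving)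
    exact hũL.1.comp_quasiMeasurePreserving hq
  · have : ∀ᵐ t ∂m, t ∈ ball (0 : Space d) h := by
      rw [hm]; exact Measure.smul_absolutelyContinuous.ae_le (ae_restrict_mem measurableSet_ball)
    filter_upwards [this] with t ht
    rw [mem_ball, dist_zero_right] at ht
    have e1 : eLpNorm (fun x => ũ x - ũ (x + t)) p (volume.restrict (ball z r))
        = eLpNorm (fun x => u (x + t) - u x) p (volume.restrict (ball z r)) := by
      rw [eLpNorm_fun_sub_comm]
      refine eLpNorm_congr_ae ?_
      filter_upwards [ae_restrict_mem measurableSet_ball] with x hx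
      have h1 : x ∈ ball z s := ball_subset_ball (by linarith) hx
      have h2 : x + t ∈ ball z s := by
        rw [mem_ball, dist_eq_norm] at hx ⊢
        calc ‖x + t - z‖ = ‖(x - z) + t‖ := by congr 1; abel
          _ ≤ ‖x - z‖ + ‖t‖ := norm_add_le _ _
          _ < s := by linarith
      simp [hũ, h1, h2]
    change eLpNorm (fun x => ũ x - ũ (x + t)) p (volume.restrict (ball z r)) ≤ _
    rw [e1]
    refine (eLpNorm_translate_sub_le hp1 hp hr (by linarith) hw hu hD).trans ?_
    gcongr

lemma lintegral_enorm_rpow_eq_eLpNorm_rpow {X F : Type*} [MeasurableSpace X] {μ : Measure X}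
    [NormedAddCommGroup F] {p : ENNReal} (hp1 : 1 ≤ p) (hp : p ≠ ⊤) (g : X → F) :
    ∫⁻ x, ‖g x‖ₑ ^ p.toReal ∂μ = eLpNorm g p μ ^ p.toReal := by
  have hp0 : p ≠ 0 := (zero_lt_one.trans_le hp1).ne'
  rw [eLpNorm_eq_lintegral_rpow_enorm_toReal hp0 hp, ← ENNReal.rpow_mul, one_div,
    inv_mul_cancel₀ (ENNReal.toReal_pos hp0 hp).ne', ENNReal.rpow_one]

/-- Double difference estimate for pairs of points in two concentric balls. -/
lemma lintegral_lintegral_sub_le {p : ENNReal} (hp1 : 1 ≤ p) (hp : p ≠ ⊤) {z : Space d}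
    {r t s : ℝ} (hr : 0 < r) (ht : r ≤ t) (hs : r + (r + t) < s) {u : Space d → ℝ}
    {Du : Space d → Space d}
    (hw : HasWeakGradient (ball z s) u Du) (hu : MemLp u p (volume.restrict (ball z s)))
    (hD : MemLp Du p (volume.restrict (ball z s))) :
    ∫⁻ y in ball z t, ∫⁻ x in ball z r, ‖u x - u y‖ₑ ^ p.toReal
      ≤ volume (ball (0 : Space d) (r + t)) *
        (ENNReal.ofReal (r + t) * eLpNorm Du p (volume.restrict (ball z s))) ^ p.toReal := by
  set ũ : Space d → ℝ := (ball z s).indicator u with hũ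
  have hũL : MemLp ũ p volume := (memLp_indicator_iff_restrict measurableSet_ball).2 hu
  have hm1 : AEMeasurable (Function.uncurry fun y x : Space d => ‖ũ x - ũ y‖ₑ ^ p.toReal)
      ((volume.restrict (ball z t)).prod (volume.restrict (ball z r))) := by
    have h1 : AEStronglyMeasurable (fun q : Space d × Space d => ũ q.2 - ũ q.1)
      ((volume.restrict (ball z t)).prod (volume.restrict (ball z r))) :=
      (hũL.1.restrict.comp_snd).sub hũL.1.restrict.comp_fst
    exact h1.enorm.pow_const _
  have hm2 : AEMeasurable (Function.uncurry fun x w : Space d => ‖ũ x - ũ (x + w)‖ₑ ^ p.toReal)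
      ((volume.restrict (ball z r)).prod (volume.restrict (ball 0 (r + t)))) := by
    have h1 : AEStronglyMeasurable (fun q : Space d × Space d => ũ q.1 - ũ (q.1 + q.2))
        (volume.prod volume) :=
      hũL.1.comp_fst.sub (hũL.1.comp_quasiMeasurePreserving
        (quasiMeasurePreserving_add (volume : Measure (Space d)) volume))
    have h2 := h1.mono_ac ((Measure.restrict_le_self (μ := volume) (s := ball z r)).absolutelyContinuous.prod
      (Measure.restrict_le_self (μ := volume) (s := ball (0 : Space d) (r + t))).absolutelyContinuous)
    exact h2.enorm.pow_const _
  calc ∫⁻ y in ball z t, ∫⁻ x in ball z r, ‖u x - u y‖ₑ ^ p.toReal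
      = ∫⁻ y in ball z t, ∫⁻ x in ball z r, ‖ũ x - ũ y‖ₑ ^ p.toReal := by
        refine setLIntegral_congr_fun measurableSet_ball fun y hy => ?_
        refine setLIntegral_congr_fun measurableSet_ball fun x hx => ?_
        have h1 : x ∈ ball z s := ball_subset_ball (by linarith) hx
        have h2 : y ∈ ball z s := ball_subset_ball (by linarith) hy
        simp [hũ, h1, h2]
    _ = ∫⁻ x in ball z r, ∫⁻ y in ball z t, ‖ũ x - ũ y‖ₑ ^ p.toReal := by
        exact lintegral_lintegral_swap hm1
    -- Substitute `y = x + w`: for `x ∈ ball z r`, the ball `ball z t` is contained in `ball x (r +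
    -- t)`.
    _ ≤ ∫⁻ x in ball z r, ∫⁻ w in ball 0 (r + t), ‖ũ x - ũ (x + w)‖ₑ ^ p.toReal := by
        refine setLIntegral_mono' measurableSet_ball fun x hx => ?_
        have hmp := measurePreserving_add_right_restrict_ball (0 : Space d) x (r + t)
        rw [zero_add] at hmp
        have e : ∫⁻ w in ball 0 (r + t), ‖ũ x - ũ (x + w)‖ₑ ^ p.toReal
            = ∫⁻ y in ball x (r + t), ‖ũ x - ũ y‖ₑ ^ p.toReal := by
          rw [← hmp.map_eq, (measurableEmbedding_addRight x).lintegral_map]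
          simp only [add_comm]
        rw [e]
        refine lintegral_mono_set (ball_subset_ball' ?_)
        rw [mem_ball, dist_comm] at hx
        linarith
    _ = ∫⁻ w in ball 0 (r + t), ∫⁻ x in ball z r, ‖ũ x - ũ (x + w)‖ₑ ^ p.toReal := by
        exact lintegral_lintegral_swap hm2
    _ ≤ ∫⁻ w in ball (0 : Space d) (r + t),
          (ENNReal.ofReal (r + t) * eLpNorm Du p (volume.restrict (ball z s))) ^ p.toReal := by
        refine setLIntegral_mono' measurableSet_ball fun w hw' => ?_
        rw [mem_ball, dist_zero_right] at hw'
        rw [lintegral_enorm_rpow_eq_eLpNorm_rpow hp1 hp]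
        gcongr
        have e1 : eLpNorm (fun x => ũ x - ũ (x + w)) p (volume.restrict (ball z r))
            = eLpNorm (fun x => u (x + w) - u x) p (volume.restrict (ball z r)) := by
          rw [eLpNorm_fun_sub_comm]
          refine eLpNorm_congr_ae ?_
          filter_upwards [ae_restrict_mem measurableSet_ball] with x hx
          have h1 : x ∈ ball z s := ball_subset_ball (by linarith) hx
          have h2 : x + w ∈ ball z s := by
            rw [mem_ball, dist_eq_norm] at hx ⊢
            calc ‖x + w - z‖ = ‖(x - z) + w‖ := by congr 1; abel
              _ ≤ ‖x - z‖ + ‖w‖ := norm_add_le _ _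
              _ < s := by linarith
          simp [hũ, h1, h2]
        rw [e1]
        refine (eLpNorm_translate_sub_le hp1 hp hr (by linarith) hw hu hD).trans ?_
        gcongr
    _ = _ := by rw [setLIntegral_const, mul_comm]

/-- A Poincaré inequality on balls, with a larger ball on the right-hand side. -/
lemma exists_poincare (hd : 0 < d) {p : ENNReal} (hp1 : 1 ≤ p) (hp : p ≠ ⊤) {z : Space d}
    {r s : ℝ} (hr : 0 < r) (hs : 3 * r < s) {u : Space d → ℝ} {Du : Space d → Space d}
    (hw : HasWeakGradient (ball z s) u Du) (hu : MemLp u p (volume.restrict (ball z s)))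
    (hD : MemLp Du p (volume.restrict (ball z s))) :
    ∃ c : ℝ, eLpNorm (fun x => u x - c) p (volume.restrict (ball z r))
      ≤ ENNReal.ofReal (2 ^ (d + 1) * r) * eLpNorm Du p (volume.restrict (ball z s)) := by
  have hp0 : p ≠ 0 := (zero_lt_one.trans_le hp1).ne'
  have hq0 := ENNReal.toReal_pos hp0 hp
  have hq1 : 1 ≤ p.toReal := by
    rw [← ENNReal.toReal_one]; exact ENNReal.toReal_mono hp hp1
  have hv0 : volume (ball z r) ≠ 0 := (measure_ball_pos volume z hr).ne'
  have hvt : volume (ball z r) ≠ ⊤ := measure_ball_lt_top.ne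
  have hpair := lintegral_lintegral_sub_le hp1 hp hr le_rfl (by linarith) hw hu hD
  have hum : AEStronglyMeasurable u (volume.restrict (ball z r)) :=
    hu.1.mono_measure (Measure.restrict_mono_set volume (ball_subset_ball (by linarith)))
  -- The constant is `u y` for a point `y` at which `∫ |u x - u y|^p dx` does not exceed its mean
  -- over `y`.
  obtain ⟨y, -, hy⟩ := exists_le_setLAverage (μ := volume) (s := ball z r)
    (f := fun y => ∫⁻ x in ball z r, ‖u x - u y‖ₑ ^ p.toReal) hv0 hvt (by
      have : AEMeasurable (fun q : Space d × Space d => ‖u q.2 - u q.1‖ₑ ^ p.toReal)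
        ((volume.restrict (ball z r)).prod (volume.restrict (ball z r))) :=
        ((hum.comp_snd).sub hum.comp_fst).enorm.pow_const _
      exact this.lintegral_prod_right')
  refine ⟨u y, ?_⟩
  rw [setLAverage_eq] at hy
  rw [lintegral_enorm_rpow_eq_eLpNorm_rpow hp1 hp] at hy
  have h2 : eLpNorm (fun x => u x - u y) p (volume.restrict (ball z r)) ^ p.toReal
      ≤ (ENNReal.ofReal (2 ^ (d + 1) * r) * eLpNorm Du p (volume.restrict (ball z s))) ^ p.toReal := by
    refine hy.trans ?_
    refine ENNReal.div_le_of_le_mul (hpair.trans ?_)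
    rw [volume_ball_eq hd _ (by linarith : 0 ≤ r + r), volume_ball_eq hd z hr.le]
    have e1 : ENNReal.ofReal ((r + r) ^ d) = ENNReal.ofReal (2 ^ d) * ENNReal.ofReal (r ^ d) := by
      rw [← ENNReal.ofReal_mul (by positivity)]; congr 1; rw [← two_mul, mul_pow]
    have e2 : ENNReal.ofReal (2 ^ (d + 1) * r) = ENNReal.ofReal (2 ^ d) * ENNReal.ofReal (r + r) := by
      rw [← ENNReal.ofReal_mul (by positivity)]; congr 1; ring
    rw [e1, e2, mul_assoc (ENNReal.ofReal (2 ^ d)) (ENNReal.ofReal (r + r))]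
    generalize ENNReal.ofReal (r + r) * eLpNorm Du p (volume.restrict (ball z s)) = Y
    rw [ENNReal.mul_rpow_of_nonneg _ _ hq0.le]
    -- The factor `2 ^ d` is the ratio of the volumes of the balls of radii `2 r` and `r`; as `p ≥
    -- 1`, it can be put inside the `p`-th power.
    have e3 : ENNReal.ofReal (2 ^ d) ≤ ENNReal.ofReal (2 ^ d) ^ p.toReal := by
      refine ENNReal.le_rpow_self_of_one_le ?_ hq1
      rw [ENNReal.one_le_ofReal]
      exact one_le_pow₀ (by norm_num)
    calc _ = ENNReal.ofReal (2 ^ d) * Y ^ p.toReal * (ENNReal.ofReal (r ^ d) * volume (ball (0 : Space d) 1)) := by ring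
      _ ≤ _ := by gcongr
  exact (ENNReal.rpow_le_rpow_iff hq0).1 h2

end GreenEstimates

namespace GreenEstimates


variable {d : ℕ}

/-! ### The `L²` pairing -/

section L2Pairing

variable {X F : Type*} [MeasurableSpace X] {μ : Measure X} [NormedAddCommGroup F]
  [InnerProductSpace ℝ F]

lemma inner_toLp {f g : X → F} (hf : MemLp f 2 μ) (hg : MemLp g 2 μ) :
    inner ℝ hf.toLp hg.toLp = ∫ x, inner ℝ (f x) (g x) ∂μ := by
  rw [L2.inner_def]
  refine integral_congr_ae ?_
  filter_upwards [hf.coeFn_toLp, hg.coeFn_toLp] with x h1 h2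
  rw [h1, h2]

lemma abs_integral_inner_le {f g : X → F} (hf : MemLp f 2 μ) (hg : MemLp g 2 μ) :
    |∫ x, inner ℝ (f x) (g x) ∂μ| ≤ (eLpNorm f 2 μ).toReal * (eLpNorm g 2 μ).toReal := by
  rw [← inner_toLp hf hg]
  refine (abs_real_inner_le_norm _ _).trans ?_
  rw [Lp.norm_toLp, Lp.norm_toLp]

lemma integrable_inner_of_memLp {f g : X → F} (hf : MemLp f 2 μ) (hg : MemLp g 2 μ) :
    Integrable (fun x => inner ℝ (f x) (g x)) μ := by
  refine (L2.integrable_inner (𝕜 := ℝ) hf.toLp hg.toLp).congr ?_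
  filter_upwards [hf.coeFn_toLp, hg.coeFn_toLp] with x h1 h2
  rw [h1, h2]

/-- Continuity of the pairing in its second argument, arranged for extending a weak formulation from
test functions to their `L²` limits. -/
lemma integral_inner_eq_of_approx {f g : X → F} (hf : MemLp f 2 μ) (hg : MemLp g 2 μ) {a : ℝ}
    (h : ∀ ε : ENNReal, 0 < ε → ∃ g' : X → F, MemLp g' 2 μ ∧
      eLpNorm (fun x => g x - g' x) 2 μ ≤ ε ∧ |(∫ x, inner ℝ (f x) (g' x) ∂μ) - a| ≤ ε.toReal) :
    ∫ x, inner ℝ (f x) (g x) ∂μ = a := by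
  have key : ∀ ε : ℝ, 0 < ε → |(∫ x, inner ℝ (f x) (g x) ∂μ) - a|
      ≤ ((eLpNorm f 2 μ).toReal + 1) * ε := by
    intro ε hε
    obtain ⟨g', hg', h1, h2⟩ := h (ENNReal.ofReal ε) (by simpa using hε)
    rw [ENNReal.toReal_ofReal hε.le] at h2
    have e : ∫ x, inner ℝ (f x) (g x) ∂μ
        = (∫ x, inner ℝ (f x) (g x - g' x) ∂μ) + ∫ x, inner ℝ (f x) (g' x) ∂μ := by
      have h := integral_add (integrable_inner_of_memLp hf (hg.sub hg')) (integrable_inner_of_memLp hf hg')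
      simp only [Pi.sub_apply] at h
      rw [← h]
      congr 1; ext x; rw [← inner_add_right]; simp
    have h3 := abs_integral_inner_le hf (hg.sub hg')
    have h4 : (eLpNorm (g - g') 2 μ).toReal ≤ ε := ENNReal.toReal_le_of_le_ofReal hε.le h1
    calc |(∫ x, inner ℝ (f x) (g x) ∂μ) - a|
        = |(∫ x, inner ℝ (f x) (g x - g' x) ∂μ) + ((∫ x, inner ℝ (f x) (g' x) ∂μ) - a)| := by
          rw [e]; congr 1; ring
      _ ≤ |∫ x, inner ℝ (f x) (g x - g' x) ∂μ| + |(∫ x, inner ℝ (f x) (g' x) ∂μ) - a| := abs_add_le _ _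
      _ ≤ (eLpNorm f 2 μ).toReal * ε + ε := by
          refine add_le_add (h3.trans ?_) h2
          gcongr
      _ = _ := by ring
  rw [← sub_eq_zero, ← abs_nonpos_iff]
  refine le_of_forall_pos_le_add fun ε hε => ?_
  have hpos : 0 < (eLpNorm f 2 μ).toReal + 1 := by positivity
  have := key (ε / ((eLpNorm f 2 μ).toReal + 1)) (by positivity)
  rw [mul_div_cancel₀ _ hpos.ne'] at this
  linarith

end L2Pairing

/-! ### The coefficient field as an operator, and the energy space -/

section Coefficients

variable {lam : ℝ} {A : Space d → Space d →L[ℝ] Space d}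

/-- Transposition changes neither the quadratic form nor the operator norm. -/
lemma IsUniformlyElliptic.adjoint (hA : IsUniformlyElliptic lam A) :
    IsUniformlyElliptic lam (adjointField A) := by
  refine ⟨?_, fun φ hφ => ?_, ?_⟩
  · exact (ContinuousLinearMap.adjoint (𝕜 := ℝ) (E := Space d) (F := Space d)).continuous.comp_aestronglyMeasurable
      hA.aestronglyMeasurable
  · refine (hA.coercive φ hφ).trans (le_of_eq ?_)
    congr 1; ext x
    rw [adjointField, ContinuousLinearMap.adjoint_inner_right, real_inner_comm]
  · filter_upwards [hA.bounded] with x hx ξ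
    have h1 : ‖A x‖ ≤ 1 := ContinuousLinearMap.opNorm_le_bound _ zero_le_one (by simpa using hx)
    have h2 : ‖adjointField A x‖ ≤ 1 := by
      rw [adjointField, LinearIsometryEquiv.norm_map]; exact h1
    simpa using (adjointField A x).le_of_opNorm_le h2 ξ

lemma IsUniformlyElliptic.memLp (hA : IsUniformlyElliptic lam A) {μ : Measure (Space d)}
    (hμ : μ ≪ volume) {p : ENNReal} {F : Space d → Space d} (hF : MemLp F p μ) :
    MemLp (fun x => A x (F x)) p μ := by
  have hm : AEStronglyMeasurable (fun x => A x (F x)) μ :=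
    (ContinuousLinearMap.id ℝ (Space d →L[ℝ] Space d)).aestronglyMeasurable_comp₂
      (hA.aestronglyMeasurable.mono_ac hμ) hF.1
  refine hF.of_le hm ?_
  filter_upwards [hμ hA.bounded] with x hx using hx _

lemma IsUniformlyElliptic.eLpNorm_le (hA : IsUniformlyElliptic lam A) {μ : Measure (Space d)}
    (hμ : μ ≪ volume) {p : ENNReal} (F : Space d → Space d) :
    eLpNorm (fun x => A x (F x)) p μ ≤ eLpNorm F p μ := by
  refine eLpNorm_mono_ae ?_
  filter_upwards [hμ hA.bounded] with x hx using hx _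

/-- The multiplication operator `F ↦ A F` on `L²`. -/
noncomputable def coeffOp (hA : IsUniformlyElliptic lam A) :
    Lp (Space d) 2 (volume : Measure (Space d)) →L[ℝ] Lp (Space d) 2 (volume : Measure (Space d)) :=
  LinearMap.mkContinuous
    { toFun := fun F => (hA.memLp Measure.AbsolutelyContinuous.rfl (Lp.memLp F)).toLp
      map_add' := fun F G => by
        rw [← MemLp.toLp_add]
        refine MemLp.toLp_congr _ _ ?_
        filter_upwards [Lp.coeFn_add F G] with x hx
        rw [hx]; simp
      map_smul' := fun c F => by
        rw [RingHom.id_apply, ← MemLp.toLp_const_smul]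
        refine MemLp.toLp_congr _ _ ?_
        filter_upwards [Lp.coeFn_smul c F] with x hx
        rw [hx]; simp } 1 (fun F => by
      rw [one_mul]
      refine Lp.norm_le_norm_of_ae_le ?_
      have h := (hA.memLp Measure.AbsolutelyContinuous.rfl (Lp.memLp F)).coeFn_toLp
      filter_upwards [h, hA.bounded] with x hx hx'
      simp only [LinearMap.coe_mk, AddHom.coe_mk]
      rw [hx]; exact hx' _)

lemma coeffOp_coeFn (hA : IsUniformlyElliptic lam A)
    (F : Lp (Space d) 2 (volume : Measure (Space d))) :
    coeffOp hA F =ᵐ[volume] fun x => A x (F x) :=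
  (hA.memLp Measure.AbsolutelyContinuous.rfl (Lp.memLp F)).coeFn_toLp

lemma norm_coeffOp_le (hA : IsUniformlyElliptic lam A)
    (F : Lp (Space d) 2 (volume : Measure (Space d))) : ‖coeffOp hA F‖ ≤ ‖F‖ := by
  have := (coeffOp hA).le_of_opNorm_le (LinearMap.mkContinuous_norm_le _ zero_le_one _) F
  simpa using this

lemma inner_coeffOp (hA : IsUniformlyElliptic lam A)
    (F G : Lp (Space d) 2 (volume : Measure (Space d))) :
    inner ℝ G (coeffOp hA F) = ∫ x, inner ℝ (G x) (A x (F x)) := by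
  rw [L2.inner_def]
  refine integral_congr_ae ?_
  filter_upwards [coeffOp_coeFn hA F] with x hx
  rw [hx]

/-- Test functions on `ℝ^d` as a vector space. -/
def testSpace (d : ℕ) : Submodule ℝ (Space d → ℝ) where
  carrier := {φ | IsTestFunction Set.univ φ}
  zero_mem' := ⟨contDiff_const, HasCompactSupport.zero, Set.subset_univ _⟩
  add_mem' := fun h1 h2 => ⟨h1.1.add h2.1, h1.2.1.add h2.2.1, Set.subset_univ _⟩
  smul_mem' := fun c _ h => ⟨contDiff_const.smul h.1, h.2.1.smul_left (f := fun _ => c), Set.subset_univ _⟩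

/-- The gradient of a test function as an element of `L²`. -/
noncomputable def gradLp (d : ℕ) : testSpace d →ₗ[ℝ] Lp (Space d) 2 (volume : Measure (Space d)) where
  toFun := fun φ => (φ.2.memLp_gradient 2 volume).toLp
  map_add' := fun φ ψ => by
    rw [← MemLp.toLp_add]
    refine MemLp.toLp_congr _ _ (Filter.Eventually.of_forall fun x => ?_)
    refine ext_inner_right ℝ fun v => ?_
    have : fderiv ℝ (φ.1 + ψ.1) x = fderiv ℝ φ.1 x + fderiv ℝ ψ.1 x :=
      fderiv_add (φ.2.differentiable x) (ψ.2.differentiable x)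
    simp only [Submodule.coe_add, Pi.add_apply, inner_gradient, inner_add_left, this]
    simp
  map_smul' := fun c φ => by
    rw [RingHom.id_apply, ← MemLp.toLp_const_smul]
    refine MemLp.toLp_congr _ _ (Filter.Eventually.of_forall fun x => ?_)
    refine ext_inner_right ℝ fun v => ?_
    have : fderiv ℝ (c • φ.1) x = c • fderiv ℝ φ.1 x := fderiv_const_smul (φ.2.differentiable x) c
    simp only [Submodule.coe_smul, Pi.smul_apply, inner_gradient, inner_smul_left, this]
    simp

lemma gradLp_coeFn (φ : testSpace d) : gradLp d φ =ᵐ[volume] gradient φ.1 :=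
  (φ.2.memLp_gradient 2 volume).coeFn_toLp

/-- The closure of gradients of test functions in `L²`. -/
noncomputable def energySpace (d : ℕ) : Submodule ℝ (Lp (Space d) 2 (volume : Measure (Space d))) :=
  (LinearMap.range (gradLp d)).topologicalClosure

/-- Both sides are continuous in `L²`, so the inequality survives the closure. No pointwise
ellipticity is assumed, hence coercivity is available only for such limits of gradients and not for
arbitrary fields. -/
lemma coercive_energySpace (hA : IsUniformlyElliptic lam A)
    {F : Lp (Space d) 2 (volume : Measure (Space d))} (hF : F ∈ energySpace d) :
    lam * ‖F‖ ^ 2 ≤ inner ℝ F (coeffOp hA F) := by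
  have hcl : IsClosed {F : Lp (Space d) 2 (volume : Measure (Space d)) |
      lam * ‖F‖ ^ 2 ≤ inner ℝ F (coeffOp hA F)} :=
    isClosed_le (by fun_prop) (continuous_id.inner (coeffOp hA).continuous)
  refine closure_minimal ?_ hcl hF
  rintro _ ⟨φ, rfl⟩
  have h := hA.coercive φ.1 φ.2
  have e1 : ∫ x, ‖gradient φ.1 x‖ ^ 2 = ‖gradLp d φ‖ ^ 2 := by
    rw [← real_inner_self_eq_norm_sq, L2.inner_def]
    refine integral_congr_ae ?_
    filter_upwards [gradLp_coeFn φ] with x hx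
    rw [hx, real_inner_self_eq_norm_sq]
  have e2 : ∫ x, inner ℝ (gradient φ.1 x) (A x (gradient φ.1 x))
      = inner ℝ (gradLp d φ) (coeffOp hA (gradLp d φ)) := by
    rw [inner_coeffOp]
    refine integral_congr_ae ?_
    filter_upwards [gradLp_coeFn φ] with x hx
    rw [hx]
  rw [Set.mem_ofPred_eq, ← e1, ← e2]; exact h

/-- Compactly supported `H¹` functions are `H¹` limits of test functions; this makes truncations
admissible in coercivity and in the weak equations. -/
lemma toLp_mem_energySpace {z : Space d} {r : ℝ} {ψ : Space d → ℝ}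
    {Dψ : Space d → Space d} (h : HasWeakGradient Set.univ ψ Dψ)
    (hz : ∀ x, x ∉ closedBall z r → ψ x = 0) (hψ : MemLp ψ 2 volume)
    (hD : MemLp Dψ 2 volume) :
    hD.toLp ∈ energySpace d := by
  rw [energySpace, ← SetLike.mem_coe, Submodule.topologicalClosure_coe, EMetric.mem_closure_iff]
  intro ε hε
  obtain ⟨ε', hε', hlt⟩ := exists_between hε
  obtain ⟨φ, hφ, -, h2⟩ := exists_test_approx (lt_add_one r) h hz (by norm_num) (by norm_num) hψ hD hε'
  have hφ' : φ ∈ testSpace d := hφ.mono (Set.subset_univ _)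
  refine ⟨gradLp d ⟨φ, hφ'⟩, ⟨⟨φ, hφ'⟩, rfl⟩, lt_of_le_of_lt ?_ hlt⟩
  exact (Lp.edist_toLp_toLp _ _ hD (hφ'.memLp_gradient 2 volume)).trans_le h2

end Coefficients

end GreenEstimates

namespace GreenEstimates


variable {d : ℕ}

/-! ### Caccioppoli's inequality -/

section Caccioppoli

variable {lam : ℝ} {A : Space d → Space d →L[ℝ] Space d}

/-- Harmonic functions may be tested with compactly supported `H¹` functions. -/
lemma IsHarmonicOn.integral_eq_zero (hA : IsUniformlyElliptic lam A) {z : Space d} {r s : ℝ}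
    (hrs : r < s) {u : Space d → ℝ} {Du : Space d → Space d} (hu : IsHarmonicOn A (ball z s) u Du)
    {ψ : Space d → ℝ} {Dψ : Space d → Space d} (h : HasWeakGradient Set.univ ψ Dψ)
    (hz : ∀ x, x ∉ closedBall z r → ψ x = 0) (hψ : MemLp ψ 2 volume) (hD : MemLp Dψ 2 volume) :
    ∫ x in ball z s, inner ℝ (A x (Du x)) (Dψ x) = 0 := by
  refine integral_inner_eq_of_approx
    (hA.memLp Measure.restrict_le_self.absolutelyContinuous hu.memLp_grad) (hD.restrict _) ?_
  intro ε hε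
  obtain ⟨φ, hφ, -, h2⟩ := exists_test_approx hrs h hz (by norm_num) (by norm_num) hψ hD hε
  refine ⟨gradient φ, (hφ.memLp_gradient 2 volume).restrict _, (eLpNorm_restrict_le _ _ _ _).trans h2, ?_⟩
  rw [hu.eq_zero φ hφ]
  simp

/-- Read with `p = Du`, `q = ∇η`, `a = η`, `b = u`. The left side is the energy density of `∇(ηu)`;
the first term on the right is `A Du · ∇(η²u)`, which integrates to zero for harmonic `u`. What
remains involves only `∇(ηu)` and `u∇η`, with two cross terms because `A` need not be symmetric. -/
lemma energy_identity (L : Space d →L[ℝ] Space d) (p q : Space d) (a b : ℝ) :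
    inner ℝ (a • p + b • q) (L (a • p + b • q))
      = inner ℝ (L p) ((a ^ 2) • p + b • ((2 * a) • q))
        + (inner ℝ (a • p + b • q) (L (b • q)) - inner ℝ (b • q) (L (a • p + b • q))
          + inner ℝ (b • q) (L (b • q))) := by
  simp only [map_add, map_smul, inner_add_left, inner_add_right, inner_smul_left, inner_smul_right]
  simp only [conj_trivial]
  rw [real_inner_comm p (L p), real_inner_comm q (L p)]
  ring

/-- Caccioppoli's inequality. -/
lemma exists_caccioppoli (hlam0 : 0 < lam) (hlam1 : lam < 1) :
    ∃ C : ℝ, 0 < C ∧ ∀ (d : ℕ) (A : Space d → Space d →L[ℝ] Space d),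
      IsUniformlyElliptic lam A → ∀ (z : Space d) (r s : ℝ), 0 < r → r < s →
      ∀ (u : Space d → ℝ) (Du : Space d → Space d), IsHarmonicOn A (ball z s) u Du →
        eLpNorm Du 2 (volume.restrict (ball z r))
          ≤ ENNReal.ofReal (C / (s - r)) * eLpNorm u 2 (volume.restrict (ball z s)) := by
  obtain ⟨c, hc0, hc⟩ := exists_cutoff
  refine ⟨(3 / lam) * (2 * c), by positivity, fun d A hA z r s hr hrs u Du hu => ?_⟩
  -- The support of the cutoff must be compact in the open ball of radius `s`; halving the gap costs
  -- the factor `2` in the constant.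
  set t := (r + s) / 2 with ht
  obtain ⟨η, h1, h2, h3, h4, h5, h6, h7, h8⟩ := hc d z r t hr (by rw [ht]; linarith)
  have hts : t < s := by rw [ht]; linarith
  have hsub : closedBall z t ⊆ ball z s := closedBall_subset_ball hts
  have hη : IsTestFunction (ball z s) η :=
    ⟨h1, (isCompact_closedBall z _).of_isClosed_subset (isClosed_tsupport _) h7, h7.trans hsub⟩
  have hη2 : IsTestFunction (ball z s) (fun x => η x * η x) := hη.mul_left h1
  have hz : ∀ x, x ∉ closedBall z t → η x = 0 := fun x hx =>
    h5 x fun h => hx (ball_subset_closedBall h)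
  have hgrad2 : ∀ x, gradient (fun x => η x * η x) x = (2 * η x) • gradient η x := by
    intro x
    rw [gradient_mul (hη.differentiable x) (hη.differentiable x), ← add_smul]
    congr 1; ring
  have w1 := hu.hasWeakGradient.mul_test hη
  have w2 := hu.hasWeakGradient.mul_test hη2
  have mem : ∀ {k : Space d → ℝ}, IsTestFunction (ball z s) k →
      MemLp (fun x => u x * k x) 2 volume ∧ MemLp (fun x => u x • gradient k x) 2 volume ∧
      MemLp (fun x => k x • Du x) 2 volume := by
    intro k hk
    refine ⟨?_, memLp_smul_of_support' measurableSet_ball hu.memLp (continuous_gradient hk.1)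
        hk.hasCompactSupport_gradient (fun x hx => hk.gradient_eq_zero hx),
      memLp_smul_of_support measurableSet_ball hu.memLp_grad hk.continuous hk.2.1
        (fun x hx => hk.eq_zero hx)⟩
    have := memLp_smul_of_support measurableSet_ball hu.memLp hk.continuous hk.2.1
        (fun x hx => hk.eq_zero hx)
    simpa [mul_comm] using this
  obtain ⟨m1, mW, m3⟩ := mem hη
  obtain ⟨n1, n2, n3⟩ := mem hη2
  have mF := m3.add mW
  have hzero := hu.integral_eq_zero hA hts w2
    (fun x hx => by simp [hz x hx]) n1 (n3.add n2)
  have hFmem := toLp_mem_energySpace (z := z) (r := t) w1 (fun x hx => by simp [hz x hx]) m1 mF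
  have hco := coercive_energySpace hA hFmem
  set F := mF.toLp with hFdef
  set W := mW.toLp with hWdef
  change lam * ‖F‖ ^ 2 ≤ inner ℝ F (coeffOp hA F) at hco
  have hid : inner ℝ F (coeffOp hA F) = inner ℝ F (coeffOp hA W) - inner ℝ W (coeffOp hA F)
      + inner ℝ W (coeffOp hA W) := by
    have hAF := hA.memLp Measure.AbsolutelyContinuous.rfl (Lp.memLp F)
    have hAW := hA.memLp Measure.AbsolutelyContinuous.rfl (Lp.memLp W)
    have i1 := integrable_inner_of_memLp (Lp.memLp F) hAW
    have i2 := integrable_inner_of_memLp (Lp.memLp W) hAF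
    have i3 := integrable_inner_of_memLp (Lp.memLp W) hAW
    have hAη : MemLp (fun x => η x • A x (Du x)) 2 volume :=
      memLp_smul_of_support measurableSet_ball
        (hA.memLp Measure.restrict_le_self.absolutelyContinuous hu.memLp_grad) hη.continuous hη.2.1
        (fun x hx => hη.eq_zero hx)
    have hG : ∀ x, inner ℝ (A x (Du x)) ((η x * η x) • Du x + u x • gradient (fun x => η x * η x) x)
        = inner ℝ (η x • A x (Du x)) (η x • Du x + (2 : ℝ) • u x • gradient η x) := by
      intro x
      rw [hgrad2]
      simp only [inner_add_right, inner_smul_right, inner_smul_left, conj_trivial]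
      ring
    have i0 : Integrable (fun x => inner ℝ (A x (Du x))
        ((η x * η x) • Du x + u x • gradient (fun x => η x * η x) x)) volume := by
      simp only [hG]
      exact integrable_inner_of_memLp hAη (m3.add (mW.const_smul (2 : ℝ)))
    have hzero' : ∫ x, inner ℝ (A x (Du x))
        ((η x * η x) • Du x + u x • gradient (fun x => η x * η x) x) = 0 := by
      rw [← hzero]
      symm
      refine setIntegral_eq_integral_of_forall_compl_eq_zero fun x hx => ?_
      rw [hη2.eq_zero hx, hη2.gradient_eq_zero hx]
      simp
    rw [inner_coeffOp, inner_coeffOp, inner_coeffOp, inner_coeffOp]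
    have h12 : Integrable (fun x => inner ℝ (F x) (A x (W x)) - inner ℝ (W x) (A x (F x))) volume := i1.sub i2
    rw [← integral_sub i1 i2, ← integral_add h12 i3]
    rw [← zero_add (∫ x, (inner ℝ (F x) (A x (W x)) - inner ℝ (W x) (A x (F x))
      + inner ℝ (W x) (A x (W x)))), ← hzero']
    have h123 : Integrable (fun x => inner ℝ (F x) (A x (W x)) - inner ℝ (W x) (A x (F x))
      + inner ℝ (W x) (A x (W x))) volume := h12.add i3
    rw [← integral_add i0 h123]
    refine integral_congr_ae ?_
    filter_upwards [mF.coeFn_toLp, mW.coeFn_toLp] with x hx1 hx2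
    have e := energy_identity (A x) (Du x) (gradient η x) (η x) (u x)
    rw [hx1, hx2, hgrad2, ← sq]
    exact e
  -- If the bound failed, then `‖W‖ ≤ ‖F‖` since `lam < 1`, so the right side of `b4` is at most `3
  -- ‖F‖ ‖W‖`, which is less than `lam ‖F‖²`: a contradiction.
  have hFW : ‖F‖ ≤ 3 / lam * ‖W‖ := by
    have b1 : inner ℝ F (coeffOp hA W) ≤ ‖F‖ * ‖W‖ :=
      (real_inner_le_norm _ _).trans (by gcongr; exact norm_coeffOp_le hA W)
    have b2 : - inner ℝ W (coeffOp hA F) ≤ ‖W‖ * ‖F‖ :=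
      (neg_le_abs _).trans ((abs_real_inner_le_norm _ _).trans (by gcongr; exact norm_coeffOp_le hA F))
    have b3 : inner ℝ W (coeffOp hA W) ≤ ‖W‖ * ‖W‖ :=
      (real_inner_le_norm _ _).trans (by gcongr; exact norm_coeffOp_le hA W)
    have b4 : lam * ‖F‖ ^ 2 ≤ 2 * (‖F‖ * ‖W‖) + ‖W‖ ^ 2 := by
      rw [hid] at hco; linarith
    by_contra hcon
    rw [not_le, div_mul_eq_mul_div, div_lt_iff₀ hlam0] at hcon
    have hF0 := norm_nonneg F
    have hW0 := norm_nonneg W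
    have hWF : ‖W‖ ≤ ‖F‖ := by nlinarith
    have hFpos : 0 < ‖F‖ := by
      by_contra h0
      have : ‖F‖ = 0 := le_antisymm (not_lt.1 h0) hF0
      rw [this] at hcon; linarith
    nlinarith
  have eF : eLpNorm Du 2 (volume.restrict (ball z r)) ≤ ENNReal.ofReal ‖F‖ := by
    rw [hFdef, Lp.norm_toLp, ENNReal.ofReal_toReal mF.2.ne]
    refine le_trans (le_of_eq (eLpNorm_congr_ae ?_))
      (eLpNorm_restrict_le _ 2 volume (ball z r))
    filter_upwards [ae_restrict_mem measurableSet_ball] with x hx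
    have : gradient η x = 0 := by
      by_contra hne
      exact (h8 x hne).2 hx
    simp only [Pi.add_apply, this, h4 x (ball_subset_closedBall hx)]
    simp
  have eW : ENNReal.ofReal ‖W‖ ≤ ENNReal.ofReal (c / (t - r)) * eLpNorm u 2 (volume.restrict (ball z s)) := by
    rw [hWdef, Lp.norm_toLp, ENNReal.ofReal_toReal mW.2.ne]
    have : (fun x => u x • gradient η x) = (ball z s).indicator (fun x => u x • gradient η x) := by
      ext1 x
      by_cases hx : x ∈ ball z s
      · simp [hx]
      · simp [hx, hη.gradient_eq_zero hx]
    rw [this, eLpNorm_indicator_eq_eLpNorm_restrict measurableSet_ball]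
    refine eLpNorm_le_mul_eLpNorm_of_ae_le_mul (Filter.Eventually.of_forall fun x => ?_) 2
    rw [norm_smul, mul_comm]
    gcongr
    exact h6 x
  calc eLpNorm Du 2 (volume.restrict (ball z r)) ≤ ENNReal.ofReal (3 / lam * ‖W‖) :=
        eF.trans (ENNReal.ofReal_le_ofReal hFW)
    _ = ENNReal.ofReal (3 / lam) * ENNReal.ofReal ‖W‖ := ENNReal.ofReal_mul (by positivity)
    _ ≤ ENNReal.ofReal (3 / lam) * (ENNReal.ofReal (c / (t - r)) *
          eLpNorm u 2 (volume.restrict (ball z s))) := by gcongr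
    _ = _ := by
        rw [← mul_assoc, ← ENNReal.ofReal_mul (by positivity)]
        congr 2
        have : t - r = (s - r) / 2 := by rw [ht]; ring
        rw [this]
        field_simp

end Caccioppoli

/-! ### Elementary operations on harmonic functions -/

lemma IsHarmonicOn.mono {A : Space d → Space d →L[ℝ] Space d} {U U' : Set (Space d)}
    {u : Space d → ℝ} {Du : Space d → Space d} (h : IsHarmonicOn A U u Du) (hU : U' ⊆ U) :
    IsHarmonicOn A U' u Du := by
  refine ⟨h.1.mono hU, h.2.mono_measure (Measure.restrict_mono_set _ hU),
    h.3.mono_measure (Measure.restrict_mono_set _ hU), fun φ hφ => ?_⟩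
  rw [← h.4 φ (hφ.mono hU)]
  have key : ∀ S : Set (Space d), U' ⊆ S → ∫ x in S, inner ℝ (A x (Du x)) (gradient φ x)
      = ∫ x, inner ℝ (A x (Du x)) (gradient φ x) := fun S hS =>
    setIntegral_eq_integral_of_forall_compl_eq_zero fun x hx => by
      rw [hφ.gradient_eq_zero fun h => hx (hS h), inner_zero_right]
  rw [key U' subset_rfl, key U hU]

lemma IsHarmonicOn.congr_ae {A : Space d → Space d →L[ℝ] Space d} {U : Set (Space d)}
    {u u' : Space d → ℝ} {Du Du' : Space d → Space d} (h : IsHarmonicOn A U u Du)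
    (hu : u =ᵐ[volume.restrict U] u') (hD : Du =ᵐ[volume.restrict U] Du') :
    IsHarmonicOn A U u' Du' := by
  refine ⟨fun i => (h.1 i).congr_ae hu (hD.mono fun x hx => by simp only [hx]), h.2.ae_eq hu,
    h.3.ae_eq hD, fun φ hφ => ?_⟩
  rw [← h.4 φ hφ]
  refine integral_congr_ae (hD.mono fun x hx => by simp only [hx])

lemma HasWeakDeriv.sub {V : Type*} [NormedAddCommGroup V] [NormedSpace ℝ V] [MeasureSpace V]
    [BorelSpace V] {U : Set V} {v : V} {u w u' w' : V → ℝ}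
    (h : HasWeakDeriv U v u w) (h' : HasWeakDeriv U v u' w') :
    HasWeakDeriv U v (fun x => u x - u' x) (fun x => w x - w' x) := by
  refine hasWeakDeriv_of_integral_eq (h.1.sub h'.1) (h.2.1.sub h'.2.1) fun φ hφ => ?_
  have hv := hφ.fderiv_apply v
  simp only [sub_mul]
  rw [integral_sub (integrable_mul_of_locallyIntegrableOn h.1 hv.continuous hv.2.1 hv.2.2)
    (integrable_mul_of_locallyIntegrableOn h'.1 hv.continuous hv.2.1 hv.2.2),
    integral_sub (integrable_mul_of_locallyIntegrableOn h.2.1 hφ.continuous hφ.2.1 hφ.2.2)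
    (integrable_mul_of_locallyIntegrableOn h'.2.1 hφ.continuous hφ.2.1 hφ.2.2),
    h.integral_eq hφ, h'.integral_eq hφ]
  ring

lemma hasWeakDeriv_of_contDiff {U : Set (Space d)} {v : Space d} {k : Space d → ℝ}
    (hk : ContDiff ℝ ∞ k) : HasWeakDeriv U v k (fun x => fderiv ℝ k x v) := by
  have hkv : Continuous fun x => fderiv ℝ k x v :=
    ((hk.continuous_fderiv (by simp)).clm_apply continuous_const)
  refine hasWeakDeriv_of_integral_eq (hk.continuous.locallyIntegrable.locallyIntegrableOn _)
    (hkv.locallyIntegrable.locallyIntegrableOn _) fun φ hφ => ?_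
  have hv := hφ.fderiv_apply v
  have i : ∀ {f : Space d → ℝ}, Continuous f → ∀ {g}, IsTestFunction U g →
      Integrable (fun x => f x * g x) := fun hf g hg =>
    integrable_mul_of_locallyIntegrableOn (U := U) (hf.locallyIntegrable.locallyIntegrableOn _)
      hg.continuous hg.2.1 hg.2.2
  exact integral_mul_fderiv_eq_neg_fderiv_mul_of_integrable (i hkv hφ) (i hk.continuous hv)
    (i hk.continuous hφ) (fun x _ => hk.differentiable (by simp) x) (fun x _ => hφ.differentiable x)

lemma HasWeakGradient.sub_const {U : Set (Space d)} {u : Space d → ℝ} {Du : Space d → Space d}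
    (h : HasWeakGradient U u Du) (c : ℝ) : HasWeakGradient U (fun x => u x - c) Du := by
  intro i
  have := (h i).sub (hasWeakDeriv_of_contDiff (k := fun _ => c) contDiff_const)
  simpa using this

instance isFiniteMeasure_restrict_ball (z : Space d) (s : ℝ) :
    IsFiniteMeasure (volume.restrict (ball z s)) :=
  isFiniteMeasure_restrict.2 measure_ball_lt_top.ne

lemma IsHarmonicOn.sub_const {A : Space d → Space d →L[ℝ] Space d} {z : Space d} {s : ℝ}
    {u : Space d → ℝ} {Du : Space d → Space d} (h : IsHarmonicOn A (ball z s) u Du) (c : ℝ) :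
    IsHarmonicOn A (ball z s) (fun x => u x - c) Du :=
  ⟨h.1.sub_const c, h.2.sub (memLp_const c), h.3, h.4⟩

end GreenEstimates

namespace GreenEstimates


/-! ### Interior `L²` bounds from averages over small balls -/

variable {d : ℕ}

lemma lintegral_enorm_sq {X F : Type*} [MeasurableSpace X] {μ : Measure X}
    [NormedAddCommGroup F] (g : X → F) : ∫⁻ x, ‖g x‖ₑ ^ 2 ∂μ = eLpNorm g 2 μ ^ 2 := by
  have := lintegral_enorm_rpow_eq_eLpNorm_rpow (μ := μ) (p := 2) (by norm_num) (by norm_num) g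
  simpa [ENNReal.rpow_ofNat] using this

/-- After `n` iterations there remain `B ∑ (q D)^k ≤ 2 B` and the tail `q^n φ n ≤ 2^{-n} M`, which
vanishes because `M` is finite. The inhomogeneity may grow like `D^k` as long as `q` compensates for
it. -/
lemma le_two_mul_of_absorb {φ : ℕ → ENNReal} {B D q M : ENNReal} (hM : M ≠ ⊤)
    (hφM : ∀ k, φ k ≤ M) (hq : q ≤ 2⁻¹) (hqD : q * D ≤ 2⁻¹)
    (h : ∀ k, φ k ≤ B * D ^ k + q * φ (k + 1)) : φ 0 ≤ B * 2 := by
  have claim : ∀ n, φ 0 ≤ B * ∑ k ∈ Finset.range n, (2⁻¹ : ENNReal) ^ k + q ^ n * φ n := by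
    intro n
    induction n with
    | zero => simp
    | succ n ih =>
      calc φ 0 ≤ B * ∑ k ∈ Finset.range n, (2⁻¹ : ENNReal) ^ k + q ^ n * φ n := ih
        _ ≤ B * ∑ k ∈ Finset.range n, (2⁻¹ : ENNReal) ^ k + q ^ n * (B * D ^ n + q * φ (n + 1)) := by
          gcongr; exact h n
        _ = B * ∑ k ∈ Finset.range n, (2⁻¹ : ENNReal) ^ k + B * (q * D) ^ n
            + q ^ (n + 1) * φ (n + 1) := by rw [mul_pow]; ring
        _ ≤ B * ∑ k ∈ Finset.range n, (2⁻¹ : ENNReal) ^ k + B * 2⁻¹ ^ n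
            + q ^ (n + 1) * φ (n + 1) := by gcongr
        _ = _ := by rw [Finset.sum_range_succ]; ring
  have claim2 : ∀ n, φ 0 ≤ B * 2 + 2⁻¹ ^ n * M := by
    intro n
    refine (claim n).trans ?_
    gcongr
    · refine (ENNReal.sum_le_tsum _).trans (le_of_eq ?_)
      rw [ENNReal.tsum_geometric, ENNReal.one_sub_inv_two, inv_inv]
    · exact hφM n
  have hlim : Filter.Tendsto (fun n : ℕ => B * 2 + (2⁻¹ : ENNReal) ^ n * M) Filter.atTop
      (𝓝 (B * 2 + 0 * M)) := by
    refine Filter.Tendsto.const_add _ (ENNReal.Tendsto.mul_const ?_ (Or.inr hM))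
    exact ENNReal.tendsto_pow_atTop_nhds_zero_of_lt_one (by norm_num)
  simpa using ge_of_tendsto hlim (Filter.Eventually.of_forall claim2)

lemma enorm_add_sq_le {F : Type*} [NormedAddCommGroup F] (a b : F) :
    ‖a + b‖ₑ ^ 2 ≤ 2 * ‖a‖ₑ ^ 2 + 2 * ‖b‖ₑ ^ 2 := by
  have h := ENNReal.rpow_add_le_mul_rpow_add_rpow ‖a‖ₑ ‖b‖ₑ (p := 2) (by norm_num)
  have h2 : (2 : ENNReal) ^ ((2 : ℝ) - 1) = 2 := by norm_num
  rw [h2] at h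
  simp only [ENNReal.rpow_ofNat] at h
  calc ‖a + b‖ₑ ^ 2 ≤ (‖a‖ₑ + ‖b‖ₑ) ^ 2 := by gcongr; exact enorm_add_le a b
    _ ≤ _ := by rw [← mul_add]; exact h

/-- The moving ball becomes a fixed measurable set of triples, and the integral becomes a partial
integral of one jointly measurable function. -/
lemma stronglyMeasurable_ball_integral {Y : Type*} [MeasurableSpace Y] {U : Space d → Y → ℝ}
    (hU : StronglyMeasurable (Function.uncurry U)) (h : ℝ) :
    StronglyMeasurable (fun q : Space d × Y => ∫ t in ball q.1 h, U t q.2) := by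
  have e : (fun q : Space d × Y => ∫ t in ball q.1 h, U t q.2)
      = fun q : Space d × Y => ∫ t, {w : (Space d × Y) × Space d | dist w.2 w.1.1 < h}.indicator
        (fun w => U w.2 w.1.2) (q, t) := by
    ext q
    rw [← integral_indicator measurableSet_ball]
    rfl
  rw [e]
  refine StronglyMeasurable.integral_prod_right' (f := {w : (Space d × Y) × Space d |
    dist w.2 w.1.1 < h}.indicator (fun w => U w.2 w.1.2)) ?_
  refine StronglyMeasurable.indicator ?_ ?_
  · exact hU.comp_measurable (g := fun w : (Space d × Y) × Space d => (w.2, w.1.2)) (by fun_prop)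
  · exact measurableSet_lt (by fun_prop) measurable_const

lemma stronglyMeasurable_ball_average {u : Space d → ℝ} (hu : StronglyMeasurable u) (h : ℝ) :
    StronglyMeasurable (fun x => ⨍ t in ball x h, u t) := by
  have h1 := stronglyMeasurable_ball_integral (Y := Unit) (U := fun t _ => u t)
    (hu.comp_measurable measurable_fst) h
  have h2 : StronglyMeasurable fun x : Space d => ∫ t in ball x h, u t :=
    h1.comp_measurable (g := fun x => (x, ())) (by fun_prop)
  have e : (fun x => ⨍ t in ball x h, u t)
      = fun x : Space d => (volume.real (ball (0 : Space d) h))⁻¹ • ∫ t in ball x h, u t := by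
    ext x
    rw [setAverage_eq, Measure.real, Measure.real, Measure.addHaar_ball_center]
  rw [e]
  exact h2.const_mul _

/-- One step of the iteration leading to `exists_interior_family_bound`. -/
lemma IsHarmonicOn.lintegral_sq_le {C₁ : ℝ} (hC₁ : 0 < C₁) {A : Space d → Space d →L[ℝ] Space d}
    (hcac : ∀ (z : Space d) (r s : ℝ), 0 < r → r < s →
      ∀ (u : Space d → ℝ) (Du : Space d → Space d), IsHarmonicOn A (ball z s) u Du →
        eLpNorm Du 2 (volume.restrict (ball z r))
          ≤ ENNReal.ofReal (C₁ / (s - r)) * eLpNorm u 2 (volume.restrict (ball z s)))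
    {z : Space d} {ρ δ ε : ℝ} (hρ : 0 < ρ) (hδ : 0 < δ) (hε : 0 < ε) (hε' : ε ≤ 1 / 4)
    {u : Space d → ℝ} {Du : Space d → Space d} (hum : StronglyMeasurable u)
    (hu : IsHarmonicOn A (ball z (ρ + δ)) u Du) :
    ∫⁻ x in ball z ρ, ‖u x‖ₑ ^ 2
      ≤ 2 * (∫⁻ x in ball z ρ, ‖⨍ t in ball x (ε * δ), u t‖ₑ ^ 2)
        + ENNReal.ofReal (8 * C₁ ^ 2 * ε ^ 2) * ∫⁻ x in ball z (ρ + δ), ‖u x‖ₑ ^ 2 := by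
  have hu' : IsHarmonicOn A (ball z (ρ + δ / 2)) u Du := hu.mono (ball_subset_ball (by linarith))
  have h1 := eLpNorm_sub_average_le (p := 2) (by norm_num) (by norm_num) hρ (mul_pos hε hδ)
    (s := ρ + δ / 2) (by nlinarith) hu'.1 hu'.2 hu'.3
  have h2 := hcac z (ρ + δ / 2) (ρ + δ) (by linarith) (by linarith) u Du hu
  -- The moving average at scale `ε δ` gains `ε δ` against the gradient, and Caccioppoli over a gap
  -- `δ / 2` loses `2 C₁ / δ`: the scale `δ` drops out.
  have h3 : eLpNorm (fun x => u x - ⨍ t in ball x (ε * δ), u t) 2 (volume.restrict (ball z ρ))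
      ≤ ENNReal.ofReal (2 * C₁ * ε) * eLpNorm u 2 (volume.restrict (ball z (ρ + δ))) := by
    refine (h1.trans (mul_le_mul_right h2 _)).trans (le_of_eq ?_)
    rw [← mul_assoc, ← ENNReal.ofReal_mul (by positivity)]
    congr 2
    have : ρ + δ - (ρ + δ / 2) = δ / 2 := by ring
    rw [this]; field_simp
  have hm : AEMeasurable (fun x => 2 * ‖u x - ⨍ t in ball x (ε * δ), u t‖ₑ ^ 2)
      (volume.restrict (ball z ρ)) := by
    exact ((hum.sub (stronglyMeasurable_ball_average hum _)).aestronglyMeasurable.enorm.pow_const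
      _).const_mul _
  calc ∫⁻ x in ball z ρ, ‖u x‖ₑ ^ 2
      ≤ ∫⁻ x in ball z ρ, (2 * ‖u x - ⨍ t in ball x (ε * δ), u t‖ₑ ^ 2
          + 2 * ‖⨍ t in ball x (ε * δ), u t‖ₑ ^ 2) := by
        refine lintegral_mono fun x => ?_
        have := enorm_add_sq_le (u x - ⨍ t in ball x (ε * δ), u t) (⨍ t in ball x (ε * δ), u t)
        rwa [sub_add_cancel] at this
    _ = 2 * (∫⁻ x in ball z ρ, ‖u x - ⨍ t in ball x (ε * δ), u t‖ₑ ^ 2)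
          + 2 * ∫⁻ x in ball z ρ, ‖⨍ t in ball x (ε * δ), u t‖ₑ ^ 2 := by
        rw [lintegral_add_left' hm, lintegral_const_mul' _ _ (by norm_num),
          lintegral_const_mul' _ _ (by norm_num)]
    _ ≤ 2 * (ENNReal.ofReal (2 * C₁ * ε) * eLpNorm u 2 (volume.restrict (ball z (ρ + δ)))) ^ 2
          + 2 * ∫⁻ x in ball z ρ, ‖⨍ t in ball x (ε * δ), u t‖ₑ ^ 2 := by
        rw [lintegral_enorm_sq (fun x => u x - ⨍ t in ball x (ε * δ), u t)]
        gcongr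
    _ = _ := by
        rw [lintegral_enorm_sq u, mul_pow, ← ENNReal.ofReal_pow (by positivity), add_comm, ← mul_assoc]
        congr 2
        rw [← ENNReal.ofReal_ofNat, ← ENNReal.ofReal_mul (by positivity)]
        congr 1; ring

/-- The cost of the `k`-th step of the iteration, in which averages are taken over balls of radius
`ε R 2^{-(k+2)}`: the squared normalisation grows like `4^{dk}`. -/
lemma ball_volume_ratio {ε R v : ℝ} (hε : ε ≠ 0) (hR : R ≠ 0) (hv : v ≠ 0) (d k : ℕ) :
    ((ε * (R * 2⁻¹ ^ (k + 2))) ^ d * v)⁻¹ ^ 2 * (R ^ d * v)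
      = 16 ^ d / (ε ^ (2 * d) * v) / R ^ d * 4 ^ (d * k) := by
  have h4 : (4 : ℝ) ^ (d * k) = ((2 ^ d) ^ k) ^ 2 := by
    rw [show (4 : ℝ) = 2 ^ 2 by norm_num, ← pow_mul, ← pow_mul, ← pow_mul]; congr 1; ring
  have h16 : (16 : ℝ) ^ d = (2 ^ d) ^ 4 := by
    rw [show (16 : ℝ) = 2 ^ 4 by norm_num, ← pow_mul, ← pow_mul]; congr 1; ring
  have h2 : ((2⁻¹ : ℝ) ^ (k + 2)) ^ d = (((2 ^ d) ^ k) * (2 ^ d) ^ 2)⁻¹ := by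
    rw [← pow_mul, inv_pow, ← pow_mul, ← pow_mul, ← pow_add]; congr 2; ring
  have hε2 : ε ^ (2 * d) = (ε ^ d) ^ 2 := by rw [← pow_mul]; congr 1; ring
  rw [h4, h16, mul_pow, mul_pow, h2, hε2]
  have hP : (2 : ℝ) ^ d ≠ 0 := by positivity
  have hε' : ε ^ d ≠ 0 := pow_ne_zero _ hε
  have hR' : R ^ d ≠ 0 := pow_ne_zero _ hR
  generalize (2 : ℝ) ^ d = P at *
  generalize ε ^ d = E at *
  generalize R ^ d = T at *
  have hQ : P ^ k ≠ 0 := pow_ne_zero _ hP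
  generalize P ^ k = Q at *
  field_simp

/-- Interior `L²` bounds for a family of harmonic functions in terms of averages over balls. -/
lemma exists_interior_family_bound {lam : ℝ} (hlam0 : 0 < lam) (hlam1 : lam < 1) (hd : 0 < d) :
    ∃ C : ℝ, 0 < C ∧ ∀ (A : Space d → Space d →L[ℝ] Space d), IsUniformlyElliptic lam A →
      ∀ (z : Space d) (R : ℝ), 0 < R → ∀ (Y : Type) [MeasurableSpace Y] (ν : Measure Y)
      [IsFiniteMeasure ν] (U : Space d → Y → ℝ),
      AEStronglyMeasurable (Function.uncurry U) ((volume.restrict (ball z R)).prod ν) →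
      (∀ᵐ y ∂ν, ∃ Du, IsHarmonicOn A (ball z R) (fun x => U x y) Du) → ∀ K : ENNReal,
      (∀ (x : Space d) (h : ℝ), 0 < h → ball x h ⊆ ball z R →
        ∫⁻ y, ‖∫ t in ball x h, U t y‖ₑ ^ 2 ∂ν ≤ K) →
      ∫⁻ y, (∫⁻ x in ball z (R / 2), ‖U x y‖ₑ ^ 2) ∂ν ≤ ENNReal.ofReal (C / R ^ d) * K := by
  obtain ⟨C₁, hC₁, hcac⟩ := exists_caccioppoli hlam0 hlam1
  set vol₁ : ℝ := volume.real (ball (0 : Space d) 1) with hvol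
  have hvol0 : 0 < vol₁ := ENNReal.toReal_pos (measure_ball_pos volume 0 one_pos).ne' measure_ball_lt_top.ne
  -- The averages at step `k` cost `4^{dk}`. This `ε` brings the absorbed factor below `4^{-d} / 2`,
  -- so the growth rate times the contraction factor is at most `1 / 2`.
  set ε : ℝ := min (1 / 4) (1 / (C₁ * 2 ^ (d + 3))) with hε
  have hε0 : 0 < ε := by positivity
  have hε1 : ε ≤ 1 / 4 := min_le_left _ _
  have hε2 : 8 * C₁ ^ 2 * ε ^ 2 ≤ (4 ^ d)⁻¹ * 2⁻¹ := by
    have h1 : ε ≤ 1 / (C₁ * 2 ^ (d + 3)) := min_le_right _ _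
    calc 8 * C₁ ^ 2 * ε ^ 2 ≤ 8 * C₁ ^ 2 * (1 / (C₁ * 2 ^ (d + 3))) ^ 2 := by gcongr
      _ = (4 ^ d)⁻¹ * 8⁻¹ := by
        have : (4 : ℝ) ^ d = (2 ^ d) ^ 2 := by rw [← pow_mul, mul_comm, pow_mul]; norm_num
        rw [this]; field_simp; ring
      _ ≤ _ := by gcongr; norm_num
  refine ⟨2 * (2 * 16 ^ d / (ε ^ (2 * d) * vol₁)), by positivity, ?_⟩
  intro A hA z R hR Y _ ν _ U₀ hU₀ hharm₀ K hK₀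
  -- replace `U₀` by a strongly measurable representative
  set U : Space d → Y → ℝ := fun x y => hU₀.mk (Function.uncurry U₀) (x, y) with hUdef
  have hU : StronglyMeasurable (Function.uncurry U) := hU₀.stronglyMeasurable_mk
  have hae : ∀ᵐ y ∂ν, ∀ᵐ x ∂(volume.restrict (ball z R)), U₀ x y = U x y := by
    have := Measure.measurePreserving_swap.quasiMeasurePreserving.ae (p := fun q => Function.uncurry U₀ q
      = hU₀.mk (Function.uncurry U₀) q) (μa := ν.prod (volume.restrict (ball z R))) hU₀.ae_eq_mk
    exact Measure.ae_ae_of_ae_prod this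
  have hharm : ∀ᵐ y ∂ν, ∃ Du, IsHarmonicOn A (ball z R) (fun x => U x y) Du := by
    filter_upwards [hae, hharm₀] with y h1 ⟨Du, h2⟩
    exact ⟨Du, h2.congr_ae h1 Filter.EventuallyEq.rfl⟩
  have hK : ∀ (x : Space d) (h : ℝ), 0 < h → ball x h ⊆ ball z R →
        ∫⁻ y, ‖∫ t in ball x h, U t y‖ₑ ^ 2 ∂ν ≤ K := by
    intro x h hh hsub
    refine le_trans (le_of_eq (lintegral_congr_ae ?_)) (hK₀ x h hh hsub)
    filter_upwards [hae] with y hy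
    have : ∫ t in ball x h, U t y = ∫ t in ball x h, U₀ t y :=
      integral_congr_ae ((ae_restrict_of_ae_restrict_of_subset hsub hy).mono fun x hx => hx.symm)
    rw [this]
  have hgoal : ∫⁻ y, (∫⁻ x in ball z (R / 2), ‖U₀ x y‖ₑ ^ 2) ∂ν
      = ∫⁻ y, (∫⁻ x in ball z (R / 2), ‖U x y‖ₑ ^ 2) ∂ν := by
    refine lintegral_congr_ae ?_
    filter_upwards [hae] with y hy
    refine lintegral_congr_ae ?_
    filter_upwards [ae_restrict_of_ae_restrict_of_subset (ball_subset_ball (by linarith)) hy] with x hx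
    rw [hx]
  rw [hgoal]
  have hsec : ∀ y, StronglyMeasurable fun x => U x y := fun y =>
    hU.comp_measurable (g := fun x => (x, y)) (by fun_prop)
  have hmE : ∀ r, Measurable fun y => ∫⁻ x in ball z r, ‖U x y‖ₑ ^ 2 := by
    intro r
    have : Measurable fun q : Y × Space d => ‖U q.2 q.1‖ₑ ^ 2 :=
      ((hU.comp_measurable measurable_swap).enorm).pow_const _
    exact this.lintegral_prod_right'
  -- truncation
  set S : ℕ → Set Y := fun M => {y | ∫⁻ x in ball z R, ‖U x y‖ₑ ^ 2 ≤ M} with hS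
  have hSm : ∀ M, MeasurableSet (S M) := fun M => measurableSet_le (hmE R) measurable_const
  -- Absorption needs a finite a priori bound on all iterates. It holds on `S M`, and these sets
  -- increase to a set of full measure, so monotone convergence removes the truncation.
  suffices hsuff : ∀ M, ∫⁻ y in S M, (∫⁻ x in ball z (R / 2), ‖U x y‖ₑ ^ 2) ∂ν
      ≤ ENNReal.ofReal (2 * (2 * 16 ^ d / (ε ^ (2 * d) * vol₁)) / R ^ d) * K by
    have hdir : Directed (· ⊆ ·) S := by
      refine Monotone.directed_le fun M N hMN y hy => ?_
      have hy' : ∫⁻ x in ball z R, ‖U x y‖ₑ ^ 2 ≤ M := hy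
      exact hy'.trans (by exact_mod_cast hMN)
    have huniv : ν.restrict (⋃ M, S M) = ν := by
      refine Measure.restrict_eq_self_of_ae_mem ?_
      filter_upwards [hharm] with y ⟨Du, hy⟩
      have : ∫⁻ x in ball z R, ‖U x y‖ₑ ^ 2 < ⊤ := by
        rw [lintegral_enorm_sq (fun x => U x y)]
        exact ENNReal.pow_lt_top hy.2.2
      obtain ⟨M, hM⟩ := ENNReal.exists_nat_gt this.ne
      exact Set.mem_iUnion.2 ⟨M, hM.le⟩
    rw [← huniv, setLIntegral_iUnion_of_directed _ hdir]
    exact iSup_le hsuff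
  intro M
  set ν' := ν.restrict (S M) with hν'
  -- The radii increase from `R / 2` towards `R`, with gaps `δ k`.
  set ρ : ℕ → ℝ := fun k => R * (1 - 2⁻¹ ^ (k + 1)) with hρ
  set δ : ℕ → ℝ := fun k => R * 2⁻¹ ^ (k + 2) with hδ
  have hρδ : ∀ k, ρ k + δ k = ρ (k + 1) := by intro k; simp only [hρ, hδ]; ring
  have hδ0 : ∀ k, 0 < δ k := fun k => by simp only [hδ]; positivity
  have hρ0 : ∀ k, 0 < ρ k := by
    intro k
    have : (2⁻¹ : ℝ) ^ (k + 1) < 1 := pow_lt_one₀ (by norm_num) (by norm_num) (by omega)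
    simp only [hρ]
    exact mul_pos hR (by linarith)
  have hρR : ∀ k, ρ k ≤ R := by
    intro k
    simp only [hρ]
    have : (0 : ℝ) ≤ (2⁻¹ : ℝ) ^ (k + 1) := by positivity
    nlinarith
  set φ : ℕ → ENNReal := fun k => ∫⁻ y, (∫⁻ x in ball z (ρ k), ‖U x y‖ₑ ^ 2) ∂ν' with hφ
  have hρ0' : ρ 0 = R / 2 := by simp only [hρ]; norm_num; ring
  set B : ENNReal := ENNReal.ofReal (2 * 16 ^ d / (ε ^ (2 * d) * vol₁) / R ^ d) * K with hB
  have main : φ 0 ≤ B * 2 := by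
    refine le_two_mul_of_absorb (D := ENNReal.ofReal (4 ^ d)) (q := ENNReal.ofReal ((4 ^ d)⁻¹ * 2⁻¹))
      (M := M * ν Set.univ) (by finiteness) ?_ ?_ ?_ ?_
    · intro k
      calc φ k ≤ ∫⁻ _y, M ∂ν' := by
            refine lintegral_mono_ae ?_
            filter_upwards [ae_restrict_mem (hSm M)] with y hy
            exact (lintegral_mono_set (ball_subset_ball (hρR k))).trans hy
        _ = M * ν' Set.univ := lintegral_const _
        _ ≤ M * ν Set.univ := by gcongr; exact Measure.restrict_le_self
    · rw [← ENNReal.ofReal_ofNat, ← ENNReal.ofReal_inv_of_pos (by norm_num)]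
      refine ENNReal.ofReal_le_ofReal ?_
      have : ((4 : ℝ) ^ d)⁻¹ ≤ 1 := inv_le_one_of_one_le₀ (one_le_pow₀ (by norm_num))
      linarith
    · rw [← ENNReal.ofReal_mul (by positivity), ← ENNReal.ofReal_ofNat,
        ← ENNReal.ofReal_inv_of_pos (by norm_num)]
      refine ENNReal.ofReal_le_ofReal (le_of_eq ?_)
      field_simp
    · intro k
      have hstep : ∀ᵐ y ∂ν', ∫⁻ x in ball z (ρ k), ‖U x y‖ₑ ^ 2
          ≤ 2 * (∫⁻ x in ball z (ρ k), ‖⨍ t in ball x (ε * δ k), U t y‖ₑ ^ 2)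
            + ENNReal.ofReal ((4 ^ d)⁻¹ * 2⁻¹) * ∫⁻ x in ball z (ρ (k + 1)), ‖U x y‖ₑ ^ 2 := by
        filter_upwards [ae_restrict_of_ae hharm] with y ⟨Du, hy⟩
        have hy' : IsHarmonicOn A (ball z (ρ k + δ k)) (fun x => U x y) Du :=
          hy.mono (ball_subset_ball (by rw [hρδ]; exact hρR _))
        refine (hy'.lintegral_sq_le hC₁ (hcac d A hA) (hρ0 k) (hδ0 k) hε0 hε1 (hsec y)).trans ?_
        rw [hρδ]
        gcongr
      -- By Tonelli the integral in `y` comes first, and for each centre `x` the hypothesis bounds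
      -- it by `K`.
      have havg : ∫⁻ y, (∫⁻ x in ball z (ρ k), ‖⨍ t in ball x (ε * δ k), U t y‖ₑ ^ 2) ∂ν'
          ≤ ENNReal.ofReal (16 ^ d / (ε ^ (2 * d) * vol₁) / R ^ d * 4 ^ (d * k)) * K := by
        have hh0 : 0 < ε * δ k := mul_pos hε0 (hδ0 k)
        set V := volume.real (ball (0 : Space d) (ε * δ k)) with hV
        have hVeq : V = (ε * δ k) ^ d * vol₁ := by
          rw [hV, hvol, Measure.real, volume_ball_eq hd _ hh0.le, ENNReal.toReal_mul,
            ENNReal.toReal_ofReal (by positivity), Measure.real]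
        have hV0 : 0 < V := by rw [hVeq]; positivity
        have hint := stronglyMeasurable_ball_integral hU (ε * δ k)
        have e1 : ∀ x y, ‖⨍ t in ball x (ε * δ k), U t y‖ₑ ^ 2
            = ENNReal.ofReal (V⁻¹ ^ 2) * ‖∫ t in ball x (ε * δ k), U t y‖ₑ ^ 2 := by
          intro x y
          rw [setAverage_eq, Measure.real, Measure.addHaar_ball_center, ← Measure.real, enorm_smul,
            mul_pow, ENNReal.ofReal_pow (by positivity)]
          congr 2
          exact Real.enorm_of_nonneg (by positivity)
        simp only [e1]
        calc ∫⁻ y, (∫⁻ x in ball z (ρ k), ENNReal.ofReal (V⁻¹ ^ 2) *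
              ‖∫ t in ball x (ε * δ k), U t y‖ₑ ^ 2) ∂ν'
            = ∫⁻ x in ball z (ρ k), ∫⁻ y, ENNReal.ofReal (V⁻¹ ^ 2) *
              ‖∫ t in ball x (ε * δ k), U t y‖ₑ ^ 2 ∂ν' := by
              refine lintegral_lintegral_swap (Measurable.aemeasurable ?_)
              exact ((hint.comp_measurable measurable_swap).enorm.pow_const _).const_mul _
          _ ≤ ∫⁻ x in ball z (ρ k), ENNReal.ofReal (V⁻¹ ^ 2) * K := by
              refine setLIntegral_mono' measurableSet_ball fun x hx => ?_
              rw [lintegral_const_mul' _ _ ENNReal.ofReal_ne_top]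
              gcongr
              refine (lintegral_mono' Measure.restrict_le_self le_rfl).trans (hK x _ hh0 ?_)
              refine ball_subset_ball' ?_
              rw [mem_ball] at hx
              have h1 := hρδ k
              have h2 := hρR (k + 1)
              have h3 := hδ0 k
              nlinarith
          _ = ENNReal.ofReal (V⁻¹ ^ 2) * K * (ENNReal.ofReal (ρ k ^ d) * ENNReal.ofReal vol₁) := by
              rw [setLIntegral_const, volume_ball_eq hd _ (hρ0 k).le, hvol, Measure.real,
                ENNReal.ofReal_toReal measure_ball_lt_top.ne]
          _ ≤ ENNReal.ofReal (V⁻¹ ^ 2) * K * (ENNReal.ofReal (R ^ d) * ENNReal.ofReal vol₁) := by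
              gcongr
              · exact (hρ0 k).le
              · exact hρR k
          _ = ENNReal.ofReal (V⁻¹ ^ 2 * (R ^ d * vol₁)) * K := by
              rw [ENNReal.ofReal_mul (by positivity), ENNReal.ofReal_mul (by positivity)]; ring
          _ = _ := by
              congr 2
              rw [hVeq]
              exact ball_volume_ratio hε0.ne' hR.ne' hvol0.ne' d k
      calc φ k ≤ ∫⁻ y, (2 * (∫⁻ x in ball z (ρ k), ‖⨍ t in ball x (ε * δ k), U t y‖ₑ ^ 2)
            + ENNReal.ofReal ((4 ^ d)⁻¹ * 2⁻¹) * ∫⁻ x in ball z (ρ (k + 1)), ‖U x y‖ₑ ^ 2) ∂ν' :=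
            lintegral_mono_ae hstep
        _ = 2 * (∫⁻ y, (∫⁻ x in ball z (ρ k), ‖⨍ t in ball x (ε * δ k), U t y‖ₑ ^ 2) ∂ν')
            + ENNReal.ofReal ((4 ^ d)⁻¹ * 2⁻¹) * φ (k + 1) := by
            rw [lintegral_add_right _ ((hmE _).const_mul _), lintegral_const_mul' _ _ (by norm_num),
              lintegral_const_mul' _ _ (by finiteness)]
        _ ≤ _ := by
            refine add_le_add ?_ le_rfl
            refine (mul_le_mul_right havg 2).trans (le_of_eq ?_)
            rw [hB, ← ENNReal.ofReal_ofNat, ← ENNReal.ofReal_pow (by positivity), ← mul_assoc,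
              ← ENNReal.ofReal_mul (by positivity), mul_assoc (ENNReal.ofReal _) K,
              mul_comm K, ← mul_assoc, ← mul_assoc, ← ENNReal.ofReal_mul (by positivity)]
            congr 2
            rw [← pow_mul]; ring
  rw [← hρ0']
  refine main.trans (le_of_eq ?_)
  rw [hB, mul_comm _ (2 : ENNReal), ← mul_assoc, ← ENNReal.ofReal_ofNat,
    ← ENNReal.ofReal_mul (by positivity)]
  congr 2; ring

end GreenEstimates

namespace GreenEstimates


/-! ### Interior bounds in terms of `L¹` norms, and annuli -/

variable {d : ℕ}

/-- A single function is a family over a one-point space, with the square of the `L¹` norm as `K`;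
Caccioppoli then handles the gradient. Having `L¹` on the right matters because only `W^{1,1}`
control is available up to the pole. -/
lemma exists_interior_bound {lam : ℝ} (hlam0 : 0 < lam) (hlam1 : lam < 1) (hd : 0 < d) :
    ∃ C : ℝ, 0 < C ∧ ∀ (A : Space d → Space d →L[ℝ] Space d), IsUniformlyElliptic lam A →
      ∀ (z : Space d) (R : ℝ), 0 < R → ∀ (u : Space d → ℝ) (Du : Space d → Space d),
      IsHarmonicOn A (ball z R) u Du →
      ∫⁻ x in ball z (R / 2), ‖u x‖ₑ ^ 2
        ≤ ENNReal.ofReal (C / R ^ d) * (∫⁻ x in ball z R, ‖u x‖ₑ) ^ 2 ∧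
      ∫⁻ x in ball z (R / 4), ‖Du x‖ₑ ^ 2
        ≤ ENNReal.ofReal (C / (R ^ d * R ^ 2)) * (∫⁻ x in ball z R, ‖u x‖ₑ) ^ 2 := by
  obtain ⟨C, hC, h⟩ := exists_interior_family_bound hlam0 hlam1 hd
  obtain ⟨C₁, hC₁, hcac⟩ := exists_caccioppoli hlam0 hlam1
  refine ⟨max C (16 * C₁ ^ 2 * C), lt_max_of_lt_left hC, fun A hA z R hR u Du hu => ?_⟩
  have key : ∫⁻ x in ball z (R / 2), ‖u x‖ₑ ^ 2
        ≤ ENNReal.ofReal (C / R ^ d) * (∫⁻ x in ball z R, ‖u x‖ₑ) ^ 2 := by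
    have := h A hA z R hR Unit (Measure.dirac ()) (fun x _ => u x) (hu.2.1.comp_fst)
      (Filter.Eventually.of_forall fun _ => ⟨Du, hu⟩) ((∫⁻ x in ball z R, ‖u x‖ₑ) ^ 2)
      (fun x h _ hsub => by
        rw [lintegral_dirac]
        gcongr
        exact (enorm_integral_le_lintegral_enorm _).trans (lintegral_mono_set hsub))
    simpa using this
  constructor
  · refine key.trans ?_
    gcongr
    exact le_max_left _ _
  · have h2 := hcac d A hA z (R / 4) (R / 2) (by positivity) (by linarith) u Du
      (hu.mono (ball_subset_ball (by linarith)))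
    rw [lintegral_enorm_sq Du]
    calc eLpNorm Du 2 (volume.restrict (ball z (R / 4))) ^ 2
        ≤ (ENNReal.ofReal (C₁ / (R / 2 - R / 4)) * eLpNorm u 2 (volume.restrict (ball z (R / 2)))) ^ 2 := by
          gcongr
      _ ≤ ENNReal.ofReal (C₁ / (R / 2 - R / 4)) ^ 2 *
          (ENNReal.ofReal (C / R ^ d) * (∫⁻ x in ball z R, ‖u x‖ₑ) ^ 2) := by
          rw [mul_pow, ← lintegral_enorm_sq u]; gcongr
      _ = ENNReal.ofReal (16 * C₁ ^ 2 * C / (R ^ d * R ^ 2)) * (∫⁻ x in ball z R, ‖u x‖ₑ) ^ 2 := by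
          have hq : 0 < R / 2 - R / 4 := by linarith
          rw [← mul_assoc, ← ENNReal.ofReal_pow (by positivity), ← ENNReal.ofReal_mul (by positivity)]
          congr 2
          rw [show R / 2 - R / 4 = R / 4 by ring]
          field_simp; ring
      _ ≤ _ := by gcongr; exact le_max_right _ _

/-- Covering a set by small balls centered in a neighborhood of the set. -/
lemma setLIntegral_mul_volume_ball_le {f : Space d → ENNReal} (hf : AEMeasurable f)
    {S S' : Set (Space d)} (hS : MeasurableSet S) {ε : ℝ}
    (h : ∀ x ∈ S, ball x ε ⊆ S') :
    (∫⁻ x in S, f x) * volume (ball (0 : Space d) ε) ≤ ∫⁻ z in S', ∫⁻ x in ball z ε, f x := by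
  have hm : AEMeasurable (Function.uncurry fun z x : Space d => (ball z ε).indicator f x)
      ((volume.restrict S').prod volume) := by
    have e : (Function.uncurry fun z x : Space d => (ball z ε).indicator f x)
        = {q : Space d × Space d | dist q.2 q.1 < ε}.indicator (fun q => f q.2) := by
      ext ⟨z, x⟩; rfl
    rw [e]
    exact (hf.comp_snd).indicator (measurableSet_lt (by fun_prop) measurable_const)
  calc (∫⁻ x in S, f x) * volume (ball (0 : Space d) ε)
      = ∫⁻ x in S, f x * volume (ball (0 : Space d) ε) := by
        rw [lintegral_mul_const'' _ hf.restrict]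
    _ ≤ ∫⁻ x in S, ∫⁻ z in S', (ball z ε).indicator f x := by
        refine setLIntegral_mono' hS fun x hx => ?_
        have e : ∀ z, (ball z ε).indicator f x = (ball x ε).indicator (fun _ => f x) z := by
          intro z
          by_cases hz : z ∈ ball x ε
          · rw [Set.indicator_of_mem hz, Set.indicator_of_mem (mem_ball_comm.1 hz)]
          · rw [Set.indicator_of_notMem hz, Set.indicator_of_notMem fun h => hz (mem_ball_comm.1 h)]
        simp only [e]
        rw [lintegral_indicator_const measurableSet_ball, Measure.restrict_apply measurableSet_ball,
          Set.inter_eq_left.2 (h x hx), Measure.addHaar_ball_center volume x]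
    _ ≤ ∫⁻ x, ∫⁻ z in S', (ball z ε).indicator f x := setLIntegral_le_lintegral _ _
    _ = ∫⁻ z in S', ∫⁻ x, (ball z ε).indicator f x := (lintegral_lintegral_swap hm).symm
    _ = _ := by simp only [lintegral_indicator measurableSet_ball]

/-- The closed annulus `{r ≤ |x - y| ≤ 2r}`. -/
def annulus (y : Space d) (r : ℝ) : Set (Space d) := closedBall y (2 * r) \ ball y r

lemma measurableSet_annulus (y : Space d) (r : ℝ) : MeasurableSet (annulus y r) :=
  measurableSet_closedBall.diff measurableSet_ball

lemma HasWeakGradient.integrableOn {U : Set (Space d)} {u : Space d → ℝ} {Du : Space d → Space d}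
    (h : HasWeakGradient U u Du) {K : Set (Space d)} (hK : IsCompact K) (hKU : K ⊆ U) :
    IntegrableOn Du K := by
  have hi : ∀ i, IntegrableOn (fun x => Du x i) K := fun i =>
    (h i).2.1.integrableOn_compact_subset hKU hK
  have e : Du = fun x => ∑ i, Du x i • basisVec i := by
    ext x j; simp [basisVec, Finset.sum_apply, Pi.single_apply]
  rw [e]
  exact integrable_finsetSum _ fun i _ => (hi i).smul_const _

lemma HasWeakGradient.aestronglyMeasurable {u : Space d → ℝ} {Du : Space d → Space d}
    (h : HasWeakGradient Set.univ u Du) : AEStronglyMeasurable Du volume := by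
  have hi : ∀ i, AEStronglyMeasurable (fun x => Du x i) volume := fun i =>
    (locallyIntegrableOn_univ.1 (h i).2.1).aestronglyMeasurable
  have e : Du = fun x => ∑ i, Du x i • basisVec i := by
    ext x j; simp [basisVec, Finset.sum_apply, Pi.single_apply]
  rw [e]
  exact Finset.aestronglyMeasurable_fun_sum _ fun i _ => (hi i).smul_const _

/-- Bounds on annuli for functions which are harmonic away from a point. -/
lemma exists_annulus_bound {lam : ℝ} (hlam0 : 0 < lam) (hlam1 : lam < 1) (hd : 0 < d) :
    ∃ C : ℝ, 0 < C ∧ ∀ (A : Space d → Space d →L[ℝ] Space d), IsUniformlyElliptic lam A →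
      ∀ (y : Space d) (g : Space d → ℝ) (Dg : Space d → Space d), HasWeakGradient Set.univ g Dg →
      (∀ z s, 0 < s → s < ‖z - y‖ → IsHarmonicOn A (ball z s) g Dg) → ∀ r : ℝ, 0 < r →
      ∃ c : ℝ, ∫⁻ x in annulus y r, ‖g x - c‖ₑ ^ 2
          ≤ ENNReal.ofReal (C * r ^ 2 / r ^ d) * (∫⁻ x in ball y (13 * r), ‖Dg x‖ₑ) ^ 2 ∧
        ∫⁻ x in annulus y r, ‖Dg x‖ₑ ^ 2
          ≤ ENNReal.ofReal (C / r ^ d) * (∫⁻ x in ball y (13 * r), ‖Dg x‖ₑ) ^ 2 := by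
  obtain ⟨C, hC, h⟩ := exists_interior_bound hlam0 hlam1 hd
  refine ⟨24 ^ d * (4 * C * 2 ^ d) * (2 ^ (d + 1) * 4) ^ 2, by positivity, ?_⟩
  intro A hA y g Dg hw hharm r hr
  have : Nonempty (Fin d) := ⟨⟨0, hd⟩⟩
  have hgi : IntegrableOn g (ball y (13 * r)) :=
    ((hw ⟨0, hd⟩).1.integrableOn_compact_subset (Set.subset_univ _)
      (isCompact_closedBall y (13 * r))).mono_set ball_subset_closedBall
  have hDgi : IntegrableOn Dg (ball y (13 * r)) :=
    (hw.integrableOn (isCompact_closedBall y (13 * r)) (Set.subset_univ _)).mono_set ball_subset_closedBall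
  -- Poincaré in `L¹`, straight across the pole. The ball of radius `4 r` contains all the balls
  -- used below, and `13 r > 3 · 4 r`.
  obtain ⟨c, hc⟩ := exists_poincare hd (p := 1) (z := y) (r := 4 * r) (s := 13 * r) le_rfl (by norm_num)
    (by positivity) (by linarith) (hw.mono (Set.subset_univ _)) (memLp_one_iff_integrable.2 hgi)
    (memLp_one_iff_integrable.2 hDgi)
  simp only [eLpNorm_one_eq_lintegral_enorm] at hc
  set N := ∫⁻ x in ball y (13 * r), ‖Dg x‖ₑ with hN
  have hgm : AEStronglyMeasurable g volume :=
    (locallyIntegrableOn_univ.1 (hw ⟨0, hd⟩).1).aestronglyMeasurable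
  have hDgm := hw.aestronglyMeasurable
  -- Centres of the covering balls of radius `r / 8`. Being at distance more than `r / 2` from `y`,
  -- they have balls of radius `r / 2` free of the pole.
  set S' : Set (Space d) := ball y (3 * r) \ closedBall y (r / 2) with hS'
  have hsub : ∀ x ∈ annulus y r, ball x (r / 8) ⊆ S' := by
    rintro x ⟨hx1, hx2⟩ w hw'
    rw [mem_closedBall] at hx1
    rw [mem_ball, not_lt] at hx2
    rw [mem_ball] at hw'
    constructor
    · rw [mem_ball]; linarith [dist_triangle w x y]
    · rw [mem_closedBall, not_le]; linarith [dist_triangle x w y, dist_comm x w]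
  have hin : ∀ z ∈ S',
      ∫⁻ x in ball z (r / 8), ‖g x - c‖ₑ ^ 2
        ≤ ENNReal.ofReal (C / (r / 2) ^ d) * (ENNReal.ofReal (2 ^ (d + 1) * (4 * r)) * N) ^ 2 ∧
      ∫⁻ x in ball z (r / 8), ‖Dg x‖ₑ ^ 2
        ≤ ENNReal.ofReal (C / ((r / 2) ^ d * (r / 2) ^ 2)) *
          (ENNReal.ofReal (2 ^ (d + 1) * (4 * r)) * N) ^ 2 := by
    rintro z ⟨hz1, hz2⟩
    rw [mem_ball] at hz1
    rw [mem_closedBall, not_le, dist_eq_norm] at hz2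
    have hh := (hharm z (r / 2) (by positivity) hz2).sub_const c
    have hle : ∫⁻ x in ball z (r / 2), ‖g x - c‖ₑ ≤ ENNReal.ofReal (2 ^ (d + 1) * (4 * r)) * N :=
      (lintegral_mono_set (ball_subset_ball' (by linarith))).trans hc
    obtain ⟨h1, h2⟩ := h A hA z (r / 2) (by positivity) _ Dg hh
    constructor
    · refine (lintegral_mono_set (ball_subset_ball (by linarith))).trans (h1.trans ?_)
      gcongr
    · refine (lintegral_mono_set (ball_subset_ball (by linarith))).trans (h2.trans ?_)
      gcongr
  have hB : volume (ball (0 : Space d) (r / 8)) ≠ 0 := (measure_ball_pos volume 0 (by positivity)).ne'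
  have hB' : volume (ball (0 : Space d) (r / 8)) ≠ ⊤ := measure_ball_lt_top.ne
  -- Here `24 = 3 r / (r / 8)`.
  have hvol : volume S' ≤ ENNReal.ofReal (24 ^ d) * volume (ball (0 : Space d) (r / 8)) := by
    refine (measure_mono Set.sdiff_subset).trans (le_of_eq ?_)
    rw [volume_ball_eq hd y (by positivity), volume_ball_eq hd 0 (by positivity : 0 ≤ r / 8),
      ← mul_assoc, ← ENNReal.ofReal_mul (by positivity), ← mul_pow]
    congr 3; ring
  have hcov : ∀ f : Space d → ENNReal, AEMeasurable f volume → ∀ M : ENNReal,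
      (∀ z ∈ S', ∫⁻ x in ball z (r / 8), f x ≤ M) →
      ∫⁻ x in annulus y r, f x ≤ ENNReal.ofReal (24 ^ d) * M := by
    intro f hf M hM
    have hS'm : MeasurableSet S' := measurableSet_ball.diff measurableSet_closedBall
    have h1 := setLIntegral_mul_volume_ball_le hf (measurableSet_annulus y r) hsub
    have h2 : ∫⁻ z in S', ∫⁻ x in ball z (r / 8), f x ≤ M * volume S' := by
      refine (setLIntegral_mono' hS'm hM).trans (le_of_eq (setLIntegral_const _ _))
    have h3 := (h1.trans h2).trans (mul_le_mul_right hvol M)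
    rw [← mul_assoc] at h3
    have := (ENNReal.mul_le_mul_iff_left hB hB').1 h3
    rwa [mul_comm]
  refine ⟨c, ?_, ?_⟩
  · refine (hcov _ ((hgm.sub aestronglyMeasurable_const).enorm.pow_const 2) _
      fun z hz => (hin z hz).1).trans ?_
    rw [mul_pow, ← mul_assoc, ← mul_assoc, ← ENNReal.ofReal_pow (by positivity),
      ← ENNReal.ofReal_mul (by positivity), ← ENNReal.ofReal_mul (by positivity)]
    gcongr
    rw [div_pow]
    have : 24 ^ d * (C / (r ^ d / 2 ^ d)) * (2 ^ (d + 1) * (4 * r)) ^ 2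
      = 24 ^ d * (1 * C * 2 ^ d) * (2 ^ (d + 1) * 4) ^ 2 * r ^ 2 / r ^ d := by
      field_simp
    rw [this]
    gcongr; norm_num
  · refine (hcov _ (hDgm.enorm.pow_const 2) _ fun z hz => (hin z hz).2).trans ?_
    rw [mul_pow, ← mul_assoc, ← mul_assoc, ← ENNReal.ofReal_pow (by positivity),
      ← ENNReal.ofReal_mul (by positivity), ← ENNReal.ofReal_mul (by positivity)]
    gcongr
    refine le_of_eq ?_
    rw [div_pow, div_pow]
    field_simp; ring

end GreenEstimates

namespace GreenEstimates


/-! ### Sobolev's inequality and potentials of energy fields -/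

variable {d : ℕ}

/-- The Sobolev exponent `2d/(d-2)`. -/
noncomputable def sobolevExponent (d : ℕ) : ENNReal := ENNReal.ofReal (2 * d / (d - 2))

lemma two_le_sobolevExponent (hd : 3 ≤ d) : 2 ≤ sobolevExponent d := by
  have h : (3 : ℝ) ≤ d := by exact_mod_cast hd
  rw [sobolevExponent, show (2 : ENNReal) = ENNReal.ofReal 2 by simp]
  refine ENNReal.ofReal_le_ofReal ?_
  rw [le_div_iff₀ (by linarith)]
  linarith

instance fact_one_le_sobolevExponent [Fact (3 ≤ d)] : Fact (1 ≤ sobolevExponent d) :=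
  ⟨le_trans (by norm_num) (two_le_sobolevExponent Fact.out)⟩

/-- The Gagliardo-Nirenberg-Sobolev inequality for test functions. -/
lemma exists_sobolev (hd : 3 ≤ d) : ∃ C : ℝ, 0 < C ∧ ∀ φ : Space d → ℝ,
    IsTestFunction Set.univ φ →
    eLpNorm φ (sobolevExponent d) volume ≤ ENNReal.ofReal C * eLpNorm (gradient φ) 2 volume := by
  have h3 : (3 : ℝ) ≤ d := by exact_mod_cast hd
  set C := eLpNormLESNormFDerivOfEqInnerConst (volume : Measure (Space d)) (2 : NNReal)
  refine ⟨C + 1, by positivity, fun φ hφ => ?_⟩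
  have h := eLpNorm_le_eLpNorm_fderiv_of_eq_inner (volume : Measure (Space d))
    (hφ.1.of_le (by exact_mod_cast le_top)) hφ.2.1
    (p := 2) (p' := (2 * d / (d - 2) : ℝ).toNNReal) (by norm_num) (by simp; omega) (by
      rw [Real.coe_toNNReal _ (div_nonneg (by positivity) (by linarith))]
      simp
      have : (d : ℝ) - 2 ≠ 0 := by linarith
      field_simp)
  calc eLpNorm φ (sobolevExponent d) volume ≤ C * eLpNorm (fderiv ℝ φ) 2 volume := h
    _ ≤ ENNReal.ofReal (C + 1) * eLpNorm (fderiv ℝ φ) 2 volume := by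
      gcongr
      rw [← ENNReal.ofReal_coe_nnreal]
      exact ENNReal.ofReal_le_ofReal (by linarith)
    _ = _ := by
      congr 1
      exact eLpNorm_congr_norm_ae (Filter.Eventually.of_forall fun x => (norm_gradient φ x).symm)

/-- Hölder's inequality on balls, for the Sobolev exponent. -/
lemma exists_eLpNorm_two_le (hd : 3 ≤ d) : ∃ C : ℝ, 0 < C ∧ ∀ (z : Space d) (r : ℝ), 0 < r →
    ∀ v : Space d → ℝ, AEStronglyMeasurable v (volume.restrict (ball z r)) →
    eLpNorm v 2 (volume.restrict (ball z r))
      ≤ ENNReal.ofReal (C * r) * eLpNorm v (sobolevExponent d) (volume.restrict (ball z r)) := by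
  have h3 : (3 : ℝ) ≤ d := by exact_mod_cast hd
  have hd0 : (0 : ℝ) < d := by linarith
  set V := volume (ball (0 : Space d) 1)
  refine ⟨(V ^ (1 / d : ℝ)).toReal + 1, by positivity, fun z r hr v hv => ?_⟩
  have h := eLpNorm_le_eLpNorm_mul_rpow_measure_univ (two_le_sobolevExponent hd) hv
  -- Hölder's factor is the volume to the power `1/2 - (d-2)/(2d) = 1/d`, that is, a multiple of
  -- `r`.
  have e : (1 / (2 : ENNReal).toReal - 1 / (sobolevExponent d).toReal : ℝ) = 1 / d := by
    rw [sobolevExponent, ENNReal.toReal_ofReal (div_nonneg (by positivity) (by linarith))]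
    have : (d : ℝ) - 2 ≠ 0 := by linarith
    simp
    field_simp
    ring
  rw [e, Measure.restrict_apply_univ, volume_ball_eq (by omega) z hr.le, mul_comm] at h
  refine h.trans ?_
  gcongr
  rw [ENNReal.mul_rpow_of_nonneg _ _ (by positivity), ENNReal.ofReal_rpow_of_pos (by positivity),
    ← Real.rpow_natCast, ← Real.rpow_mul hr.le, mul_one_div_cancel hd0.ne', Real.rpow_one, mul_comm,
    ENNReal.ofReal_mul (by positivity)]
  gcongr
  have hV : V ^ (1 / d : ℝ) ≠ ⊤ := ENNReal.rpow_ne_top_of_nonneg (by positivity) measure_ball_lt_top.ne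
  rw [← ENNReal.ofReal_toReal hV]
  exact ENNReal.ofReal_le_ofReal (by simp)

instance : CompleteSpace (energySpace d) :=
  (Submodule.isClosed_topologicalClosure _).completeSpace_coe

/-- The gradient of a test function as an element of the energy space. -/
noncomputable def gradEnergy (d : ℕ) : testSpace d →ₗ[ℝ] energySpace d :=
  (gradLp d).codRestrict (energySpace d) fun φ => Submodule.le_topologicalClosure _ ⟨φ, rfl⟩

lemma gradEnergy_coe (φ : testSpace d) :
    ((gradEnergy d φ : energySpace d) : Lp (Space d) 2 (volume : Measure (Space d))) = gradLp d φ := rfl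

lemma denseRange_gradEnergy : DenseRange (gradEnergy d) := by
  intro F
  rw [Metric.mem_closure_iff]
  intro ε hε
  have h : (F : Lp (Space d) 2 (volume : Measure (Space d))) ∈
      closure (LinearMap.range (gradLp d) : Set (Lp (Space d) 2 (volume : Measure (Space d)))) := F.2
  rw [Metric.mem_closure_iff] at h
  obtain ⟨_, ⟨φ, rfl⟩, h2⟩ := h ε hε
  exact ⟨gradEnergy d φ, ⟨φ, rfl⟩, h2⟩

/-- Test functions as elements of `L^{2d/(d-2)}`. -/
noncomputable def testLp (d : ℕ) [Fact (3 ≤ d)] :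
    testSpace d →ₗ[ℝ] Lp ℝ (sobolevExponent d) (volume : Measure (Space d)) where
  toFun := fun φ => (φ.2.memLp _ volume).toLp
  map_add' := fun φ ψ => MemLp.toLp_add (φ.2.memLp _ _) (ψ.2.memLp _ _)
  map_smul' := fun c φ => MemLp.toLp_const_smul c (φ.2.memLp _ _)

lemma testLp_coeFn [Fact (3 ≤ d)] (φ : testSpace d) : testLp d φ =ᵐ[volume] φ.1 :=
  (φ.2.memLp _ volume).coeFn_toLp

/-- The function with a given gradient in the energy space. -/
noncomputable def potential (d : ℕ) [Fact (3 ≤ d)] :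
    energySpace d →L[ℝ] Lp ℝ (sobolevExponent d) (volume : Measure (Space d)) :=
  (testLp d).extendOfNorm (gradEnergy d)

lemma exists_norm_testLp_le (d : ℕ) [hd : Fact (3 ≤ d)] : ∃ C : ℝ, 0 < C ∧ ∀ φ : testSpace d,
    ‖testLp d φ‖ ≤ C * ‖gradEnergy d φ‖ := by
  obtain ⟨C, hC, h⟩ := exists_sobolev hd.out
  refine ⟨C, hC, fun φ => ?_⟩
  change ‖testLp d φ‖ ≤ C * ‖gradLp d φ‖
  simp only [testLp, gradLp, LinearMap.coe_mk, AddHom.coe_mk, Lp.norm_toLp]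
  have := h φ.1 φ.2
  have h2 := ENNReal.toReal_mono
    (ENNReal.mul_ne_top ENNReal.ofReal_ne_top (φ.2.memLp_gradient 2 volume).2.ne) this
  rwa [ENNReal.toReal_mul, ENNReal.toReal_ofReal hC.le] at h2

lemma potential_gradEnergy [Fact (3 ≤ d)] (φ : testSpace d) :
    potential d (gradEnergy d φ) = testLp d φ := by
  obtain ⟨C, -, hC⟩ := exists_norm_testLp_le d
  exact LinearMap.extendOfNorm_eq denseRange_gradEnergy ⟨C, hC⟩ φ

/-- Sobolev's inequality extends from test functions by density; Hölder on a ball then trades the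
Sobolev exponent for `L²` at the price of one factor `r`. -/
lemma exists_potential_bound (hd : 3 ≤ d) : ∃ C : ℝ, 0 < C ∧ ∀ [Fact (3 ≤ d)] (F : energySpace d),
    ‖potential d F‖ ≤ C * ‖F‖ ∧ ∀ (z : Space d) (r : ℝ), 0 < r →
      eLpNorm (potential d F) 2 (volume.restrict (ball z r)) ≤ ENNReal.ofReal (C * r * ‖F‖) := by
  have : Fact (3 ≤ d) := ⟨hd⟩
  obtain ⟨C₁, hC₁, h1⟩ := exists_norm_testLp_le d
  obtain ⟨C₂, hC₂, h2⟩ := exists_eLpNorm_two_le hd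
  have hb : ∀ F : energySpace d, ‖potential d F‖ ≤ C₁ * ‖F‖ := fun F =>
    LinearMap.norm_extendOfNorm_apply_le denseRange_gradEnergy C₁ h1 F
  refine ⟨max C₁ (C₂ * C₁), lt_max_of_lt_left hC₁, fun {_} F => ⟨(hb F).trans ?_, fun z r hr => ?_⟩⟩
  · gcongr; exact le_max_left _ _
  · refine (h2 z r hr _ (Lp.aestronglyMeasurable _).restrict).trans ?_
    calc _ ≤ ENNReal.ofReal (C₂ * r) * eLpNorm (potential d F) (sobolevExponent d) volume := by
          gcongr; exact Measure.restrict_le_self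
      _ = ENNReal.ofReal (C₂ * r) * ENNReal.ofReal ‖potential d F‖ := by
          rw [Lp.norm_def, ENNReal.ofReal_toReal (Lp.eLpNorm_ne_top _)]
      _ ≤ ENNReal.ofReal (C₂ * r) * ENNReal.ofReal (C₁ * ‖F‖) := by
          gcongr; exact hb F
      _ = ENNReal.ofReal (C₂ * C₁ * r * ‖F‖) := by
          rw [← ENNReal.ofReal_mul (by positivity)]; congr 1; ring
      _ ≤ _ := by gcongr; exact le_max_right _ _

lemma memLp_potential [hd : Fact (3 ≤ d)] (F : energySpace d) (z : Space d) (r : ℝ) :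
    MemLp (potential d F) 2 (volume.restrict (ball z r)) := by
  refine ⟨(Lp.aestronglyMeasurable _).restrict, ?_⟩
  obtain ⟨C, hC, h⟩ := exists_potential_bound hd.out
  refine lt_of_le_of_lt ?_ (lt_of_le_of_lt ((h F).2 z (max r 1) (by positivity)) ENNReal.ofReal_lt_top)
  exact eLpNorm_mono_measure _ (Measure.restrict_mono_set _ (ball_subset_ball (le_max_left _ _)))

lemma exists_gradEnergy_near (F : energySpace d) {ε : ℝ} (hε : 0 < ε) :
    ∃ φ : testSpace d, ‖F - gradEnergy d φ‖ < ε := by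
  obtain ⟨φ, h⟩ := Metric.mem_closure_range_iff.1 (denseRange_gradEnergy F) ε hε
  exact ⟨φ, by rwa [← dist_eq_norm]⟩

/-- Elements of the energy space are approximated by gradients of test functions, with local
control of the potentials. -/
lemma exists_test_near [hd : Fact (3 ≤ d)] (F : energySpace d) (z : Space d) (r : ℝ)
    {ε : ENNReal} (hε : 0 < ε) :
    ∃ φ : testSpace d, eLpNorm (fun x => F.1 x - gradient φ.1 x) 2 volume ≤ ε ∧
      eLpNorm (fun x => potential d F x - φ.1 x) 2 (volume.restrict (ball z r)) ≤ ε ∧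
      eLpNorm (fun x => potential d F x - φ.1 x) (sobolevExponent d) volume ≤ ε := by
  obtain ⟨C, hC, hb⟩ := exists_potential_bound hd.out
  obtain ⟨ε', hε', hlt⟩ : ∃ ε' : ℝ, 0 < ε' ∧ ENNReal.ofReal ε' ≤ ε := by
    by_cases h : ε = ⊤
    · exact ⟨1, one_pos, by simp [h]⟩
    · exact ⟨ε.toReal, ENNReal.toReal_pos hε.ne' h, ENNReal.ofReal_toReal_le⟩
  set r' := max r 1
  have hr' : 0 < r' := by positivity
  -- The denominator dominates the constants `1`, `C r'` and `C` of the three norms to be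
  -- controlled.
  obtain ⟨φ, hφ⟩ := exists_gradEnergy_near F (ε := ε' / (1 + C + C * r')) (by positivity)
  rw [lt_div_iff₀ (by positivity)] at hφ
  have hn := norm_nonneg (F - gradEnergy d φ)
  have e : ⇑(potential d (F - gradEnergy d φ)) =ᵐ[volume] fun x => potential d F x - φ.1 x := by
    rw [map_sub, potential_gradEnergy]
    filter_upwards [Lp.coeFn_sub (potential d F) (testLp d φ), testLp_coeFn φ] with x h1 h2
    rw [h1, Pi.sub_apply, h2]
  have e' : ⇑(F - gradEnergy d φ).1 =ᵐ[volume] fun x => F.1 x - gradient φ.1 x := by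
    filter_upwards [Lp.coeFn_sub F.1 (gradLp d φ), gradLp_coeFn φ] with x h1 h2
    change (F.1 - gradLp d φ : Lp (Space d) 2 volume) x = _
    rw [h1, Pi.sub_apply, h2]
  refine ⟨φ, ?_, ?_, ?_⟩
  · rw [← eLpNorm_congr_ae e', ← ENNReal.ofReal_toReal (Lp.eLpNorm_ne_top _)]
    refine (ENNReal.ofReal_le_ofReal ?_).trans hlt
    change ‖F - gradEnergy d φ‖ ≤ ε'
    nlinarith [mul_nonneg hn hC.le, mul_nonneg hn (mul_nonneg hC.le hr'.le)]
  · rw [← eLpNorm_congr_ae (ae_restrict_of_ae e)]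
    refine (eLpNorm_mono_measure _ (Measure.restrict_mono_set _ (ball_subset_ball (le_max_left r 1)))).trans
      (((hb _).2 z r' hr').trans ((ENNReal.ofReal_le_ofReal ?_).trans hlt))
    nlinarith [mul_nonneg hn hC.le]
  · rw [← eLpNorm_congr_ae e, ← ENNReal.ofReal_toReal (Lp.eLpNorm_ne_top _)]
    refine (ENNReal.ofReal_le_ofReal ?_).trans hlt
    refine ((hb (F - gradEnergy d φ)).1).trans ?_
    nlinarith [mul_nonneg hn (mul_nonneg hC.le hr'.le)]

/-- Integration by parts holds for test functions, and both sides pass to the limit: the gradients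
converge in `L²`, and the potentials converge in `L²` of a ball containing the support of `φ`. -/
lemma hasWeakGradient_potential [hd : Fact (3 ≤ d)] (F : energySpace d) :
    HasWeakGradient Set.univ (potential d F) F.1 := by
  intro i
  have hli : ∀ {E : Type} [NormedAddCommGroup E] {p : ENNReal} {f : Space d → E}, 1 ≤ p →
      MemLp f p volume → LocallyIntegrableOn f Set.univ := fun hp h =>
    (h.locallyIntegrable hp).locallyIntegrableOn _
  have hF : MemLp (fun x => F.1 x i) 2 volume := memLp_coord (Lp.memLp F.1) i
  refine hasWeakDeriv_of_integral_eq (hli Fact.out (Lp.memLp _)) (hli (by norm_num) hF)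
    fun φ hφ => ?_
  obtain ⟨r, hr⟩ := (hφ.2.1.isCompact.isBounded).subset_ball (0 : Space d)
  have hφi := hφ.fderiv_apply (basisVec i)
  have h0 : ∀ x ∉ ball (0 : Space d) r, φ x = 0 := fun x hx =>
    image_eq_zero_of_notMem_tsupport fun h => hx (hr h)
  have h0' : ∀ x ∉ ball (0 : Space d) r, fderiv ℝ φ x (basisVec i) = 0 := fun x hx =>
    image_eq_zero_of_notMem_tsupport (f := fun x => fderiv ℝ φ x (basisVec i))
      fun h => hx (hr (tsupport_fderiv_apply_subset _ h))
  have hm := hφ.memLp 2 (volume.restrict (ball 0 r))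
  have hm' := hφi.memLp 2 (volume.restrict (ball 0 r))
  set a := (eLpNorm (fun x => fderiv ℝ φ x (basisVec i)) 2 (volume.restrict (ball 0 r))).toReal
  set b := (eLpNorm φ 2 (volume.restrict (ball 0 r))).toReal
  rw [← sub_eq_zero, ← abs_nonpos_iff]
  refine le_of_forall_pos_le_add fun ε hε => ?_
  obtain ⟨ψ, h1, h2, -⟩ := exists_test_near F 0 r (ε := ENNReal.ofReal (ε / (a + b + 1)))
    (by simp; positivity)
  have e1 := (hasWeakDeriv_of_contDiff (U := Set.univ) (v := basisVec i) ψ.2.1).integral_eq hφ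
  rw [← setIntegral_mul_eq h0', ← setIntegral_mul_eq h0] at e1 ⊢
  have m1 : MemLp (fun x => potential d F x - ψ.1 x) 2 (volume.restrict (ball 0 r)) :=
    (memLp_potential F 0 r).sub (ψ.2.memLp 2 _)
  have m2 : MemLp (fun x => F.1 x i - fderiv ℝ ψ.1 x (basisVec i)) 2 (volume.restrict (ball 0 r)) :=
    (hF.restrict _).sub ((ψ.2.fderiv_apply _).memLp 2 _)
  have i1 := abs_integral_inner_le m1 hm'
  have i2 := abs_integral_inner_le m2 hm
  have n1 : (eLpNorm (fun x => potential d F x - ψ.1 x) 2 (volume.restrict (ball 0 r))).toReal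
      ≤ ε / (a + b + 1) := ENNReal.toReal_le_of_le_ofReal (by positivity) h2
  have n2 : (eLpNorm (fun x => F.1 x i - fderiv ℝ ψ.1 x (basisVec i)) 2
      (volume.restrict (ball 0 r))).toReal ≤ ε / (a + b + 1) := by
    refine ENNReal.toReal_le_of_le_ofReal (by positivity)
      (((eLpNorm_mono_measure _ Measure.restrict_le_self).trans ?_).trans h1)
    refine eLpNorm_mono fun x => ?_
    rw [← gradient_apply, ← PiLp.sub_apply]
    exact PiLp.norm_apply_le _ i
  have j : ∀ {f g : Space d → ℝ}, MemLp f 2 (volume.restrict (ball 0 r)) →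
      MemLp g 2 (volume.restrict (ball 0 r)) → IntegrableOn (fun x => f x * g x) (ball 0 r) :=
    fun hf hg => hf.integrable_mul hg
  have k1 : ∫ x in ball 0 r, inner ℝ (potential d F x - ψ.1 x) (fderiv ℝ φ x (basisVec i))
      = (∫ x in ball 0 r, potential d F x * fderiv ℝ φ x (basisVec i))
        - ∫ x in ball 0 r, ψ.1 x * fderiv ℝ φ x (basisVec i) := by
    rw [← integral_sub (j (memLp_potential F 0 r) hm') (j (ψ.2.memLp 2 _) hm')]
    congr 1; ext x; simp; ring
  have k2 : ∫ x in ball 0 r, inner ℝ (F.1 x i - fderiv ℝ ψ.1 x (basisVec i)) (φ x)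
      = (∫ x in ball 0 r, F.1 x i * φ x)
        - ∫ x in ball 0 r, fderiv ℝ ψ.1 x (basisVec i) * φ x := by
    rw [← integral_sub (j (hF.restrict _) hm) (j ((ψ.2.fderiv_apply _).memLp 2 _) hm)]
    congr 1; ext x; simp; ring
  rw [k1] at i1
  rw [k2] at i2
  have t1 := i1.trans (mul_le_mul_of_nonneg_right n1 ENNReal.toReal_nonneg)
  have t2 := i2.trans (mul_le_mul_of_nonneg_right n2 ENNReal.toReal_nonneg)
  have ha : 0 ≤ a := ENNReal.toReal_nonneg
  have hb : 0 ≤ b := ENNReal.toReal_nonneg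
  have fin : ε / (a + b + 1) * a + ε / (a + b + 1) * b ≤ ε := by
    rw [← mul_add, div_mul_eq_mul_div, div_le_iff₀ (by positivity)]
    nlinarith
  rw [sub_neg_eq_add, zero_add]
  calc _ = |((∫ x in ball 0 r, potential d F x * fderiv ℝ φ x (basisVec i))
        - ∫ x in ball 0 r, ψ.1 x * fderiv ℝ φ x (basisVec i)) + ((∫ x in ball 0 r, F.1 x i * φ x)
        - ∫ x in ball 0 r, fderiv ℝ ψ.1 x (basisVec i) * φ x)| := by rw [e1]; congr 1; ring
    _ ≤ _ := (abs_add_le _ _).trans ((add_le_add t1 t2).trans fin)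

end GreenEstimates

namespace GreenEstimates


/-! ### Lax-Milgram and restriction operators -/

variable {d : ℕ} {lam : ℝ} {A : Space d → Space d →L[ℝ] Space d}

/-- The bilinear form `∫ A F · H` on the energy space. -/
noncomputable def energyForm (hA : IsUniformlyElliptic lam A) :
    energySpace d →L[ℝ] energySpace d →L[ℝ] ℝ :=
  (innerSL ℝ (E := energySpace d)).comp
    ((energySpace d).orthogonalProjectionOnto.comp ((coeffOp hA).comp (energySpace d).subtypeL))

lemma energyForm_apply (hA : IsUniformlyElliptic lam A) (F H : energySpace d) :
    energyForm hA F H = inner ℝ (coeffOp hA F.1) H.1 := by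
  simp [energyForm]

lemma energyForm_coercive (hA : IsUniformlyElliptic lam A) (F : energySpace d) :
    lam * ‖F‖ * ‖F‖ ≤ energyForm hA F F := by
  have := coercive_energySpace hA F.2
  rw [energyForm_apply, real_inner_comm, mul_assoc, ← sq]
  exact this

/-- The Lax-Milgram solution operator of `-∇ · A ∇` on the energy space. -/
noncomputable def solOp (hlam : 0 < lam) (hA : IsUniformlyElliptic lam A) :
    energySpace d →L[ℝ] energySpace d :=
  (IsCoercive.continuousLinearEquivOfBilin (B := energyForm hA)
    ⟨lam, hlam, energyForm_coercive hA⟩).symm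

/-- The weak equation: `X` plays the role of the functional on the right-hand side, through the
Riesz identification. -/
lemma inner_coeffOp_solOp (hlam : 0 < lam) (hA : IsUniformlyElliptic lam A) (X Y : energySpace d) :
    inner ℝ (coeffOp hA (solOp hlam hA X).1) Y.1 = inner ℝ X Y := by
  rw [← energyForm_apply, ← IsCoercive.continuousLinearEquivOfBilin_apply
    (⟨lam, hlam, energyForm_coercive hA⟩ : IsCoercive (energyForm hA))]
  rw [solOp]
  simp

lemma norm_solOp_le (hlam : 0 < lam) (hA : IsUniformlyElliptic lam A) (X : energySpace d) :
    ‖solOp hlam hA X‖ ≤ lam⁻¹ * ‖X‖ := by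
  have h1 := energyForm_coercive hA (solOp hlam hA X)
  rw [energyForm_apply, inner_coeffOp_solOp] at h1
  have h2 := h1.trans (real_inner_le_norm _ _)
  rw [inv_mul_eq_div, le_div_iff₀ hlam]
  by_cases h : ‖solOp hlam hA X‖ = 0
  · rw [h]; simp
  · have : 0 < ‖solOp hlam hA X‖ := lt_of_le_of_ne (norm_nonneg _) (Ne.symm h)
    have := le_of_mul_le_mul_right h2 this
    linarith

lemma inner_coeffOp_adjoint (hA : IsUniformlyElliptic lam A)
    (F H : Lp (Space d) 2 (volume : Measure (Space d))) :
    inner ℝ (coeffOp hA.adjoint F) H = inner ℝ F (coeffOp hA H) := by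
  rw [real_inner_comm, inner_coeffOp, inner_coeffOp]
  congr 1; ext x
  rw [adjointField, ContinuousLinearMap.adjoint_inner_right, real_inner_comm]

/-- Testing each of the two equations with the solution of the other produces the same bilinear
expression. This is the operator form of the symmetry between the Green's functions of `A` and
`A^t`. -/
lemma inner_solOp_adjoint (hlam : 0 < lam) (hA : IsUniformlyElliptic lam A) (X Y : energySpace d) :
    inner ℝ (solOp hlam hA.adjoint X) Y = inner ℝ X (solOp hlam hA Y) := by
  rw [← inner_coeffOp_solOp hlam hA.adjoint X, inner_coeffOp_adjoint hA, real_inner_comm (_ : energySpace d),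
    ← inner_coeffOp_solOp hlam hA Y, real_inner_comm]

variable [hd : Fact (3 ≤ d)]

/-- Restriction of the potential to a ball, as a linear map on the energy space. -/
noncomputable def restrictLpLinear (z : Space d) (r : ℝ) :
    energySpace d →ₗ[ℝ] Lp ℝ 2 (volume.restrict (ball z r)) where
  toFun F := (memLp_potential F z r).toLp
  map_add' F H := by
    rw [← MemLp.toLp_add]
    refine MemLp.toLp_congr _ _ (ae_restrict_of_ae ?_)
    rw [map_add]; exact Lp.coeFn_add _ _
  map_smul' c F := by
    rw [RingHom.id_apply, ← MemLp.toLp_const_smul]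
    refine MemLp.toLp_congr _ _ (ae_restrict_of_ae ?_)
    rw [map_smul]; exact Lp.coeFn_smul _ _

lemma norm_restrictLpLinear (z : Space d) (r : ℝ) (F : energySpace d) :
    ‖restrictLpLinear z r F‖
      = (eLpNorm (potential d F) 2 (volume.restrict (ball z r))).toReal :=
  Lp.norm_toLp _ (memLp_potential F z r)

lemma exists_norm_restrictLpLinear_le (z : Space d) (r : ℝ) :
    ∃ C : ℝ, ∀ F, ‖restrictLpLinear z r F‖ ≤ C * ‖F‖ := by
  obtain ⟨C, hC, h⟩ := exists_potential_bound hd.out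
  refine ⟨C * max r 1, fun F => ?_⟩
  rw [norm_restrictLpLinear]
  refine ENNReal.toReal_le_of_le_ofReal (by positivity)
    (le_trans ?_ ((h F).2 z (max r 1) (by positivity)))
  exact eLpNorm_mono_measure _ (Measure.restrict_mono_set _ (ball_subset_ball (le_max_left _ _)))

/-- Restriction of the potential to a ball, as an operator on the energy space. -/
noncomputable def restrictLp (z : Space d) (r : ℝ) :
    energySpace d →L[ℝ] Lp ℝ 2 (volume.restrict (ball z r)) :=
  LinearMap.mkContinuousOfExistsBound (restrictLpLinear z r) (exists_norm_restrictLpLinear_le z r)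

lemma restrictLp_apply (z : Space d) (r : ℝ) (F : energySpace d) :
    restrictLp z r F = (memLp_potential F z r).toLp := rfl

lemma restrictLp_coeFn (z : Space d) (r : ℝ) (F : energySpace d) :
    restrictLp z r F =ᵐ[volume.restrict (ball z r)] potential d F :=
  (memLp_potential F z r).coeFn_toLp

omit hd in
lemma exists_norm_restrictLp_le (hd : 3 ≤ d) : ∃ C : ℝ, 0 < C ∧
    ∀ [Fact (3 ≤ d)] (z : Space d) (r : ℝ), 0 < r → ∀ F : energySpace d,
    ‖restrictLp z r F‖ ≤ C * r * ‖F‖ := by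
  obtain ⟨C, hC, h⟩ := exists_potential_bound hd
  refine ⟨C, hC, fun {_} z r hr F => ?_⟩
  rw [restrictLp_apply, Lp.norm_toLp]
  exact ENNReal.toReal_le_of_le_ofReal (by positivity) ((h F).2 z r hr)

omit hd in
lemma memLp_energySpace_coord (F : Lp (Space d) 2 (volume : Measure (Space d))) (i : Fin d)
    (s : Set (Space d)) : MemLp (fun x => F x i) 2 (volume.restrict s) :=
  (memLp_coord (Lp.memLp F) i).restrict s

omit hd in
/-- Restriction of a component of the gradient to a ball, as a linear map on the energy space. -/
noncomputable def restrictGradLpLinear (z : Space d) (r : ℝ) (i : Fin d) :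
    energySpace d →ₗ[ℝ] Lp ℝ 2 (volume.restrict (ball z r)) where
  toFun F := (memLp_energySpace_coord F.1 i (ball z r)).toLp
  map_add' F H := by
    rw [← MemLp.toLp_add]
    refine MemLp.toLp_congr _ _ (ae_restrict_of_ae ?_)
    filter_upwards [Lp.coeFn_add F.1 H.1] with x hx
    change (F.1 + H.1 : Lp (Space d) 2 volume) x i = _
    rw [hx]; rfl
  map_smul' c F := by
    rw [RingHom.id_apply, ← MemLp.toLp_const_smul]
    refine MemLp.toLp_congr _ _ (ae_restrict_of_ae ?_)
    filter_upwards [Lp.coeFn_smul c F.1] with x hx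
    change (c • F.1 : Lp (Space d) 2 volume) x i = _
    rw [hx]; rfl

omit hd in
lemma norm_restrictGradLpLinear_le (z : Space d) (r : ℝ) (i : Fin d) (F : energySpace d) :
    ‖restrictGradLpLinear z r i F‖ ≤ 1 * ‖F‖ := by
  have h : ‖restrictGradLpLinear z r i F‖
      = (eLpNorm (fun x => F.1 x i) 2 (volume.restrict (ball z r))).toReal :=
    Lp.norm_toLp _ (memLp_energySpace_coord F.1 i (ball z r))
  rw [h, one_mul, ← Submodule.norm_coe, Lp.norm_def]
  refine ENNReal.toReal_mono (Lp.eLpNorm_ne_top _) ?_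
  exact (eLpNorm_mono_measure _ Measure.restrict_le_self).trans
    (eLpNorm_mono fun x => PiLp.norm_apply_le _ i)

omit hd in
/-- Restriction of a component of the gradient to a ball, as an operator on the energy space. -/
noncomputable def restrictGradLp (z : Space d) (r : ℝ) (i : Fin d) :
    energySpace d →L[ℝ] Lp ℝ 2 (volume.restrict (ball z r)) :=
  LinearMap.mkContinuous (restrictGradLpLinear z r i) 1 (norm_restrictGradLpLinear_le z r i)

omit hd in
lemma restrictGradLp_coeFn (z : Space d) (r : ℝ) (i : Fin d) (F : energySpace d) :
    restrictGradLp z r i F =ᵐ[volume.restrict (ball z r)] fun x => F.1 x i :=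
  (memLp_energySpace_coord F.1 i (ball z r)).coeFn_toLp

/-- Thus the adjoint of restriction turns `e` into the right-hand side `e`, extended by zero. -/
lemma inner_restrictLp_adjoint (z : Space d) (r : ℝ) (e : Lp ℝ 2 (volume.restrict (ball z r)))
    (Y : energySpace d) :
    inner ℝ ((restrictLp z r).adjoint e) Y = ∫ x in ball z r, e x * potential d Y x := by
  rw [ContinuousLinearMap.adjoint_inner_left, L2.inner_def]
  refine integral_congr_ae ?_
  filter_upwards [restrictLp_coeFn z r Y] with x hx
  rw [hx]; simp [mul_comm]

lemma inner_restrictLp_adjoint_gradEnergy (z : Space d) (r : ℝ)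
    (e : Lp ℝ 2 (volume.restrict (ball z r))) (φ : testSpace d) :
    inner ℝ ((restrictLp z r).adjoint e) (gradEnergy d φ) = ∫ x in ball z r, e x * φ.1 x := by
  rw [inner_restrictLp_adjoint, potential_gradEnergy]
  refine integral_congr_ae (ae_restrict_of_ae ?_)
  filter_upwards [testLp_coeFn φ] with x hx
  rw [hx]

-- The right-hand side is now `-∂_i e` in the weak sense; solving with it corresponds to
-- differentiating the Green's function in its second variable.
omit hd in
lemma inner_restrictGradLp_adjoint_gradEnergy (z : Space d) (r : ℝ) (i : Fin d)
    (e : Lp ℝ 2 (volume.restrict (ball z r))) (φ : testSpace d) :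
    inner ℝ ((restrictGradLp z r i).adjoint e) (gradEnergy d φ)
      = ∫ x in ball z r, e x * gradient φ.1 x i := by
  rw [ContinuousLinearMap.adjoint_inner_left, L2.inner_def]
  refine integral_congr_ae ?_
  filter_upwards [restrictGradLp_coeFn z r i (gradEnergy d φ), ae_restrict_of_ae (gradLp_coeFn φ)] with x hx h2
  rw [hx, gradEnergy_coe, h2]; simp [mul_comm]

/-- An element of the energy space, seen as a functional, vanishes on test functions in `U`. -/
def VanishesOn (U : Set (Space d)) (X : energySpace d) : Prop :=
  ∀ φ : testSpace d, IsTestFunction U φ.1 → inner ℝ X (gradEnergy d φ) = 0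

omit hd in
lemma integral_coeff_solOp (hlam : 0 < lam) (hA : IsUniformlyElliptic lam A) (X : energySpace d)
    (φ : testSpace d) :
    ∫ x, inner ℝ (A x ((solOp hlam hA X).1 x)) (gradient φ.1 x) = inner ℝ X (gradEnergy d φ) := by
  rw [← inner_coeffOp_solOp hlam hA, gradEnergy_coe, L2.inner_def]
  refine integral_congr_ae ?_
  filter_upwards [coeffOp_coeFn hA (solOp hlam hA X).1, gradLp_coeFn φ] with x h1 h2
  rw [h1, h2]

/-- This is where interior estimates become applicable to the range of the solution operator. -/
lemma isHarmonicOn_solOp (hlam : 0 < lam) (hA : IsUniformlyElliptic lam A) {X : energySpace d}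
    {z : Space d} {r : ℝ} (hX : VanishesOn (ball z r) X) :
    IsHarmonicOn A (ball z r) (potential d (solOp hlam hA X)) (solOp hlam hA X).1 := by
  refine ⟨(hasWeakGradient_potential _).mono (Set.subset_univ _), memLp_potential _ _ _,
    (Lp.memLp _).restrict _, fun φ hφ => ?_⟩
  rw [setIntegral_eq_integral_of_forall_compl_eq_zero fun x hx => by
    rw [hφ.gradient_eq_zero hx, inner_zero_right]]
  exact (integral_coeff_solOp hlam hA X ⟨φ, hφ.mono (Set.subset_univ _)⟩).trans (hX _ hφ)

lemma vanishesOn_restrictLp_adjoint {U : Set (Space d)} {z : Space d} {r : ℝ}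
    (h : Disjoint (ball z r) U) (e : Lp ℝ 2 (volume.restrict (ball z r))) :
    VanishesOn U ((restrictLp z r).adjoint e) := by
  intro φ hφ
  rw [inner_restrictLp_adjoint_gradEnergy]
  refine setIntegral_eq_zero_of_forall_eq_zero fun x hx => ?_
  rw [hφ.eq_zero (Set.disjoint_left.1 h hx), mul_zero]

omit hd in
lemma vanishesOn_restrictGradLp_adjoint {U : Set (Space d)} {z : Space d} {r : ℝ} {i : Fin d}
    (h : Disjoint (ball z r) U) (e : Lp ℝ 2 (volume.restrict (ball z r))) :
    VanishesOn U ((restrictGradLp z r i).adjoint e) := by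
  intro φ hφ
  rw [inner_restrictGradLp_adjoint_gradEnergy]
  refine setIntegral_eq_zero_of_forall_eq_zero fun x hx => ?_
  rw [hφ.gradient_eq_zero (Set.disjoint_left.1 h hx)]; simp

end GreenEstimates

namespace GreenEstimates


/-! ### Testing with functions that vanish at infinity -/

variable {d : ℕ} {lam : ℝ} {A : Space d → Space d →L[ℝ] Space d}

lemma tendsto_eLpNorm_compl_ball {F : Type*} [NormedAddCommGroup F] {f : Space d → F}
    (hf : MemLp f 2 volume) :
    Filter.Tendsto (fun n : ℕ => eLpNorm f 2 (volume.restrict (ball (0 : Space d) n)ᶜ))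
      Filter.atTop (𝓝 0) := by
  have h2 : Filter.Tendsto (fun n : ℕ => ∫⁻ x, (ball (0 : Space d) n)ᶜ.indicator (fun x => ‖f x‖ₑ ^ 2) x)
      Filter.atTop (𝓝 (∫⁻ _ : Space d, 0)) := by
    refine tendsto_lintegral_of_dominated_convergence' (fun x => ‖f x‖ₑ ^ 2)
      (fun n => (hf.1.enorm.pow_const 2).indicator measurableSet_ball.compl)
      (fun n => Filter.Eventually.of_forall fun x => Set.indicator_le_self _ _ _) ?_
      (Filter.Eventually.of_forall fun x => ?_)
    · rw [lintegral_enorm_sq]; exact ENNReal.pow_ne_top hf.2.ne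
    · obtain ⟨N, hN⟩ := exists_nat_gt ‖x‖
      refine tendsto_const_nhds.congr' ?_
      filter_upwards [Filter.eventually_ge_atTop N] with n hn
      have : x ∈ ball (0 : Space d) n := by
        rw [mem_ball_zero_iff]; exact hN.trans_le (by exact_mod_cast hn)
      simp [this]
  simp only [lintegral_zero] at h2
  have h3 := h2.ennrpow_const (1 / 2)
  simp only [one_div, ENNReal.zero_rpow_of_pos (show (0 : ℝ) < 2⁻¹ by norm_num)] at h3
  refine h3.congr fun n => ?_
  rw [lintegral_indicator measurableSet_ball.compl, lintegral_enorm_sq, ← ENNReal.rpow_ofNat,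
    ← ENNReal.rpow_mul]
  norm_num

variable [hd : Fact (3 ≤ d)]

/-- Approximating `ψ` and `Dψ` by the same test functions makes it unnecessary to identify `ψ` with
the potential of `Dψ`. -/
lemma inner_restrictLp_adjoint_toLp {z : Space d} {r : ℝ}
    (f : Lp ℝ 2 (volume.restrict (ball z r))) {z₀ : Space d} {ρ : ℝ} {ψ : Space d → ℝ}
    {Dψ : Space d → Space d} (h : HasWeakGradient Set.univ ψ Dψ)
    (hz : ∀ x, x ∉ closedBall z₀ ρ → ψ x = 0) (hψ : MemLp ψ 2 volume)
    (hD : MemLp Dψ 2 volume) :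
    inner ℝ ((restrictLp z r).adjoint f) (⟨hD.toLp, toLp_mem_energySpace h hz hψ hD⟩ : energySpace d)
      = ∫ x in ball z r, f x * ψ x := by
  set X := (restrictLp z r).adjoint f
  set H : energySpace d := ⟨hD.toLp, toLp_mem_energySpace h hz hψ hD⟩
  rw [← sub_eq_zero, ← abs_nonpos_iff]
  refine le_of_forall_pos_le_add fun ε hε => ?_
  set ε' := ε / (‖X‖ + ‖f‖ + 1)
  have hε' : 0 < ε' := by positivity
  obtain ⟨φ, hφ, h1, h2⟩ := exists_test_approx (lt_add_one ρ) h hz (by norm_num) (by norm_num) hψ hD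
    (ε := ENNReal.ofReal ε') (by simpa using hε')
  let φ' : testSpace d := ⟨φ, hφ.mono (Set.subset_univ _)⟩
  have e1 : |inner ℝ X H - inner ℝ X (gradEnergy d φ')| ≤ ‖X‖ * ε' := by
    rw [← inner_sub_right]
    refine (abs_real_inner_le_norm _ _).trans (mul_le_mul_of_nonneg_left ?_ (norm_nonneg _))
    have : ‖H - gradEnergy d φ'‖ = ‖hD.toLp - (φ'.2.memLp_gradient 2 volume).toLp‖ := rfl
    rw [this, ← MemLp.toLp_sub, Lp.norm_toLp]
    exact ENNReal.toReal_le_of_le_ofReal hε'.le h2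
  have i1 : IntegrableOn (fun x => f x * ψ x) (ball z r) := (Lp.memLp f).integrable_mul (hψ.restrict _)
  have i2 : IntegrableOn (fun x => f x * φ x) (ball z r) :=
    (Lp.memLp f).integrable_mul ((hφ.memLp 2 volume).restrict _)
  have e2 : |(∫ x in ball z r, f x * ψ x) - ∫ x in ball z r, f x * φ x| ≤ ‖f‖ * ε' := by
    rw [← integral_sub i1 i2]
    have := abs_integral_inner_le (Lp.memLp f) ((hψ.sub (hφ.memLp 2 volume)).restrict (ball z r))
    have e : ∀ x, inner ℝ (f x) ((ψ - φ) x) = f x * ψ x - f x * φ x := fun x => by simp; ring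
    simp only [e] at this
    refine this.trans ?_
    rw [Lp.norm_def]
    gcongr
    exact ENNReal.toReal_le_of_le_ofReal hε'.le ((eLpNorm_mono_measure _ Measure.restrict_le_self).trans h1)
  have e3 := inner_restrictLp_adjoint_gradEnergy z r f φ'
  calc _ = |(inner ℝ X H - inner ℝ X (gradEnergy d φ')) - ((∫ x in ball z r, f x * ψ x)
        - ∫ x in ball z r, f x * φ x)| := by rw [e3]; congr 1; ring
    _ ≤ ‖X‖ * ε' + ‖f‖ * ε' := (abs_sub _ _).trans (add_le_add e1 e2)
    _ ≤ 0 + ε := by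
      rw [zero_add, ← add_mul, mul_div_assoc', div_le_iff₀ (by positivity)]
      nlinarith [norm_nonneg X, norm_nonneg f]

omit hd in
lemma inner_coeffOp_solOp_toLp (hlam : 0 < lam) (hA : IsUniformlyElliptic lam A) (X : energySpace d)
    {D : Space d → Space d} (hD : MemLp D 2 volume) (hm : hD.toLp ∈ energySpace d) :
    ∫ x, inner ℝ (A x ((solOp hlam hA X).1 x)) (D x) = inner ℝ X (⟨hD.toLp, hm⟩ : energySpace d) := by
  rw [← inner_coeffOp_solOp hlam hA, L2.inner_def]
  refine integral_congr_ae ?_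
  filter_upwards [coeffOp_coeFn hA (solOp hlam hA X).1, hD.coeFn_toLp] with x h1 h2
  rw [h1, h2]

/-- The weak formulation for the solution with right hand side `f`, tested with functions which
vanish at infinity in the sense of `L^{2d/(d-2)}`. -/
lemma integral_coeff_solOp_eq (hlam : 0 < lam) (hA : IsUniformlyElliptic lam A) {z : Space d} {r : ℝ}
    (f : Lp ℝ 2 (volume.restrict (ball z r))) {h : Space d → ℝ} {Dh : Space d → Space d}
    (hw : HasWeakGradient Set.univ h Dh) (hh : MemLp h (sobolevExponent d) volume)
    (hD : MemLp Dh 2 volume) :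
    ∫ x, inner ℝ (A x ((solOp hlam hA ((restrictLp z r).adjoint f)).1 x)) (Dh x)
      = ∫ x in ball z r, f x * h x := by
  set F := (solOp hlam hA ((restrictLp z r).adjoint f)).1
  have hF : MemLp (fun x => A x (F x)) 2 volume := hA.memLp Measure.AbsolutelyContinuous.rfl (Lp.memLp F)
  obtain ⟨c, hc0, hc⟩ := exists_cutoff
  obtain ⟨C, hC, hHol⟩ := exists_eLpNorm_two_le hd.out
  choose η h1 h2 h3 h4 h5 h6 h7 h8 using fun n : ℕ =>
    hc d 0 ((n : ℝ) + 1) (2 * ((n : ℝ) + 1)) (by positivity) (by linarith [(n.cast_nonneg : (0 : ℝ) ≤ n)])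
  have hη : ∀ n, IsTestFunction Set.univ (η n) := fun n =>
    ⟨h1 n, HasCompactSupport.of_support_subset_isCompact (isCompact_closedBall _ _)
      (subset_closure.trans (h7 n)), Set.subset_univ _⟩
  have hψ : ∀ n, MemLp (fun x => h x * η n x) 2 volume := by
    intro n
    have hl : MemLp h 2 (volume.restrict (ball 0 (2 * ((n : ℝ) + 1)))) :=
      ⟨hh.1.restrict, (hHol _ _ (by positivity) h hh.1.restrict).trans_lt
        (ENNReal.mul_lt_top ENNReal.ofReal_lt_top (hh.restrict _).2)⟩
    simpa [mul_comm] using memLp_smul_of_support measurableSet_ball hl (hη n).continuous (hη n).2.1 (h5 n)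
  -- The gradient of the cutoff contributes `c / (n + 1)` and Hölder on the ball `C · 3 (n + 1)`:
  -- bounded in `n`, but not small.
  have hbd : ∀ n, eLpNorm (fun x => h x • gradient (η n) x) 2 volume
      ≤ ENNReal.ofReal (3 * c * C) * eLpNorm h (sobolevExponent d) volume := by
    intro n
    have hn : 0 < (n : ℝ) + 1 := by positivity
    have e : (fun x => h x • gradient (η n) x)
        = (ball 0 (3 * ((n : ℝ) + 1))).indicator (fun x => h x • gradient (η n) x) := by
      ext1 x
      by_cases hx : x ∈ ball (0 : Space d) (3 * ((n : ℝ) + 1))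
      · rw [Set.indicator_of_mem hx]
      · rw [Set.indicator_of_notMem hx]
        by_contra hne
        have := h8 n x (fun h0 => hne (by rw [h0, smul_zero]))
        exact hx (closedBall_subset_ball (by linarith) this.1)
    rw [e, eLpNorm_indicator_eq_eLpNorm_restrict measurableSet_ball]
    calc _ ≤ ENNReal.ofReal (c / (n + 1)) * eLpNorm h 2 (volume.restrict (ball 0 (3 * ((n : ℝ) + 1)))) := by
          refine eLpNorm_le_mul_eLpNorm_of_ae_le_mul (Filter.Eventually.of_forall fun x => ?_) 2
          rw [norm_smul, mul_comm]
          refine mul_le_mul_of_nonneg_right ((h6 n x).trans (le_of_eq ?_)) (norm_nonneg _)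
          congr 1; ring
      _ ≤ ENNReal.ofReal (c / (n + 1)) * (ENNReal.ofReal (C * (3 * (n + 1))) *
          eLpNorm h (sobolevExponent d) volume) := by
          gcongr
          refine (hHol _ _ (by positivity) h hh.1.restrict).trans ?_
          gcongr
          exact Measure.restrict_le_self
      _ = _ := by
          rw [← mul_assoc, ← ENNReal.ofReal_mul (by positivity)]
          congr 2; field_simp
  have hg2 : ∀ n, MemLp (fun x => h x • gradient (η n) x) 2 volume := fun n =>
    ⟨hh.1.smul (continuous_gradient (h1 n)).aestronglyMeasurable,
      (hbd n).trans_lt (ENNReal.mul_lt_top ENNReal.ofReal_lt_top hh.2)⟩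
  have hg1 : ∀ n, MemLp (fun x => η n x • Dh x) 2 volume := fun n =>
    hD.of_le ((hη n).continuous.aestronglyMeasurable.smul hD.1) (Filter.Eventually.of_forall fun x => by
      rw [norm_smul, Real.norm_of_nonneg (h2 n x)]
      exact mul_le_of_le_one_left (norm_nonneg _) (h3 n x))
  have key : ∀ n, (∫ x, inner ℝ (A x (F x)) (η n x • Dh x))
      + ∫ x, inner ℝ (A x (F x)) (h x • gradient (η n) x) = ∫ x in ball z r, f x * (h x * η n x) := by
    intro n
    have hwn := hw.mul_test (hη n)
    have hz : ∀ x, x ∉ closedBall (0 : Space d) (2 * ((n : ℝ) + 1)) → h x * η n x = 0 := fun x hx => by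
      rw [h5 n x fun h => hx (ball_subset_closedBall h), mul_zero]
    have hDn : MemLp (fun x => η n x • Dh x + h x • gradient (η n) x) 2 volume := (hg1 n).add (hg2 n)
    rw [← inner_restrictLp_adjoint_toLp f hwn hz (hψ n) hDn, ← inner_coeffOp_solOp_toLp hlam hA]
    simp only [inner_add_right]
    exact (integral_add (integrable_inner_of_memLp hF (hg1 n)) (integrable_inner_of_memLp hF (hg2 n))).symm
  have l1 : Filter.Tendsto (fun n => ∫ x, inner ℝ (A x (F x)) (η n x • Dh x)) Filter.atTop
      (𝓝 (∫ x, inner ℝ (A x (F x)) (Dh x))) := by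
    refine tendsto_integral_of_dominated_convergence (fun x => ‖inner ℝ (A x (F x)) (Dh x)‖)
      (fun n => (integrable_inner_of_memLp hF (hg1 n)).1) (integrable_inner_of_memLp hF hD).norm
      (fun n => Filter.Eventually.of_forall fun x => ?_) (Filter.Eventually.of_forall fun x => ?_)
    · rw [inner_smul_right, norm_mul, Real.norm_of_nonneg (h2 n x)]
      exact mul_le_of_le_one_left (norm_nonneg _) (h3 n x)
    · obtain ⟨N, hN⟩ := exists_nat_gt ‖x‖
      refine tendsto_const_nhds.congr' ?_
      filter_upwards [Filter.eventually_ge_atTop N] with n hn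
      have hn' : (N : ℝ) ≤ n := by exact_mod_cast hn
      rw [h4 n x (by rw [mem_closedBall_zero_iff]; linarith), one_smul]
  -- Smallness comes from the other factor: `∇η_n` lives outside the ball of radius `n`, where the
  -- `L²` norm of `A F` tends to zero.
  have l2 : Filter.Tendsto (fun n => ∫ x, inner ℝ (A x (F x)) (h x • gradient (η n) x)) Filter.atTop
      (𝓝 0) := by
    have hK : ENNReal.ofReal (3 * c * C) * eLpNorm h (sobolevExponent d) volume ≠ ⊤ :=
      ENNReal.mul_ne_top ENNReal.ofReal_ne_top hh.2.ne
    have t := (ENNReal.tendsto_toReal ENNReal.zero_ne_top).comp (tendsto_eLpNorm_compl_ball hF)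
    have t2 := t.mul_const (ENNReal.ofReal (3 * c * C) * eLpNorm h (sobolevExponent d) volume).toReal
    simp only [ENNReal.toReal_zero, zero_mul] at t2
    refine squeeze_zero_norm (fun n => ?_) t2
    have e : ∫ x, inner ℝ (A x (F x)) (h x • gradient (η n) x)
        = ∫ x in (ball (0 : Space d) n)ᶜ, inner ℝ (A x (F x)) (h x • gradient (η n) x) := by
      refine (setIntegral_eq_integral_of_forall_compl_eq_zero fun x hx => ?_).symm
      by_contra hne
      have := (h8 n x (fun h0 => hne (by rw [h0, smul_zero, inner_zero_right]))).2
      exact hx fun h => this (ball_subset_ball (by linarith) h)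
    rw [e, Real.norm_eq_abs]
    refine (abs_integral_inner_le (hF.restrict _) ((hg2 n).restrict _)).trans ?_
    refine mul_le_mul_of_nonneg_left ?_ ENNReal.toReal_nonneg
    exact ENNReal.toReal_mono hK ((eLpNorm_mono_measure _ Measure.restrict_le_self).trans (hbd n))
  have l3 := l1.add l2
  rw [add_zero] at l3
  refine tendsto_nhds_unique l3 (tendsto_const_nhds.congr' ?_)
  obtain ⟨N, hN⟩ := exists_nat_gt (‖z‖ + r)
  filter_upwards [Filter.eventually_ge_atTop N] with n hn
  rw [key n]
  refine setIntegral_congr_fun measurableSet_ball fun x hx => ?_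
  have hn' : (N : ℝ) ≤ n := by exact_mod_cast hn
  have hx' : ‖x‖ ≤ n + 1 := by
    have := norm_add_le (x - z) z
    rw [mem_ball, dist_eq_norm] at hx
    rw [sub_add_cancel] at this
    linarith
  simp only [h4 n x (by rwa [mem_closedBall_zero_iff]), mul_one]

end GreenEstimates

namespace GreenEstimates


/-! ### Green's functions with a fixed pole -/

variable {d : ℕ} {lam : ℝ} {A : Space d → Space d →L[ℝ] Space d}

/-- `g` is a Green's function with pole `y` and weak gradient `Dg`. -/
def IsGreenPair (A : Space d → Space d →L[ℝ] Space d) (y : Space d) (g : Space d → ℝ)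
    (Dg : Space d → Space d) : Prop :=
  HasWeakGradient Set.univ g Dg ∧
    (∀ φ : Space d → ℝ, IsTestFunction Set.univ φ →
      ∫ x, inner ℝ (A x (Dg x)) (gradient φ x) = φ y) ∧
    ∀ r : ℝ, 0 < r →
      MemLp Dg 2 (volume.restrict (ball y r)ᶜ) ∧
      MemLp g (sobolevExponent d) (volume.restrict (ball y r)ᶜ)

lemma IsGreenPair.isHarmonicOn (hd : 3 ≤ d) {y : Space d} {g : Space d → ℝ} {Dg : Space d → Space d}
    (hg : IsGreenPair A y g Dg) {z : Space d} {s : ℝ} (hsz : s < ‖z - y‖) :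
    IsHarmonicOn A (ball z s) g Dg := by
  have hsub : ball z s ⊆ (ball y (‖z - y‖ - s))ᶜ := by
    intro x hx hx'
    rw [mem_ball, dist_eq_norm] at hx hx'
    have := norm_sub_le (x - y) (x - z)
    rw [sub_sub_sub_cancel_left] at this
    linarith
  obtain ⟨h1, h2⟩ := hg.2.2 (‖z - y‖ - s) (by linarith)
  have h2' := h2.mono_measure (Measure.restrict_mono_set volume hsub)
  refine ⟨hg.1.mono (Set.subset_univ _), h2'.mono_exponent (two_le_sobolevExponent hd),
    h1.mono_measure (Measure.restrict_mono_set volume hsub), fun φ hφ => ?_⟩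
  rw [setIntegral_eq_integral_of_forall_compl_eq_zero fun x hx => by
    rw [hφ.gradient_eq_zero hx, inner_zero_right], hg.2.1 φ (hφ.mono (Set.subset_univ _))]
  refine hφ.eq_zero fun hy => ?_
  rw [mem_ball, dist_eq_norm, norm_sub_rev] at hy
  linarith

lemma eLpNorm_smul_sub_smul_le {F : Type*} [NormedAddCommGroup F] [NormedSpace ℝ F]
    {U : Set (Space d)} {μ : Measure (Space d)} {a : Space d → F} {v : Space d → ℝ} {k : Space d → ℝ} {l : Space d → F}
    (hU : MeasurableSet U) (ha : AEStronglyMeasurable a μ) (hv : AEStronglyMeasurable v μ)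
    (hk : Continuous k) (hl : Continuous l) {K : ℝ} (hk1 : ∀ x, ‖k x‖ ≤ 1) (hK : ∀ x, ‖l x‖ ≤ K)
    (hlU : ∀ x ∉ U, l x = 0) :
    eLpNorm (fun x => k x • a x - v x • l x) 2 μ
      ≤ eLpNorm a 2 μ + ENNReal.ofReal K * eLpNorm v 2 (μ.restrict U) := by
  refine (eLpNorm_sub_le (hk.aestronglyMeasurable.smul ha) (hv.smul hl.aestronglyMeasurable)
    (by norm_num)).trans (add_le_add ?_ ?_)
  · refine eLpNorm_mono fun x => ?_
    simp only [Pi.smul_apply', norm_smul]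
    exact mul_le_of_le_one_left (norm_nonneg _) (hk1 x)
  · have e : (v • l) = U.indicator (fun x => v x • l x) := by
      ext1 x
      by_cases hx : x ∈ U
      · simp [hx]
      · simp [hx, hlU x hx]
    rw [e, eLpNorm_indicator_eq_eLpNorm_restrict hU]
    refine eLpNorm_le_mul_eLpNorm_of_ae_le_mul (Filter.Eventually.of_forall fun x => ?_) 2
    rw [norm_smul, mul_comm]
    exact mul_le_mul_of_nonneg_right (hK x) (norm_nonneg _)

variable [hd : Fact (3 ≤ d)]

/-- A cutoff function near the pole of a Green's function. -/
structure IsPoleCutoff (y : Space d) (r : ℝ) (η : Space d → ℝ) : Prop where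
  pos : 0 < r
  contDiff : ContDiff ℝ ∞ η
  nonneg : ∀ x, 0 ≤ η x
  le_one : ∀ x, η x ≤ 1
  eq_one : ∀ x ∈ closedBall y r, η x = 1
  eq_zero : ∀ x, x ∉ ball y (2 * r) → η x = 0
  tsupport_subset : tsupport η ⊆ closedBall y (2 * r)
  gradient_ne_zero : ∀ x, gradient η x ≠ 0 → x ∈ annulus y r

omit hd in
lemma IsPoleCutoff.isTestFunction {y : Space d} {r : ℝ} {η : Space d → ℝ} (h : IsPoleCutoff y r η) :
    IsTestFunction Set.univ η :=
  ⟨h.contDiff, HasCompactSupport.of_support_subset_isCompact (isCompact_closedBall _ _)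
    (subset_closure.trans h.tsupport_subset), Set.subset_univ _⟩

omit hd in
lemma IsPoleCutoff.gradient_eq_zero {y : Space d} {r : ℝ} {η : Space d → ℝ} (h : IsPoleCutoff y r η)
    {x : Space d} (hx : x ∉ annulus y r) : gradient η x = 0 := by
  by_contra hne; exact hx (h.gradient_ne_zero x hne)

omit hd in
lemma IsPoleCutoff.one_sub_eq_zero {y : Space d} {r : ℝ} {η : Space d → ℝ} (h : IsPoleCutoff y r η)
    {x : Space d} (hx : x ∈ ball y r) : 1 - η x = 0 := by
  rw [h.eq_one x (ball_subset_closedBall hx), sub_self]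

omit hd in
lemma annulus_subset_compl (y : Space d) (r : ℝ) : annulus y r ⊆ (ball y r)ᶜ := fun _ hx => hx.2

omit hd in
lemma annulus_subset_ball (y : Space d) {r : ℝ} (hr : 0 < r) : annulus y r ⊆ ball y (3 * r) :=
  Set.sdiff_subset.trans (closedBall_subset_ball (by linarith))

/-- The field in the second slot is the gradient of `1 - η` times the potential of `F`, a function
that vanishes near the pole and so does not see the delta. It is a limit of gradients of the test
functions `φ (1 - η)`, and off the pole `A Dg` is square integrable. -/
lemma IsGreenPair.integral_eq_zero (hA : IsUniformlyElliptic lam A) {y : Space d} {g : Space d → ℝ}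
    {Dg : Space d → Space d} (hg : IsGreenPair A y g Dg) {r : ℝ} {η : Space d → ℝ}
    (hη : IsPoleCutoff y r η) (F : energySpace d) :
    ∫ x in (ball y r)ᶜ, inner ℝ (A x (Dg x)) ((1 - η x) • F.1 x - potential d F x • gradient η x) = 0 := by
  have hr := hη.pos
  have hηt := hη.isTestFunction
  obtain ⟨K, hK⟩ := hηt.hasCompactSupport_gradient.exists_bound_of_continuous
    (continuous_gradient hη.contDiff)
  have hK0 : 0 ≤ K := (norm_nonneg _).trans (hK 0)
  have hD := (hg.2.2 r hr).1
  have hk1 : ∀ x, ‖1 - η x‖ ≤ 1 := fun x => by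
    rw [Real.norm_of_nonneg (by linarith [hη.le_one x])]; linarith [hη.nonneg x]
  have hU : ∀ x ∉ ball y (3 * r), gradient η x = 0 := fun x hx =>
    hη.gradient_eq_zero fun h => hx (annulus_subset_ball y hr h)
  have hbound : ∀ {a : Space d → Space d} {v : Space d → ℝ}, AEStronglyMeasurable a volume →
      AEStronglyMeasurable v volume →
      eLpNorm (fun x => (1 - η x) • a x - v x • gradient η x) 2 (volume.restrict (ball y r)ᶜ)
        ≤ eLpNorm a 2 volume + ENNReal.ofReal K * eLpNorm v 2 (volume.restrict (ball y (3 * r))) := by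
    intro a v ha hv
    exact (eLpNorm_mono_measure _ Measure.restrict_le_self).trans
      (eLpNorm_smul_sub_smul_le measurableSet_ball ha hv (continuous_const.sub hη.contDiff.continuous)
        (continuous_gradient hη.contDiff) hk1 hK hU)
  have hmeas : ∀ {a : Space d → Space d} {v : Space d → ℝ}, AEStronglyMeasurable a volume →
      AEStronglyMeasurable v volume →
      AEStronglyMeasurable (fun x => (1 - η x) • a x - v x • gradient η x)
        (volume.restrict (ball y r)ᶜ) := fun ha hv =>
    (((continuous_const.sub hη.contDiff.continuous).aestronglyMeasurable.smul ha).sub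
      (hv.smul (continuous_gradient hη.contDiff).aestronglyMeasurable)).restrict
  refine integral_inner_eq_of_approx (hA.memLp Measure.restrict_le_self.absolutelyContinuous hD) ?_ ?_
  · refine ⟨hmeas (Lp.aestronglyMeasurable _) (Lp.aestronglyMeasurable _),
      (hbound (Lp.aestronglyMeasurable _) (Lp.aestronglyMeasurable _)).trans_lt ?_⟩
    exact ENNReal.add_lt_top.2 ⟨(Lp.memLp F.1).2,
      ENNReal.mul_lt_top ENNReal.ofReal_lt_top (memLp_potential F y (3 * r)).2⟩
  · intro ε hε
    obtain ⟨φ, h1, h2, -⟩ := exists_test_near F y (3 * r) (ε := ε / (1 + ENNReal.ofReal K))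
      (ENNReal.div_pos hε.ne' (by simp))
    have mφ := (φ.2.memLp_gradient 2 volume)
    refine ⟨fun x => (1 - η x) • gradient φ.1 x - φ.1 x • gradient η x, ⟨hmeas mφ.1
      φ.2.continuous.aestronglyMeasurable, (hbound mφ.1 φ.2.continuous.aestronglyMeasurable).trans_lt
      (ENNReal.add_lt_top.2 ⟨mφ.2, ENNReal.mul_lt_top ENNReal.ofReal_lt_top (φ.2.memLp 2 _).2⟩)⟩, ?_, ?_⟩
    · have e : ∀ x, ((1 - η x) • F.1 x - potential d F x • gradient η x)
          - ((1 - η x) • gradient φ.1 x - φ.1 x • gradient η x)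
          = (1 - η x) • (F.1 x - gradient φ.1 x) - (potential d F x - φ.1 x) • gradient η x := by
        intro x; rw [smul_sub (1 - η x), sub_smul (potential d F x)]; abel
      simp only [e]
      refine (hbound ((Lp.aestronglyMeasurable _).sub mφ.1)
        ((Lp.aestronglyMeasurable _).sub φ.2.continuous.aestronglyMeasurable)).trans ?_
      calc _ ≤ ε / (1 + ENNReal.ofReal K) + ENNReal.ofReal K * (ε / (1 + ENNReal.ofReal K)) := by
            exact add_le_add h1 (mul_le_mul_right h2 _)
        _ = (1 + ENNReal.ofReal K) * (ε / (1 + ENNReal.ofReal K)) := by ring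
        _ = ε := ENNReal.mul_div_cancel (by simp) (by simp)
        _ ≤ ε := le_rfl
    · have ht : IsTestFunction Set.univ (fun x => φ.1 x * (1 - η x)) :=
        IsTestFunction.mul_left φ.2 (contDiff_const.sub hη.contDiff)
      have e : ∀ x, (1 - η x) • gradient φ.1 x - φ.1 x • gradient η x
          = gradient (fun x => φ.1 x * (1 - η x)) x := by
        intro x
        have hη1 : DifferentiableAt ℝ η x := hηt.differentiable x
        have hη2 : DifferentiableAt ℝ (fun x => 1 - η x) x := (differentiableAt_const _).sub hη1
        rw [gradient_mul (φ.2.differentiable x) hη2, sub_eq_add_neg,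
          ← smul_neg]
        congr 2
        refine ext_inner_right ℝ fun v => ?_
        rw [inner_neg_left, inner_gradient, inner_gradient, fderiv_const_sub]; simp
      have e2 := hg.2.1 _ ht
      simp only [e]
      rw [setIntegral_eq_integral_of_forall_compl_eq_zero, e2, hη.eq_one y (mem_closedBall_self hr.le)]
      · simp
      · intro x hx
        have hx : x ∈ ball y r := not_not.1 hx
        rw [← e, hη.one_sub_eq_zero hx, hη.gradient_eq_zero fun h => h.2 hx]
        simp

end GreenEstimates

namespace GreenEstimates


/-! ### The representation formula on an annulus -/

variable {d : ℕ} {lam : ℝ} {A : Space d → Space d →L[ℝ] Space d}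

lemma IsPoleCutoff.norm_one_sub_le {y : Space d} {r : ℝ} {η : Space d → ℝ} (h : IsPoleCutoff y r η)
    (x : Space d) : ‖1 - η x‖ ≤ 1 := by
  rw [Real.norm_of_nonneg (by linarith [h.le_one x])]; linarith [h.nonneg x]

instance isFiniteMeasure_restrict_annulus (y : Space d) (r : ℝ) :
    IsFiniteMeasure (volume.restrict (annulus y r)) :=
  isFiniteMeasure_restrict.2
    ((measure_mono Set.sdiff_subset).trans_lt measure_closedBall_lt_top).ne

lemma IsPoleCutoff.memLp_smul_gradient {y : Space d} {r : ℝ} {η : Space d → ℝ}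
    (h : IsPoleCutoff y r η) {u : Space d → ℝ} (hu : MemLp u 2 (volume.restrict (annulus y r))) :
    MemLp (fun x => u x • gradient η x) 2 volume :=
  memLp_smul_of_support' (measurableSet_annulus y r) hu (continuous_gradient h.contDiff)
    h.isTestFunction.hasCompactSupport_gradient fun _ hx => h.gradient_eq_zero hx

lemma IsPoleCutoff.memLp_one_sub_smul {y : Space d} {r : ℝ} {η : Space d → ℝ}
    (h : IsPoleCutoff y r η) {F : Type*} [NormedAddCommGroup F] [NormedSpace ℝ F] {p : ENNReal}
    {u : Space d → F} (hm : AEStronglyMeasurable u volume)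
    (hu : MemLp u p (volume.restrict (ball y r)ᶜ)) : MemLp (fun x => (1 - η x) • u x) p volume := by
  have indic : (fun x => (1 - η x) • u x) = (ball y r)ᶜ.indicator (fun x => (1 - η x) • u x) := by
    ext1 x
    by_cases hx : x ∈ (ball y r)ᶜ
    · rw [Set.indicator_of_mem hx]
    · rw [Set.indicator_of_notMem hx, h.one_sub_eq_zero (not_not.1 hx), zero_smul]
  rw [indic, memLp_indicator_iff_restrict measurableSet_ball.compl]
  refine hu.of_le ((continuous_const.sub h.contDiff.continuous).aestronglyMeasurable.smul hm).restrict
    (Filter.Eventually.of_forall fun x => ?_)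
  rw [norm_smul]; exact mul_le_of_le_one_left (norm_nonneg _) (h.norm_one_sub_le x)

lemma IsGreenPair.aestronglyMeasurable (hd : 3 ≤ d) {y : Space d} {g : Space d → ℝ}
    {Dg : Space d → Space d} (hg : IsGreenPair A y g Dg) : AEStronglyMeasurable g volume :=
  (locallyIntegrableOn_univ.1 (hg.1 ⟨0, by omega⟩).1).aestronglyMeasurable

lemma IsGreenPair.memLp_annulus (hd : 3 ≤ d) {y : Space d} {g : Space d → ℝ}
    {Dg : Space d → Space d} (hg : IsGreenPair A y g Dg) {r : ℝ} (hr : 0 < r) :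
    MemLp g 2 (volume.restrict (annulus y r)) :=
  (((hg.2.2 r hr).2).mono_measure (Measure.restrict_mono_set _
    (annulus_subset_compl y r))).mono_exponent (two_le_sobolevExponent hd)

/-- Removing the singularity makes the Green's function admissible in `integral_coeff_solOp_eq`; its
decay at infinity is exactly membership in the Sobolev space `L^{2d/(d-2)}`. -/
lemma IsGreenPair.truncation (hd : 3 ≤ d) {y : Space d} {g : Space d → ℝ} {Dg : Space d → Space d}
    (hg : IsGreenPair A y g Dg) {r : ℝ} {η : Space d → ℝ} (hη : IsPoleCutoff y r η) :
    HasWeakGradient Set.univ (fun x => (1 - η x) • g x)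
      (fun x => (1 - η x) • Dg x - g x • gradient η x) ∧
    MemLp (fun x => (1 - η x) • g x) (sobolevExponent d) volume ∧
    MemLp (fun x => (1 - η x) • Dg x - g x • gradient η x) 2 volume := by
  obtain ⟨hD, hgp⟩ := hg.2.2 r hη.pos
  refine ⟨fun i => ?_, hη.memLp_one_sub_smul (hg.aestronglyMeasurable hd) hgp,
    (hη.memLp_one_sub_smul hg.1.aestronglyMeasurable hD).sub
      (hη.memLp_smul_gradient (hg.memLp_annulus hd hη.pos))⟩
  have := (hg.1 i).sub ((hg.1.mul_test hη.isTestFunction) i)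
  convert this using 2 with x x
  · simp only [smul_eq_mul]; ring
  · simp only [PiLp.add_apply, PiLp.sub_apply, PiLp.smul_apply, smul_eq_mul]
    ring

lemma setIntegral_inner_smul_sub {U : Set (Space d)} {B k : Space d → Space d} {v : Space d → ℝ}
    {c : ℝ} (h1 : IntegrableOn (fun x => inner ℝ (B x) (v x • k x)) U)
    (h2 : IntegrableOn (fun x => inner ℝ (B x) (k x)) U) :
    ∫ x in U, inner ℝ (B x) ((v x - c) • k x)
      = (∫ x in U, inner ℝ (B x) (v x • k x)) - c * ∫ x in U, inner ℝ (B x) (k x) := by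
  rw [← integral_const_mul, ← integral_sub h1 (h2.const_mul c)]
  congr 1; ext x
  rw [inner_smul_right, inner_smul_right]; ring

/-- The algebra behind the representation formula for Green's functions. -/
lemma integral_annulus_identity (hA : IsUniformlyElliptic lam A) {y : Space d} {r : ℝ}
    {η : Space d → ℝ} (hη : IsPoleCutoff y r η) {F Dg : Space d → Space d} {v g : Space d → ℝ}
    (hF : MemLp F 2 volume) (hDm : AEStronglyMeasurable Dg volume)
    (hD : MemLp Dg 2 (volume.restrict (ball y r)ᶜ))
    (hv : MemLp v 2 (volume.restrict (annulus y r)))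
    (hg : MemLp g 2 (volume.restrict (annulus y r))) {I c c' : ℝ}
    (E1 : ∫ x, inner ℝ (adjointField A x (F x)) ((1 - η x) • Dg x - g x • gradient η x) = I)
    (E2 : ∫ x, inner ℝ (adjointField A x (F x)) (gradient η x) = 0)
    (E3 : ∫ x in (ball y r)ᶜ, inner ℝ (A x (Dg x)) ((1 - η x) • F x - v x • gradient η x) = 0)
    (E4 : ∫ x, inner ℝ (A x (Dg x)) (gradient η x) = 1) :
    I = c' + (∫ x in annulus y r, inner ℝ (A x (Dg x)) ((v x - c') • gradient η x))
        - ∫ x in annulus y r, inner ℝ (adjointField A x (F x)) ((g x - c) • gradient η x) := by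
  have hηt := hη.isTestFunction
  have hUS := annulus_subset_compl y r
  have hη0 : ∀ x ∉ annulus y r, gradient η x = 0 := fun x hx => hη.gradient_eq_zero hx
  have hT : MemLp (fun x => adjointField A x (F x)) 2 volume :=
    hA.adjoint.memLp Measure.AbsolutelyContinuous.rfl hF
  have hAD : MemLp (fun x => A x (Dg x)) 2 (volume.restrict (ball y r)ᶜ) :=
    hA.memLp Measure.restrict_le_self.absolutelyContinuous hD
  have hADU : MemLp (fun x => A x (Dg x)) 2 (volume.restrict (annulus y r)) :=
    hAD.mono_measure (Measure.restrict_mono_set _ hUS)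
  have hDg := hη.memLp_one_sub_smul hDm hD
  have hFη := hη.memLp_one_sub_smul hF.1 (hF.restrict _)
  have hvη := hη.memLp_smul_gradient hv
  have hgη := hη.memLp_smul_gradient hg
  have hG : MemLp (gradient η) 2 volume := hηt.memLp_gradient 2 volume
  have toU : ∀ B : Space d → Space d, ∀ k : Space d → ℝ,
      ∫ x, inner ℝ (B x) (k x • gradient η x) = ∫ x in annulus y r, inner ℝ (B x) (k x • gradient η x) :=
    fun B k => (setIntegral_eq_integral_of_forall_compl_eq_zero fun x hx => by
      rw [hη0 x hx, smul_zero, inner_zero_right]).symm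
  have toU' : ∀ B : Space d → Space d,
      ∫ x, inner ℝ (B x) (gradient η x) = ∫ x in annulus y r, inner ℝ (B x) (gradient η x) :=
    fun B => (setIntegral_eq_integral_of_forall_compl_eq_zero fun x hx => by
      rw [hη0 x hx, inner_zero_right]).symm
  have toS : ∫ x in (ball y r)ᶜ, inner ℝ (A x (Dg x)) (v x • gradient η x)
      = ∫ x in annulus y r, inner ℝ (A x (Dg x)) (v x • gradient η x) := by
    rw [← toU]
    exact setIntegral_eq_integral_of_forall_compl_eq_zero fun x hx => by
      rw [hη0 x fun h => hx (hUS h), smul_zero, inner_zero_right]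
  have toS' : ∫ x in (ball y r)ᶜ, inner ℝ (A x (Dg x)) ((1 - η x) • F x)
      = ∫ x, inner ℝ (adjointField A x (F x)) ((1 - η x) • Dg x) := by
    rw [setIntegral_eq_integral_of_forall_compl_eq_zero fun x hx => by
      rw [hη.one_sub_eq_zero (not_not.1 hx), zero_smul, inner_zero_right]]
    congr 1; ext x
    rw [inner_smul_right, inner_smul_right, adjointField, ContinuousLinearMap.adjoint_inner_left,
      real_inner_comm]
  have i1 := integrable_inner_of_memLp hT hDg
  have i2 := integrable_inner_of_memLp hT hgη
  have i3 := integrable_inner_of_memLp hAD (hFη.restrict _)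
  have i4 := integrable_inner_of_memLp hAD (hvη.restrict _)
  -- The term with `(1 - η) A Dg · F` occurs in both `E1` and `E3` and cancels. The constants are
  -- then free: `E2` shows that `c` contributes nothing, and `E4` that `c'` contributes exactly
  -- `c'`.
  simp only [inner_sub_right] at E1 E3
  rw [integral_sub i1 i2, toU] at E1
  rw [integral_sub i3 i4, toS, toS'] at E3
  rw [toU'] at E2 E4
  rw [setIntegral_inner_smul_sub (integrable_inner_of_memLp hADU (hvη.restrict _))
      (integrable_inner_of_memLp hADU (hG.restrict _)),
    setIntegral_inner_smul_sub (integrable_inner_of_memLp (hT.restrict _) (hgη.restrict _))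
      (integrable_inner_of_memLp (hT.restrict _) (hG.restrict _)), E2, E4]
  linarith

variable [hd : Fact (3 ≤ d)]

/-- Representation formula: the pairing of a Green's function with a right hand side, in terms of
integrals over a small annulus around the pole. -/
lemma IsGreenPair.integral_mul_eq (hlam : 0 < lam) (hA : IsUniformlyElliptic lam A) {y : Space d}
    {g : Space d → ℝ} {Dg : Space d → Space d} (hg : IsGreenPair A y g Dg) {r : ℝ} {η : Space d → ℝ}
    (hη : IsPoleCutoff y r η) {z : Space d} {ρ : ℝ} (hz : Disjoint (ball z ρ) (ball y (2 * r)))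
    (f : Lp ℝ 2 (volume.restrict (ball z ρ))) (F : energySpace d)
    (hF : F = solOp hlam hA.adjoint ((restrictLp z ρ).adjoint f)) (c c' : ℝ) :
    ∫ x in ball z ρ, f x * g x
      = c' + (∫ x in annulus y r, inner ℝ (A x (Dg x)) ((potential d F x - c') • gradient η x))
        - ∫ x in annulus y r, inner ℝ (adjointField A x (F.1 x)) ((g x - c) • gradient η x) := by
  have hr := hη.pos
  have hηt := hη.isTestFunction
  obtain ⟨h1, h2, h3⟩ := hg.truncation hd.out hη
  have hηz : ∀ x ∈ ball z ρ, η x = 0 := fun x hx => hη.eq_zero x (Set.disjoint_left.1 hz hx)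
  have E1 : ∫ x, inner ℝ (adjointField A x (F.1 x)) ((1 - η x) • Dg x - g x • gradient η x)
      = ∫ x in ball z ρ, f x * ((1 - η x) • g x) := by
    rw [hF]; exact integral_coeff_solOp_eq hlam hA.adjoint f h1 h2 h3
  have E2 : ∫ x, inner ℝ (adjointField A x (F.1 x)) (gradient η x)
      = ∫ x in ball z ρ, f x * η x := by
    rw [hF]
    exact (integral_coeff_solOp hlam hA.adjoint _ ⟨η, hηt⟩).trans
      (inner_restrictLp_adjoint_gradEnergy z ρ f ⟨η, hηt⟩)
  have E1' : ∫ x in ball z ρ, f x * ((1 - η x) • g x) = ∫ x in ball z ρ, f x * g x :=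
    setIntegral_congr_fun measurableSet_ball fun x hx => by
      simp only [hηz x hx, sub_zero, one_smul]
  have E2' : ∫ x in ball z ρ, f x * η x = 0 :=
    setIntegral_eq_zero_of_forall_eq_zero fun x hx => by rw [hηz x hx, mul_zero]
  -- The mass of the delta: the cutoff equals `1` at the pole.
  have E4 : ∫ x, inner ℝ (A x (Dg x)) (gradient η x) = 1 := by
    rw [hg.2.1 η hηt, hη.eq_one y (mem_closedBall_self hr.le)]
  have hv : MemLp (potential d F) 2 (volume.restrict (annulus y r)) :=
    (memLp_potential F y (3 * r)).mono_measure
      (Measure.restrict_mono_set _ (annulus_subset_ball y hr))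
  exact integral_annulus_identity hA hη (Lp.memLp F.1) hg.1.aestronglyMeasurable (hg.2.2 r hr).1
    hv (hg.memLp_annulus hd.out hr) (E1.trans E1') (E2.trans E2') (hg.integral_eq_zero hA hη F) E4

end GreenEstimates

namespace GreenEstimates


/-! ### Passage to the pole -/

variable {d : ℕ} {lam : ℝ} {A : Space d → Space d →L[ℝ] Space d}

lemma ofReal_abs_integral_inner_le {X F : Type*} [MeasurableSpace X] {μ : Measure X}
    [NormedAddCommGroup F] [InnerProductSpace ℝ F] {f g : X → F} (hf : MemLp f 2 μ) (hg : MemLp g 2 μ) :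
    ENNReal.ofReal |∫ x, inner ℝ (f x) (g x) ∂μ| ≤ eLpNorm f 2 μ * eLpNorm g 2 μ := by
  rw [← ENNReal.ofReal_toReal hf.2.ne, ← ENNReal.ofReal_toReal hg.2.ne,
    ← ENNReal.ofReal_mul ENNReal.toReal_nonneg]
  exact ENNReal.ofReal_le_ofReal (abs_integral_inner_le hf hg)

lemma le_ofReal_sqrt_mul {a b : ENNReal} {K : ℝ} (h : a ^ 2 ≤ ENNReal.ofReal K * b ^ 2) :
    a ≤ ENNReal.ofReal √K * b := by
  rw [← ENNReal.pow_le_pow_left_iff two_ne_zero, mul_pow, ← ENNReal.ofReal_pow (Real.sqrt_nonneg _)]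
  refine h.trans ?_
  gcongr
  rcases le_total 0 K with hK | hK
  · rw [Real.sq_sqrt hK]
  · exact hK.trans (sq_nonneg _)

lemma exists_poleCutoff : ∃ c : ℝ, 0 < c ∧ ∀ (d : ℕ) (y : Space d) (r : ℝ), 0 < r →
    ∃ η, IsPoleCutoff y r η ∧ ∀ x, ‖gradient η x‖ ≤ c / r := by
  obtain ⟨c, hc, h⟩ := exists_cutoff
  refine ⟨c, hc, fun d y r hr => ?_⟩
  obtain ⟨η, h1, h2, h3, h4, h5, h6, h7, h8⟩ := h d y r (2 * r) hr (by linarith)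
  exact ⟨η, ⟨hr, h1, h2, h3, h4, h5, h7, h8⟩, fun x => (h6 x).trans (le_of_eq (by congr 1; ring))⟩

lemma eLpNorm_smul_le {F : Type*} [NormedAddCommGroup F] [NormedSpace ℝ F] {μ : Measure (Space d)}
    {u : Space d → ℝ} {k : Space d → F} {K : ℝ} (hK : ∀ x, ‖k x‖ ≤ K) :
    eLpNorm (fun x => u x • k x) 2 μ ≤ ENNReal.ofReal K * eLpNorm u 2 μ := by
  refine eLpNorm_le_mul_eLpNorm_of_ae_le_mul (Filter.Eventually.of_forall fun x => ?_) 2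
  rw [norm_smul, mul_comm]
  exact mul_le_mul_of_nonneg_right (hK x) (norm_nonneg _)

/-- Bounds for the two error terms in the representation formula. -/
lemma abs_integral_annulus_le (hd : 3 ≤ d) (hA : IsUniformlyElliptic lam A) {y : Space d}
    {g : Space d → ℝ} {Dg : Space d → Space d} (hg : IsGreenPair A y g Dg) {r : ℝ} {η : Space d → ℝ}
    (hη : IsPoleCutoff y r η) {c : ℝ} (hc : 0 < c) (hη2 : ∀ x, ‖gradient η x‖ ≤ c / r)
    {F : Space d → Space d} (hF : MemLp F 2 volume) {v : Space d → ℝ}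
    (hv : MemLp v 2 (volume.restrict (ball y (3 * r)))) {C P c₀ c' : ℝ} (hC : 0 < C) (hP : 0 < P)
    {I N : ENNReal} (hN : N = eLpNorm F 2 (volume.restrict (ball y (10 * r))))
    (hb1 : eLpNorm (fun x => g x - c₀) 2 (volume.restrict (annulus y r))
      ≤ ENNReal.ofReal √(C * r ^ 2 / r ^ d) * I)
    (hb2 : eLpNorm Dg 2 (volume.restrict (annulus y r)) ≤ ENNReal.ofReal √(C / r ^ d) * I)
    (hc' : eLpNorm (fun x => v x - c') 2 (volume.restrict (ball y (3 * r)))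
      ≤ ENNReal.ofReal (P * r) * N) :
    ENNReal.ofReal |∫ x in annulus y r, inner ℝ (A x (Dg x)) ((v x - c') • gradient η x)|
      ≤ ENNReal.ofReal (c * P * √C / √(r ^ d)) * N * I ∧
    ENNReal.ofReal |∫ x in annulus y r, inner ℝ (adjointField A x (F x)) ((g x - c₀) • gradient η x)|
      ≤ ENNReal.ofReal (c * √C / √(r ^ d)) * N * I := by
  have hr := hη.pos
  have hsub : annulus y r ⊆ ball y (3 * r) := annulus_subset_ball y hr
  have hDU : MemLp Dg 2 (volume.restrict (annulus y r)) :=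
    ((hg.2.2 r hr).1).mono_measure (Measure.restrict_mono_set _ (annulus_subset_compl y r))
  have hvU : MemLp (fun x => v x - c') 2 (volume.restrict (annulus y r)) :=
    (hv.mono_measure (Measure.restrict_mono_set _ hsub)).sub (memLp_const _)
  have hgU : MemLp (fun x => g x - c₀) 2 (volume.restrict (annulus y r)) :=
    (hg.memLp_annulus hd hr).sub (memLp_const _)
  have hac : volume.restrict (annulus y r) ≪ volume := Measure.restrict_le_self.absolutelyContinuous
  have hs : 0 < √(r ^ d) := Real.sqrt_pos.2 (by positivity)
  constructor
  · refine (ofReal_abs_integral_inner_le (hA.memLp hac hDU) ((hη.memLp_smul_gradient hvU).restrict _)).trans ?_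
    calc _ ≤ (ENNReal.ofReal √(C / r ^ d) * I) * (ENNReal.ofReal (c / r) * (ENNReal.ofReal (P * r) * N)) := by
          gcongr
          · exact (hA.eLpNorm_le hac Dg).trans hb2
          · refine (eLpNorm_smul_le hη2).trans ?_
            gcongr
            exact (eLpNorm_mono_measure _ (Measure.restrict_mono_set _ hsub)).trans hc'
      _ = (ENNReal.ofReal √(C / r ^ d) * (ENNReal.ofReal (c / r) * ENNReal.ofReal (P * r))) * N * I := by
          ring
      _ = _ := by
          rw [← ENNReal.ofReal_mul (by positivity), ← ENNReal.ofReal_mul (by positivity),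
            Real.sqrt_div' _ (by positivity)]
          congr 3
          field_simp
  · refine (ofReal_abs_integral_inner_le (hA.adjoint.memLp hac (hF.restrict _))
      ((hη.memLp_smul_gradient hgU).restrict _)).trans ?_
    calc _ ≤ N * (ENNReal.ofReal (c / r) * (ENNReal.ofReal √(C * r ^ 2 / r ^ d) * I)) := by
          gcongr
          · rw [hN]
            refine (hA.adjoint.eLpNorm_le hac _).trans (eLpNorm_mono_measure _ (Measure.restrict_mono_set _ ?_))
            exact hsub.trans (ball_subset_ball (by linarith))
          · refine (eLpNorm_smul_le hη2).trans ?_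
            gcongr
      _ = (ENNReal.ofReal (c / r) * ENNReal.ofReal √(C * r ^ 2 / r ^ d)) * N * I := by
          ring
      _ = _ := by
          rw [← ENNReal.ofReal_mul (by positivity), Real.sqrt_div' _ (by positivity),
            Real.sqrt_mul' _ (by positivity), Real.sqrt_sq hr.le]
          congr 3
          field_simp

/-- The solution of `-∇ · A ∇ v = f` for a right hand side supported in a ball, as an element of
the energy space. -/
noncomputable def ballSol [Fact (3 ≤ d)] (hlam : 0 < lam) (hA : IsUniformlyElliptic lam A) (z : Space d)
    (ρ : ℝ) : Lp ℝ 2 (volume.restrict (ball z ρ)) →L[ℝ] energySpace d :=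
  (solOp hlam hA).comp (ContinuousLinearMap.adjoint (restrictLp z ρ))

lemma ballSol_apply [Fact (3 ≤ d)] (hlam : 0 < lam) (hA : IsUniformlyElliptic lam A) (z : Space d)
    (ρ : ℝ) (f : Lp ℝ 2 (volume.restrict (ball z ρ))) :
    ballSol hlam hA z ρ f = solOp hlam hA ((restrictLp z ρ).adjoint f) := rfl

/-- The free constants of the representation formula are taken from Poincaré's inequality, `c'` for
the potential and `c₀` for the Green's function. The annulus bounds convert `L¹` of `Dg` into `L²`,
and all powers of `r` other than `r^{-d/2}` cancel. -/
lemma exists_representation_bound [hd : Fact (3 ≤ d)] (hlam0 : 0 < lam) (hlam1 : lam < 1) :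
    ∃ C : ℝ, 0 < C ∧ ∀ (A : Space d → Space d →L[ℝ] Space d)
      (hA : IsUniformlyElliptic lam A) (y : Space d) (g : Space d → ℝ) (Dg : Space d → Space d),
      IsGreenPair A y g Dg → ∀ (z : Space d) (ρ r : ℝ), 0 < r →
      Disjoint (ball z ρ) (ball y (2 * r)) → ∀ (f : Lp ℝ 2 (volume.restrict (ball z ρ)))
      (F : energySpace d), F = ballSol hlam0 hA.adjoint z ρ f →
      ∃ c' : ℝ, eLpNorm (fun x => potential d F x - c') 2 (volume.restrict (ball y (3 * r)))
          ≤ ENNReal.ofReal (C * r) * eLpNorm F.1 2 (volume.restrict (ball y (10 * r))) ∧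
        ENNReal.ofReal |(∫ x in ball z ρ, f x * g x) - c'|
          ≤ ENNReal.ofReal (C / √(r ^ d)) * eLpNorm F.1 2 (volume.restrict (ball y (10 * r)))
            * ∫⁻ x in ball y (13 * r), ‖Dg x‖ₑ := by
  have hd3 := hd.out
  obtain ⟨c, hc, hcut⟩ := exists_poleCutoff
  obtain ⟨C, hC, hann⟩ := exists_annulus_bound hlam0 hlam1 (by omega : 0 < d)
  set P : ℝ := 2 ^ (d + 1) * 3
  refine ⟨P + (c * P * √C + c * √C), by positivity, ?_⟩
  intro A hA y g Dg hg z ρ r hr hdisj f F hF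
  obtain ⟨η, hη, hη2⟩ := hcut d y r hr
  obtain ⟨c₀, ha1, ha2⟩ := hann A hA y g Dg hg.1 (fun z s _ hs => hg.isHarmonicOn hd3 hs) r hr
  obtain ⟨c', hc'⟩ := exists_poincare (by omega : 0 < d) (p := 2) (by norm_num) (by norm_num)
    (r := 3 * r) (s := 10 * r) (z := y) (by positivity) (by linarith)
    ((hasWeakGradient_potential F).mono (Set.subset_univ _)) (memLp_potential F y (10 * r))
    ((Lp.memLp F.1).restrict _)
  set I := ∫⁻ x in ball y (13 * r), ‖Dg x‖ₑ
  set N := eLpNorm F.1 2 (volume.restrict (ball y (10 * r)))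
  have hrep := hg.integral_mul_eq hlam0 hA hη hdisj f F (hF.trans (ballSol_apply hlam0 hA.adjoint z ρ f)) c₀ c'
  refine ⟨c', hc'.trans ?_, ?_⟩
  · gcongr ENNReal.ofReal ?_ * _
    rw [← mul_assoc]
    exact mul_le_mul_of_nonneg_right (le_add_of_nonneg_right (by positivity)) hr.le
  rw [lintegral_enorm_sq] at ha1 ha2
  have hb1 := le_ofReal_sqrt_mul ha1
  have hb2 := le_ofReal_sqrt_mul ha2
  obtain ⟨t1, t2⟩ := abs_integral_annulus_le hd3 hA hg hη hc hη2 (Lp.memLp F.1)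
    (memLp_potential F y (3 * r)) hC (P := P) (by positivity) rfl hb1 hb2
    (by rw [show P * r = 2 ^ (d + 1) * (3 * r) by ring]; exact hc')
  rw [hrep]
  set T1 := ∫ x in annulus y r, inner ℝ (A x (Dg x)) ((potential d F x - c') • gradient η x)
  set T2 := ∫ x in annulus y r, inner ℝ (adjointField A x (F.1 x)) ((g x - c₀) • gradient η x)
  calc ENNReal.ofReal |c' + T1 - T2 - c'| ≤ ENNReal.ofReal (|T1| + |T2|) := by
        refine ENNReal.ofReal_le_ofReal ?_
        rw [show c' + T1 - T2 - c' = T1 - T2 by ring]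
        exact abs_sub _ _
    _ = ENNReal.ofReal |T1| + ENNReal.ofReal |T2| := ENNReal.ofReal_add (abs_nonneg _) (abs_nonneg _)
    _ ≤ ENNReal.ofReal (c * P * √C / √(r ^ d)) * N * I + ENNReal.ofReal (c * √C / √(r ^ d)) * N * I :=
        add_le_add t1 t2
    _ = ENNReal.ofReal ((c * P * √C + c * √C) / √(r ^ d)) * N * I := by
        rw [← add_mul, ← add_mul, ← ENNReal.ofReal_add (by positivity) (by positivity), add_div]
    _ ≤ _ := by
        gcongr ENNReal.ofReal (?_ / _) * _ * _
        exact le_add_of_nonneg_left (by positivity)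

lemma tendsto_lintegral_ball_zero {Dg : Space d → Space d} {y : Space d} (hd : 0 < d)
    (h : IntegrableOn Dg (ball y 1)) :
    Filter.Tendsto (fun r : ℝ => ∫⁻ x in ball y r, ‖Dg x‖ₑ) (𝓝[>] 0) (𝓝 0) := by
  have h0 : Filter.Tendsto (fun r : ℝ => volume (ball y r)) (𝓝[>] 0) (𝓝 0) := by
    have : Filter.Tendsto (fun r : ℝ => ENNReal.ofReal (r ^ d) * volume (ball (0 : Space d) 1))
        (𝓝[>] 0) (𝓝 (ENNReal.ofReal (0 ^ d) * volume (ball (0 : Space d) 1))) := by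
      refine ENNReal.Tendsto.mul_const ?_ (Or.inr measure_ball_lt_top.ne)
      exact ENNReal.tendsto_ofReal (((continuous_pow d).tendsto 0).mono_left nhdsWithin_le_nhds)
    simp only [zero_pow hd.ne', ENNReal.ofReal_zero, zero_mul] at this
    refine this.congr' ?_
    filter_upwards [self_mem_nhdsWithin] with r hr
    rw [volume_ball_eq hd y (le_of_lt hr)]
  have h1 : Filter.Tendsto (fun r : ℝ => (volume.restrict (ball y 1)) (ball y r)) (𝓝[>] 0) (𝓝 0) :=
    tendsto_of_tendsto_of_tendsto_of_le_of_le (tendsto_const_nhds (x := (0 : ENNReal))) h0 (fun r => bot_le)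
      fun r => Measure.restrict_le_self _
  have h2 := tendsto_setLIntegral_zero (μ := volume.restrict (ball y 1)) (f := fun x => ‖Dg x‖ₑ)
    (ne_of_lt h.2) h1
  refine h2.congr' ?_
  filter_upwards [Ioo_mem_nhdsGT (show (0 : ℝ) < 1 by norm_num)] with r hr
  rw [Measure.restrict_restrict measurableSet_ball, Set.inter_eq_left.2 (ball_subset_ball hr.2.le)]

/-- By `h1` the `L²` norm of `F` on `ball y (10 * r)` is `O(r^{d/2})`, which compensates `√(r ^ d)`.
So `|J - c'|` is controlled by the integral of `‖Dg‖` over a shrinking ball and tends to zero, while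
the first bound puts `c'` within `O(r)` of `v` in mean, and `h2` identifies the limit as `v y`. -/
lemma eq_of_forall_annulus_bound (hd0 : 0 < d) {y : Space d} {v : Space d → ℝ} {F Dg : Space d → Space d}
    (hv : ∀ r, MemLp v 2 (volume.restrict (ball y r))) (hF : MemLp F 2 volume)
    (hDg : IntegrableOn Dg (ball y 1)) {C L J δ : ℝ} (hC : 0 < C) (hδ : 0 < δ)
    (hrep : ∀ r, 0 < r → 2 * r < δ → ∃ c' : ℝ,
      eLpNorm (fun x => v x - c') 2 (volume.restrict (ball y (3 * r)))
          ≤ ENNReal.ofReal (C * r) * eLpNorm F 2 (volume.restrict (ball y (10 * r))) ∧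
        ENNReal.ofReal |J - c'|
          ≤ ENNReal.ofReal (C / √(r ^ d)) * eLpNorm F 2 (volume.restrict (ball y (10 * r)))
            * ∫⁻ x in ball y (13 * r), ‖Dg x‖ₑ)
    (h1 : Filter.Tendsto (fun r => ⨍ x in closedBall y r, ‖F x‖ ^ 2) (𝓝[>] 0) (𝓝 L))
    (h2 : Filter.Tendsto (fun r => ⨍ x in closedBall y r, ‖v x - v y‖) (𝓝[>] 0) (𝓝 0)) :
    J = v y := by
  have : Nonempty (Fin d) := ⟨⟨0, hd0⟩⟩
  have hI0 := tendsto_lintegral_ball_zero hd0 hDg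
  have hscale : ∀ k : ℝ, 0 < k → Filter.Tendsto (fun r : ℝ => k * r) (𝓝[>] 0) (𝓝[>] 0) := by
    intro k hk
    refine tendsto_nhdsWithin_iff.2 ⟨?_, ?_⟩
    · have : Filter.Tendsto (fun r : ℝ => k * r) (𝓝 0) (𝓝 (k * 0)) := by
        exact (continuous_const_mul k).tendsto 0
      rw [mul_zero] at this
      exact this.mono_left nhdsWithin_le_nhds
    · filter_upwards [self_mem_nhdsWithin] with r hr
      exact mul_pos hk hr
  set V := volume.real (ball (0 : Space d) 1) with hV
  have hVpos : 0 < V := ENNReal.toReal_pos (measure_ball_pos volume _ one_pos).ne' measure_ball_lt_top.ne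
  have hvol : ∀ r : ℝ, 0 ≤ r → volume.real (closedBall y r) = r ^ d * V := by
    intro r hr
    rw [measureReal_def, Measure.addHaar_closedBall_eq_addHaar_ball, volume_ball_eq hd0 y hr,
      ENNReal.toReal_mul, ENNReal.toReal_ofReal (by positivity), hV, measureReal_def]
  -- For small `r`, the integral of `‖F‖²` over the ball of radius `10 r` is at most `K r^d`.
  set K := 10 ^ d * V * (|L| + 1)
  have hK : 0 < K := by positivity
  -- The first summand bounds `|J - c'|`, the bracket bounds `|c' - v y|`.
  set E : ℝ → ℝ := fun r => C * √K * (∫⁻ x in ball y (13 * r), ‖Dg x‖ₑ).toReal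
    + (C * √K / √(2 ^ d * V) * r + ⨍ x in closedBall y (2 * r), ‖v x - v y‖)
  have hE : Filter.Tendsto E (𝓝[>] 0) (𝓝 0) := by
    have e1 := (ENNReal.tendsto_toReal ENNReal.zero_ne_top).comp (hI0.comp (hscale 13 (by norm_num)))
    have e2 : Filter.Tendsto (fun r : ℝ => r) (𝓝[>] 0) (𝓝 0) := nhdsWithin_le_nhds
    have := (e1.const_mul (C * √K)).add ((e2.const_mul (C * √K / √(2 ^ d * V))).add
      (h2.comp (hscale 2 (by norm_num))))
    simp only [mul_zero, add_zero, ENNReal.toReal_zero] at this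
    exact this
  have hbound : ∀ᶠ r in 𝓝[>] (0 : ℝ), |J - v y| ≤ E r := by
    have hL := (h1.comp (hscale 10 (by norm_num))).eventually_lt_const
      (show L < |L| + 1 by linarith [le_abs_self L])
    have hI := (hI0.comp (hscale 13 (by norm_num))).eventually_lt_const (ENNReal.zero_lt_top)
    filter_upwards [hL, hI, Ioo_mem_nhdsGT (show (0 : ℝ) < δ / 2 by positivity)] with r hL hI hrδ
    have hr : 0 < r := hrδ.1
    have hsr : 0 < √(r ^ d) := Real.sqrt_pos.2 (by positivity)
    obtain ⟨c', hc1, hc2⟩ := hrep r hr (by linarith [hrδ.2])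
    have hN : eLpNorm F 2 (volume.restrict (ball y (10 * r))) ≤ ENNReal.ofReal (√K * √(r ^ d)) := by
      have hFi : IntegrableOn (fun x => ‖F x‖ ^ 2) (closedBall y (10 * r)) :=
        (hF.restrict _).integrable_norm_pow two_ne_zero
      have : eLpNorm F 2 (volume.restrict (closedBall y (10 * r))) ^ 2
          ≤ ENNReal.ofReal (K * r ^ d) * 1 ^ 2 := by
        rw [← lintegral_enorm_sq, one_pow, mul_one]
        have e : ∀ x, ‖F x‖ₑ ^ 2 = ENNReal.ofReal (‖F x‖ ^ 2) := fun x => by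
          rw [ENNReal.ofReal_pow (norm_nonneg _), ofReal_norm]
        simp only [e]
        rw [← ofReal_integral_eq_lintegral_ofReal hFi (Filter.Eventually.of_forall fun x => by positivity)]
        refine ENNReal.ofReal_le_ofReal ?_
        have hL' : ⨍ x in closedBall y (10 * r), ‖F x‖ ^ 2 < |L| + 1 := hL
        rw [setAverage_eq, hvol _ (by positivity), smul_eq_mul, inv_mul_lt_iff₀ (by positivity)] at hL'
        refine hL'.le.trans (le_of_eq ?_)
        simp only [K]; ring
      have h3 := le_ofReal_sqrt_mul this
      rw [mul_one, Real.sqrt_mul hK.le] at h3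
      exact (eLpNorm_mono_measure _ (Measure.restrict_mono_set _ ball_subset_closedBall)).trans h3
    have p1 : |J - c'| ≤ C * √K * (∫⁻ x in ball y (13 * r), ‖Dg x‖ₑ).toReal := by
      rw [← ENNReal.ofReal_le_ofReal_iff (by positivity)]
      refine hc2.trans ?_
      rw [ENNReal.ofReal_mul (by positivity), ENNReal.ofReal_toReal (show ∫⁻ x in ball y (13 * r), ‖Dg x‖ₑ ≠ ⊤ from hI.ne)]
      gcongr ?_ * _
      calc _ ≤ ENNReal.ofReal (C / √(r ^ d)) * ENNReal.ofReal (√K * √(r ^ d)) := by gcongr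
        _ = _ := by
          rw [← ENNReal.ofReal_mul (by positivity)]
          congr 1; field_simp
    have hvm : ∀ a : ℝ, MemLp (fun x => v x - a) 2 (volume.restrict (closedBall y (2 * r))) := fun a =>
      ((hv (3 * r)).mono_measure (Measure.restrict_mono_set _
        (closedBall_subset_ball (by linarith)))).sub
        (memLp_const_iff (by norm_num) (by norm_num) |>.2 (Or.inr (by
          rw [Measure.restrict_apply_univ]; exact measure_closedBall_lt_top)))
    have hm := hvol (2 * r) (by positivity)
    have hfin : IsFiniteMeasure (volume.restrict (closedBall y (2 * r))) :=
      isFiniteMeasure_restrict.2 measure_closedBall_lt_top.ne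
    have p2 : ∫ x in closedBall y (2 * r), ‖v x - c'‖
        ≤ C * r * (√K * √(r ^ d)) * √((2 * r) ^ d * V) := by
      have hi := abs_integral_inner_le (hvm c').norm (memLp_const (μ := volume.restrict (closedBall y (2 * r))) (1 : ℝ))
      have e1 : ∀ x, inner ℝ ‖v x - c'‖ (1 : ℝ) = ‖v x - c'‖ := fun x => by simp
      simp only [e1] at hi
      refine (le_abs_self _).trans (hi.trans ?_)
      gcongr
      · rw [eLpNorm_norm]
        refine ENNReal.toReal_le_of_le_ofReal (by positivity) ?_
        refine (eLpNorm_mono_measure _ (Measure.restrict_mono_set _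
          (closedBall_subset_ball (by linarith)))).trans (hc1.trans ?_)
        rw [ENNReal.ofReal_mul (by positivity) (p := C * r)]
        gcongr
      · rw [eLpNorm_const _ two_ne_zero (by
          rw [Ne, Measure.restrict_eq_zero]; exact (measure_closedBall_pos volume y (by positivity)).ne')]
        rw [Measure.restrict_apply_univ, ENNReal.toReal_mul, ← ENNReal.toReal_rpow, ← measureReal_def, hm,
          Real.sqrt_eq_rpow]
        simp
    have p3 : |c' - v y| ≤ C * √K / √(2 ^ d * V) * r
        + ⨍ x in closedBall y (2 * r), ‖v x - v y‖ := by
      rw [setAverage_eq, hm, smul_eq_mul]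
      have hmp : 0 < (2 * r) ^ d * V := by positivity
      have h3 : ((2 * r) ^ d * V) * |c' - v y|
          ≤ (∫ x in closedBall y (2 * r), ‖v x - c'‖)
            + ∫ x in closedBall y (2 * r), ‖v x - v y‖ := by
        rw [← hm, ← integral_add ((hvm c').integrable (by norm_num)).norm
          ((hvm _).integrable (by norm_num)).norm]
        have : volume.real (closedBall y (2 * r)) * |c' - v y|
            = ∫ x in closedBall y (2 * r), |c' - v y| := by
          rw [setIntegral_const, smul_eq_mul]
        rw [this]
        refine integral_mono (integrable_const _) (((hvm c').integrable (by norm_num)).norm.add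
          ((hvm _).integrable (by norm_num)).norm) fun x => ?_
        simp only [Real.norm_eq_abs]
        rw [abs_sub_comm (v x) c']
        exact abs_sub_le _ _ _
      have h4 := h3.trans (add_le_add_left p2 _)
      have h5 : √((2 * r) ^ d * V) = √(2 ^ d * V) * √(r ^ d) := by
        rw [← Real.sqrt_mul (by positivity)]; congr 1; rw [mul_pow]; ring
      have h6 : (2 * r) ^ d * V = √((2 * r) ^ d * V) * (√(2 ^ d * V) * √(r ^ d)) := by
        rw [← h5, Real.mul_self_sqrt (by positivity)]
      have hs2 : 0 < √(2 ^ d * V) := Real.sqrt_pos.2 (by positivity)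
      have hs3 : 0 < √((2 * r) ^ d * V) := Real.sqrt_pos.2 (by positivity)
      rw [← sub_nonneg] at h4 ⊢
      refine nonneg_of_mul_nonneg_right (a := (2 * r) ^ d * V) (h4.trans (le_of_eq ?_)) hmp
      have h7 : ((2 * r) ^ d * V) * (C * √K / √(2 ^ d * V) * r)
          = C * r * (√K * √(r ^ d)) * √((2 * r) ^ d * V) := by
        nth_rewrite 1 [h6]
        field_simp
      have h8 : ((2 * r) ^ d * V) * (((2 * r) ^ d * V)⁻¹ *
          ∫ x in closedBall y (2 * r), ‖v x - v y‖)
          = ∫ x in closedBall y (2 * r), ‖v x - v y‖ := by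
        rw [mul_inv_cancel_left₀ hmp.ne']
      rw [mul_sub, mul_add, h7, h8]
    calc _ ≤ |J - c'| + |c' - v y| := abs_sub_le _ _ _
      _ ≤ _ := add_le_add p1 p3
  have := ge_of_tendsto hE hbound
  rwa [abs_nonpos_iff, sub_eq_zero] at this

variable [hd : Fact (3 ≤ d)]

/-- The pairing of a right hand side with the Green's function is the solution of the adjoint
equation at the pole, if the pole is a Lebesgue point. -/
lemma IsGreenPair.integral_mul_eq_potential (hlam0 : 0 < lam) (hlam1 : lam < 1)
    (hA : IsUniformlyElliptic lam A) {y : Space d}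
    {g : Space d → ℝ} {Dg : Space d → Space d} (hg : IsGreenPair A y g Dg) {z : Space d} {ρ δ : ℝ}
    (hδ : 0 < δ) (hdisj : Disjoint (ball z ρ) (ball y δ)) (f : Lp ℝ 2 (volume.restrict (ball z ρ)))
    (F : energySpace d) (hF : F = ballSol hlam0 hA.adjoint z ρ f) {L : ℝ}
    (h1 : Filter.Tendsto (fun r => ⨍ x in closedBall y r, ‖F.1 x‖ ^ 2) (𝓝[>] 0) (𝓝 L))
    (h2 : Filter.Tendsto (fun r => ⨍ x in closedBall y r, ‖potential d F x - potential d F y‖)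
      (𝓝[>] 0) (𝓝 0)) :
    ∫ x in ball z ρ, f x * g x = potential d F y := by
  obtain ⟨C, hC, hrep⟩ := exists_representation_bound hlam0 hlam1 (d := d)
  have hDg : IntegrableOn Dg (ball y 1) :=
    (hg.1.integrableOn (isCompact_closedBall y 1) (Set.subset_univ _)).mono_set ball_subset_closedBall
  have hd0 : 0 < d := by have := hd.out; omega
  exact eq_of_forall_annulus_bound hd0 (memLp_potential F y) (Lp.memLp F.1) hDg hC hδ
    (fun r hr hrδ => hrep A hA y g Dg hg z ρ r hr
      (hdisj.mono_right (ball_subset_ball hrδ.le)) f F hF) h1 h2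

/-- The solution of the adjoint equation is represented by the Green's function. -/
lemma IsGreenFunction.ae_integral_mul_eq_potential (hlam0 : 0 < lam) (hlam1 : lam < 1)
    (hA : IsUniformlyElliptic lam A) {G : Space d → Space d → ℝ} (hG : IsGreenFunction A G)
    {z z' : Space d} {ρ ρ' : ℝ} (hdisj : Disjoint (ball z ρ) (ball z' ρ'))
    (f : Lp ℝ 2 (volume.restrict (ball z ρ))) (F : energySpace d)
    (hF : F = ballSol hlam0 hA.adjoint z ρ f) :
    ∀ᵐ y ∂(volume.restrict (ball z' ρ')), ∫ x in ball z ρ, f x * G x y = potential d F y := by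
  have i1 : LocallyIntegrable (fun x => ‖F.1 x‖ ^ 2) volume :=
    ((Lp.memLp F.1).integrable_norm_pow two_ne_zero).locallyIntegrable
  have i2 : LocallyIntegrable (potential d F) volume :=
    locallyIntegrableOn_univ.1 (hasWeakGradient_potential F ⟨0, by have := hd.out; omega⟩).1
  have hmem : ∀ y : Space d, ∀ᶠ r in 𝓝[>] (0 : ℝ), y ∈ closedBall y (1 * r) := fun y => by
    filter_upwards [self_mem_nhdsWithin] with r hr
    exact mem_closedBall_self (by rw [one_mul]; exact le_of_lt hr)
  filter_upwards [ae_restrict_mem measurableSet_ball, ae_restrict_of_ae hG.green,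
    ae_restrict_of_ae (IsUnifLocDoublingMeasure.ae_tendsto_average volume i1 1),
    ae_restrict_of_ae (IsUnifLocDoublingMeasure.ae_tendsto_average_norm_sub volume i2 1)] with y hy hg h1 h2
  obtain ⟨Dg, hg⟩ := hg
  obtain ⟨δ, hδ, hsub⟩ := Metric.isOpen_ball.mem_nhds hy |> Metric.mem_nhds_iff.1
  exact IsGreenPair.integral_mul_eq_potential hlam0 hlam1 hA (g := fun x => G x y) (Dg := Dg) hg hδ
    (hdisj.mono_right hsub) f F hF (h1 (fun _ => y) id Filter.tendsto_id (hmem y))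
    (h2 (fun _ => y) id Filter.tendsto_id (hmem y))

end GreenEstimates

namespace GreenEstimates


/-! ### The size of the Green's function away from the diagonal -/

variable {d : ℕ} {lam : ℝ} {A : Space d → Space d →L[ℝ] Space d} [hd : Fact (3 ≤ d)]

lemma norm_adjoint_apply_le {E F : Type*} [NormedAddCommGroup E] [InnerProductSpace ℝ E]
    [CompleteSpace E] [NormedAddCommGroup F] [InnerProductSpace ℝ F] [CompleteSpace F] (T : E →L[ℝ] F)
    {C : ℝ} (hC : 0 ≤ C) (h : ∀ x, ‖T x‖ ≤ C * ‖x‖) (y : F) : ‖T.adjoint y‖ ≤ C * ‖y‖ := by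
  have h3 : ‖ContinuousLinearMap.adjoint T‖ ≤ C := by
    rw [LinearIsometryEquiv.norm_map]
    exact ContinuousLinearMap.opNorm_le_bound _ hC h
  exact ContinuousLinearMap.le_of_opNorm_le _ h3 y

lemma norm_ballSol_le (hlam0 : 0 < lam) (hA : IsUniformlyElliptic lam A) {z : Space d} {r C : ℝ}
    (hC : 0 ≤ C) (h : ∀ F : energySpace d, ‖restrictLp z r F‖ ≤ C * ‖F‖)
    (f : Lp ℝ 2 (volume.restrict (ball z r))) :
    ‖ballSol hlam0 hA z r f‖ ≤ lam⁻¹ * (C * ‖f‖) := by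
  rw [ballSol_apply]
  exact (norm_solOp_le hlam0 hA _).trans
    (mul_le_mul_of_nonneg_left (norm_adjoint_apply_le _ hC h f) (inv_nonneg.2 hlam0.le))

/-- Sobolev and Hölder are used twice: reading off the potential on a ball costs `r'`, and dually a
right-hand side in a ball costs `r`. -/
lemma exists_ballSol_bound (hlam0 : 0 < lam) : ∃ C : ℝ, 0 < C ∧
    ∀ (A : Space d → Space d →L[ℝ] Space d) (hA : IsUniformlyElliptic lam A) (z : Space d) (r : ℝ),
      0 < r → ∀ (f : Lp ℝ 2 (volume.restrict (ball z r))) (z' : Space d) (r' : ℝ), 0 < r' →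
      eLpNorm (potential d (ballSol hlam0 hA z r f)) 2 (volume.restrict (ball z' r'))
        ≤ ENNReal.ofReal (C * r * r' * ‖f‖) := by
  obtain ⟨C₁, hC₁, h1⟩ := exists_potential_bound hd.out
  obtain ⟨C₂, hC₂, h2⟩ := exists_norm_restrictLp_le hd.out
  refine ⟨C₁ * (lam⁻¹ * C₂), by positivity, fun A hA z r hr f z' r' hr' => ?_⟩
  have h3 := norm_ballSol_le hlam0 hA (by positivity) (h2 z r hr) f
  generalize ballSol hlam0 hA z r f = F at h3 ⊢
  refine ((h1 F).2 z' r' hr').trans (ENNReal.ofReal_le_ofReal ?_)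
  calc C₁ * r' * ‖F‖ ≤ C₁ * r' * (lam⁻¹ * (C₂ * r * ‖f‖)) := by gcongr
    _ = _ := by ring

/-- Bound for the Green's function away from the diagonal. -/
lemma exists_lintegral_green_sq_le (hlam0 : 0 < lam) (hlam1 : lam < 1) : ∃ C : ℝ, 0 < C ∧
    ∀ (A : Space d → Space d →L[ℝ] Space d), IsUniformlyElliptic lam A →
      ∀ G : Space d → Space d → ℝ, IsGreenFunction A G → ∀ (x₀ y₀ : Space d) (L : ℝ), 0 < L →
      2 * L < ‖x₀ - y₀‖ →
      ∫⁻ y in ball y₀ L, (∫⁻ x in ball x₀ (L / 2), ‖G x y‖ₑ ^ 2) ≤ ENNReal.ofReal (C * L ^ 4) := by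
  have hd0 : 0 < d := by have := hd.out; omega
  obtain ⟨C₁, hC₁, h1⟩ := exists_interior_family_bound hlam0 hlam1 hd0
  obtain ⟨C₂, hC₂, h2⟩ := exists_ballSol_bound hlam0 (d := d)
  set V := volume.real (ball (0 : Space d) 1) with hV
  have hVpos : 0 < V := ENNReal.toReal_pos (measure_ball_pos volume _ one_pos).ne' measure_ball_lt_top.ne
  refine ⟨C₁ * C₂ ^ 2 * V, by positivity, fun A hA G hG x₀ y₀ L hL hLR => ?_⟩
  have hdisj : Disjoint (ball x₀ L) (ball y₀ L) := by
    refine ball_disjoint_ball ?_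
    rw [dist_eq_norm]; linarith
  have hm : AEStronglyMeasurable (Function.uncurry G)
      ((volume.restrict (ball x₀ L)).prod (volume.restrict (ball y₀ L))) := by
    rw [Measure.prod_restrict]; exact hG.1.restrict
  have hvol : volume.real (ball x₀ L) = L ^ d * V := by
    rw [measureReal_def, volume_ball_eq hd0 x₀ hL.le, ENNReal.toReal_mul,
      ENNReal.toReal_ofReal (by positivity), hV, measureReal_def]
  -- The integral over a small ball is the pairing with its indicator, whose norm is at most
  -- `|B_L|^{1/2}`. The volume in `K` cancels the `L^{-d}` of the interior bound and leaves `L⁴`.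
  have := h1 A hA x₀ L hL (Space d) (volume.restrict (ball y₀ L)) G hm ?_
    (ENNReal.ofReal ((C₂ * L * L * √(L ^ d * V)) ^ 2)) ?_
  · refine this.trans (le_of_eq ?_)
    rw [← ENNReal.ofReal_mul (by positivity)]
    congr 1
    rw [mul_pow, Real.sq_sqrt (by positivity)]
    field_simp
  · filter_upwards [ae_restrict_mem measurableSet_ball, ae_restrict_of_ae hG.green] with y hy hg
    obtain ⟨Dg, hg⟩ := hg
    refine ⟨Dg, IsGreenPair.isHarmonicOn (g := fun x => G x y) hd.out hg ?_⟩
    have := norm_sub_le_norm_sub_add_norm_sub x₀ y y₀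
    rw [mem_ball, dist_eq_norm] at hy
    linarith
  · intro x h hh hsub
    have hmt : (volume.restrict (ball x₀ L)) (ball x h) ≠ ⊤ := (measure_lt_top _ _).ne
    set f : Lp ℝ 2 (volume.restrict (ball x₀ L)) := indicatorConstLp 2 measurableSet_ball hmt (1 : ℝ)
    have hf : ‖f‖ ≤ √(L ^ d * V) := by
      refine norm_indicatorConstLp_le.trans ?_
      rw [norm_one, one_mul, Real.sqrt_eq_rpow, ENNReal.toReal_ofNat]
      refine Real.rpow_le_rpow measureReal_nonneg ?_ (by norm_num)
      rw [← hvol, measureReal_restrict_apply measurableSet_ball]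
      exact measureReal_mono Set.inter_subset_right measure_ball_lt_top.ne
    have hrep := hG.ae_integral_mul_eq_potential hlam0 hlam1 hA hdisj f _ rfl
    have hrep' : ∀ᵐ y ∂(volume.restrict (ball y₀ L)), ‖∫ t in ball x h, G t y‖ₑ ^ 2
        = ‖potential d (ballSol hlam0 hA.adjoint x₀ L f) y‖ₑ ^ 2 := by
      filter_upwards [hrep] with y hy
      rw [← hy]
      congr 2
      have e : (fun x' => f x' * G x' y) =ᵐ[volume.restrict (ball x₀ L)]
          (ball x h).indicator (fun t => G t y) := by
        filter_upwards [indicatorConstLp_coeFn (p := 2) (hs := measurableSet_ball) (hμs := hmt)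
          (c := (1 : ℝ))] with t ht
        rw [ht]
        by_cases htx : t ∈ ball x h <;> simp [htx]
      rw [integral_congr_ae e, integral_indicator measurableSet_ball,
        Measure.restrict_restrict measurableSet_ball, Set.inter_eq_left.2 hsub]
    rw [lintegral_congr_ae hrep', lintegral_enorm_sq, ENNReal.ofReal_pow (by positivity)]
    gcongr
    refine (h2 _ hA.adjoint x₀ L hL f y₀ L hL).trans ?_
    gcongr

end GreenEstimates

namespace GreenEstimates


/-! ### Harmonic functions above the minimal radius -/

variable {d : ℕ} {lam : ℝ} {A : Space d → Space d →L[ℝ] Space d}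

lemma integral_norm_sq_eq {X F : Type*} [MeasurableSpace X] {μ : Measure X} [NormedAddCommGroup F]
    [InnerProductSpace ℝ F] {f : X → F} (hf : MemLp f 2 μ) :
    ∫ x, ‖f x‖ ^ 2 ∂μ = (eLpNorm f 2 μ).toReal ^ 2 := by
  rw [← Lp.norm_toLp f hf, ← real_inner_self_eq_norm_sq, inner_toLp hf hf]
  simp only [real_inner_self_eq_norm_sq]

/-- Comparison of mean squares on concentric balls of radii `r` and `2r`. -/
lemma eLpNorm_div_sqrt_le (hd : 0 < d) {z : Space d} {r s : ℝ} (hr : 0 < r) (hs : 4 * r < s)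
    {u : Space d → ℝ} {Du : Space d → Space d} (hw : HasWeakGradient (ball z s) u Du)
    (hu : MemLp u 2 (volume.restrict (ball z s))) (hD : MemLp Du 2 (volume.restrict (ball z s))) :
    (eLpNorm u 2 (volume.restrict (ball z r))).toReal / √(r ^ d)
      ≤ (eLpNorm u 2 (volume.restrict (ball z (2 * r)))).toReal / √((2 * r) ^ d)
        + 3 * √(3 ^ d) * r * ((eLpNorm Du 2 (volume.restrict (ball z s))).toReal / √(r ^ d)) := by
  have hpair := lintegral_lintegral_sub_le (p := 2) (by norm_num) (by norm_num) hr
    (by linarith : r ≤ 2 * r) (by linarith : r + (r + 2 * r) < s) hw hu hD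
  set V := volume.real (ball (0 : Space d) 1) with hV
  have hVpos : 0 < V := ENNReal.toReal_pos (measure_ball_pos volume _ one_pos).ne' measure_ball_lt_top.ne
  have hvol : ∀ (x : Space d) (t : ℝ), 0 ≤ t → volume (ball x t) = ENNReal.ofReal (t ^ d * V) := by
    intro x t ht
    rw [volume_ball_eq hd x ht, hV, measureReal_def, ENNReal.ofReal_mul (by positivity),
      ENNReal.ofReal_toReal measure_ball_lt_top.ne]
  set μ := volume.restrict (ball z r)
  set ν := volume.restrict (ball z (2 * r))
  have hμu : MemLp u 2 μ := hu.mono_measure (Measure.restrict_mono_set _ (ball_subset_ball (by linarith)))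
  have hνu : MemLp u 2 ν := hu.mono_measure (Measure.restrict_mono_set _ (ball_subset_ball (by linarith)))
  have m1 : AEStronglyMeasurable (fun q : Space d × Space d => u q.1) (μ.prod ν) := hμu.1.comp_fst
  have m2 : AEStronglyMeasurable (fun q : Space d × Space d => u q.2) (μ.prod ν) := hνu.1.comp_snd
  -- Triangle inequality in `L²` of the product of both balls for `u x = (u x - u y) + u y`. After
  -- normalisation the mean over the larger ball appears with coefficient exactly `1`, so the
  -- estimate can be telescoped over dyadic scales.
  have a1 : eLpNorm (fun q : Space d × Space d => u q.1) 2 (μ.prod ν)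
      ≤ ENNReal.ofReal √((3 * r) ^ d * V) * (ENNReal.ofReal (3 * r) * eLpNorm Du 2 (volume.restrict (ball z s)))
        + ENNReal.ofReal √(r ^ d * V) * eLpNorm u 2 ν := by
    have e : (fun q : Space d × Space d => u q.1)
        = (fun q => u q.1 - u q.2) + fun q => u q.2 := by ext q; simp
    rw [e]
    refine (eLpNorm_add_le (m1.sub m2) m2 (by norm_num)).trans (add_le_add ?_ ?_)
    · refine le_ofReal_sqrt_mul ?_
      rw [← lintegral_enorm_sq, lintegral_prod_symm _ ((m1.sub m2).enorm.pow_const 2), ← hvol 0 _ (by positivity)]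
      simp only [ENNReal.toReal_ofNat, ENNReal.rpow_ofNat] at hpair
      rw [show 3 * r = r + 2 * r by ring]
      exact hpair
    · refine le_ofReal_sqrt_mul ?_
      rw [← lintegral_enorm_sq, lintegral_prod _ (m2.enorm.pow_const 2)]
      simp only [lintegral_const]
      rw [lintegral_enorm_sq, Measure.restrict_apply_univ, hvol z r hr.le, mul_comm]
  have a2 : ENNReal.ofReal √((2 * r) ^ d * V) * eLpNorm u 2 μ
      ≤ eLpNorm (fun q : Space d × Space d => u q.1) 2 (μ.prod ν) := by
    rw [← ENNReal.pow_le_pow_left_iff two_ne_zero, mul_pow, ← ENNReal.ofReal_pow (Real.sqrt_nonneg _),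
      Real.sq_sqrt (by positivity), ← lintegral_enorm_sq, ← lintegral_enorm_sq,
      lintegral_prod _ (m1.enorm.pow_const 2)]
    simp only [lintegral_const, ν, Measure.restrict_apply_univ]
    rw [lintegral_mul_const'' _ (hμu.1.enorm.pow_const 2), hvol z (2 * r) (by positivity), mul_comm]
  have a3 := a2.trans a1
  set a := (eLpNorm u 2 μ).toReal
  set b := (eLpNorm u 2 ν).toReal
  set N := (eLpNorm Du 2 (volume.restrict (ball z s))).toReal
  have a4 : √((2 * r) ^ d * V) * a ≤ √((3 * r) ^ d * V) * (3 * r * N) + √(r ^ d * V) * b := by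
    have ha : eLpNorm u 2 μ = ENNReal.ofReal a := (ENNReal.ofReal_toReal hμu.2.ne).symm
    have hb : eLpNorm u 2 ν = ENNReal.ofReal b := (ENNReal.ofReal_toReal hνu.2.ne).symm
    have hN : eLpNorm Du 2 (volume.restrict (ball z s)) = ENNReal.ofReal N := (ENNReal.ofReal_toReal hD.2.ne).symm
    have hN0 : 0 ≤ N := ENNReal.toReal_nonneg
    have hb0 : 0 ≤ b := ENNReal.toReal_nonneg
    rwa [ha, hb, hN, ← ENNReal.ofReal_mul (by positivity), ← ENNReal.ofReal_mul (by positivity),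
      ← ENNReal.ofReal_mul (by positivity), ← ENNReal.ofReal_mul (by positivity),
      ← ENNReal.ofReal_add (by positivity) (by positivity), ENNReal.ofReal_le_ofReal_iff (by positivity)] at a3
  have hN0 : 0 ≤ N := ENNReal.toReal_nonneg
  have hsr : 0 < √(r ^ d) := Real.sqrt_pos.2 (by positivity)
  have hs2 : 1 ≤ √(2 ^ d) := Real.one_le_sqrt.2 (one_le_pow₀ (by norm_num))
  have hsV : 0 < √V := Real.sqrt_pos.2 hVpos
  rw [mul_pow, mul_pow, Real.sqrt_mul' _ hVpos.le, Real.sqrt_mul' _ hVpos.le, Real.sqrt_mul' _ hVpos.le,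
    Real.sqrt_mul (by positivity), Real.sqrt_mul (by positivity)] at a4
  rw [mul_pow, Real.sqrt_mul (by positivity)]
  have a5 : √(2 ^ d) * a ≤ √(3 ^ d) * (3 * r * N) + b := by
    have h : (√(r ^ d) * √V) * (√(2 ^ d) * a) ≤ (√(r ^ d) * √V) * (√(3 ^ d) * (3 * r * N) + b) := by
      calc _ = √(2 ^ d) * √(r ^ d) * √V * a := by ring
        _ ≤ _ := a4
        _ = _ := by ring
    exact le_of_mul_le_mul_left h (by positivity)
  have hs20 : 0 < √(2 ^ d) := by linarith
  have a6 : a ≤ √(3 ^ d) * (3 * r * N) + b / √(2 ^ d) := by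
    have h1 : √(2 ^ d) * a ≤ √(2 ^ d) * (√(3 ^ d) * (3 * r * N) + b / √(2 ^ d)) := by
      rw [mul_add, mul_div_cancel₀ _ hs20.ne']
      refine a5.trans (add_le_add_left ?_ _)
      exact le_mul_of_one_le_left (by positivity) hs2
    exact le_of_mul_le_mul_left h1 hs20
  calc a / √(r ^ d) ≤ (√(3 ^ d) * (3 * r * N) + b / √(2 ^ d)) / √(r ^ d) := by gcongr
    _ = _ := by field_simp; ring

/-- Growth of the energy of harmonic functions, in terms of a minimal radius. -/
lemma IsMinimalRadius.energy_le (hd : 0 < d) {C₀ : ℝ} {x : Space d} {rx : ℝ}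
    (h : IsMinimalRadius C₀ A x rx) {r s : ℝ} (hr : 1 ≤ r) (hrs : r ≤ s) {u : Space d → ℝ}
    {Du : Space d → Space d} (hu : IsHarmonicOn A (ball x s) u Du) :
    (eLpNorm Du 2 (volume.restrict (ball x r))).toReal ^ 2
      ≤ max |C₀| 1 * (r * rx / s) ^ d * (eLpNorm Du 2 (volume.restrict (ball x s))).toReal ^ 2 := by
  have hrx := h.1
  have hs : 0 < s := by linarith
  set N : ℝ → ℝ := fun t => (eLpNorm Du 2 (volume.restrict (ball x t))).toReal
  have hmono : ∀ {t}, t ≤ s → ∀ {t'}, t' ≤ t → N t' ≤ N t := fun {t} ht t' htt =>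
    ENNReal.toReal_mono (hu.memLp_grad.mono_measure (Measure.restrict_mono_set _ (ball_subset_ball ht))).2.ne
      (eLpNorm_mono_measure _ (Measure.restrict_mono_set _ (ball_subset_ball htt)))
  have hN0 : ∀ t, 0 ≤ N t := fun t => ENNReal.toReal_nonneg
  set V := volume.real (ball (0 : Space d) 1) with hV
  have hVpos : 0 < V := ENNReal.toReal_pos (measure_ball_pos volume _ one_pos).ne' measure_ball_lt_top.ne
  have hvol : ∀ t : ℝ, 0 ≤ t → volume.real (ball x t) = t ^ d * V := by
    intro t ht
    rw [measureReal_def, volume_ball_eq hd x ht, hV, measureReal_def, ENNReal.toReal_mul,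
      ENNReal.toReal_ofReal (by positivity)]
  have key : ∀ t, rx ≤ t → t ≤ s → N t ^ 2 ≤ max |C₀| 1 * (t / s) ^ d * N s ^ 2 := by
    intro t h1 h2
    have ht : 0 < t := by linarith
    have := h.2 t s h1 h2 u Du hu
    rw [setAverage_eq, setAverage_eq, hvol t ht.le, hvol s hs.le, integral_norm_sq_eq hu.memLp_grad,
      integral_norm_sq_eq (hu.memLp_grad.mono_measure (Measure.restrict_mono_set _ (ball_subset_ball h2))),
      smul_eq_mul, smul_eq_mul] at this
    have h3 : N t ^ 2 = (t ^ d * V) * ((t ^ d * V)⁻¹ * N t ^ 2) := by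
      rw [mul_inv_cancel_left₀ (by positivity)]
    rw [h3]
    calc _ ≤ (t ^ d * V) * (C₀ * ((s ^ d * V)⁻¹ * N s ^ 2)) := by gcongr
      _ ≤ (t ^ d * V) * (max |C₀| 1 * ((s ^ d * V)⁻¹ * N s ^ 2)) := by
          gcongr
          exact (le_abs_self _).trans (le_max_left _ _)
      _ = _ := by rw [div_pow]; field_simp
  change N r ^ 2 ≤ max |C₀| 1 * (r * rx / s) ^ d * N s ^ 2
  have hmax1 : 1 ≤ max |C₀| 1 := le_max_right _ _
  -- If `rx ≤ r`, the mean value property applies directly; if `r < rx ≤ s`, it applies after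
  -- enlarging `r` to `rx`; if `rx > s`, the prefactor is at least `1` and monotonicity suffices.
  rcases le_or_gt rx r with h1 | h1
  · refine (key r h1 hrs).trans ?_
    gcongr
    exact le_mul_of_one_le_right (by linarith) hrx
  · rcases le_or_gt rx s with h2 | h2
    · have hle : N r ^ 2 ≤ N rx ^ 2 := pow_le_pow_left₀ (hN0 _) (hmono h2 h1.le) 2
      refine hle.trans ((key rx le_rfl h2).trans ?_)
      gcongr
      exact le_mul_of_one_le_left (by linarith) hr
    · have hle : N r ^ 2 ≤ N s ^ 2 := pow_le_pow_left₀ (hN0 _) (hmono le_rfl hrs) 2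
      have h3 : 1 ≤ (r * rx / s) ^ d := one_le_pow₀ (by
        rw [one_le_div hs]; nlinarith)
      refine hle.trans (le_mul_of_one_le_left (sq_nonneg _) ?_)
      nlinarith

/-- Take the largest power of two below `max 1 (2 s / 5)`. For `j < k` the ball of radius `5 · 2^j`
still fits into that of radius `s`, which covers the requirement of more than four times the radius
in `eLpNorm_div_sqrt_le`. -/
lemma exists_dyadic_scale {s : ℝ} (hs : 1 ≤ s) :
    ∃ k : ℕ, (2 : ℝ) ^ k ≤ s ∧ s / 5 ≤ 2 ^ k ∧ ∀ j < k, 5 * (2 : ℝ) ^ j ≤ s := by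
  obtain ⟨k, h1, h2⟩ := exists_nat_pow_near (le_max_left 1 (2 / 5 * s)) (y := (2 : ℝ)) (by norm_num)
  have h3 : 2 / 5 * s < 2 ^ (k + 1) := (le_max_right _ _).trans_lt h2
  rw [pow_succ] at h3
  refine ⟨k, ?_, by linarith, fun j hj => ?_⟩
  · rcases max_cases 1 (2 / 5 * s) with h | h
    · linarith
    · linarith
  · have hk : (2 : ℝ) ^ j * 2 ≤ 2 ^ k := by
      rw [← pow_succ]; exact pow_le_pow_right₀ (by norm_num) hj
    have h4 : (2 : ℝ) ≤ 2 ^ k := by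
      calc (2 : ℝ) = 1 * 2 := by norm_num
        _ ≤ 2 ^ j * 2 := by gcongr; exact one_le_pow₀ (by norm_num)
        _ ≤ _ := hk
    rcases max_cases 1 (2 / 5 * s) with h | h
    · linarith
    · linarith

/-- Interior estimates for harmonic functions on the unit ball, in terms of a minimal radius. -/
lemma exists_minimalRadius_bound (hlam0 : 0 < lam) (hlam1 : lam < 1) (hd : 0 < d) (C₀ : ℝ) :
    ∃ C : ℝ, 0 < C ∧ ∀ (A : Space d → Space d →L[ℝ] Space d), IsUniformlyElliptic lam A →
      ∀ (x : Space d) (rx : ℝ), IsMinimalRadius C₀ A x rx → ∀ ρ : ℝ, 5 / 4 ≤ ρ →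
      ∀ (u : Space d → ℝ) (Du : Space d → Space d), IsHarmonicOn A (ball x ρ) u Du →
      (eLpNorm Du 2 (volume.restrict (ball x 1))).toReal ^ 2
        ≤ C * (rx / ρ) ^ d / ρ ^ 2 * (eLpNorm u 2 (volume.restrict (ball x ρ))).toReal ^ 2 ∧
      (eLpNorm u 2 (volume.restrict (ball x 1))).toReal ^ 2
        ≤ C * (rx / ρ) ^ d * (eLpNorm u 2 (volume.restrict (ball x ρ))).toReal ^ 2 := by
  obtain ⟨C₁, hC₁, hcac⟩ := exists_caccioppoli hlam0 hlam1
  set M : ℝ := max |C₀| 1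
  have hM : 1 ≤ M := le_max_right _ _
  obtain ⟨K, hKdef⟩ : ∃ K : ℝ, K = 3 * √(3 ^ d) := ⟨_, rfl⟩
  have hK : 0 < K := by rw [hKdef]; positivity
  refine ⟨M * 2 ^ d * (10 * C₁) ^ 2 + (2 * 10 ^ d + 2 * K ^ 2 * (M * 10 ^ d * (10 * C₁) ^ 2)), by positivity, ?_⟩
  intro A hA x rx hrx ρ hρ u Du hu
  have hrx1 := hrx.1
  -- Leaves a gap `ρ / 10` for Caccioppoli and keeps `s ≥ 1`, since `ρ ≥ 5 / 4`.
  set s := 9 / 10 * ρ with hs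
  have hs1 : 1 ≤ s := by rw [hs]; linarith
  have hsρ : s < ρ := by rw [hs]; linarith
  have hρ0 : 0 < ρ := by linarith
  have hs0 : 0 < s := by linarith
  set N : ℝ → ℝ := fun t => (eLpNorm Du 2 (volume.restrict (ball x t))).toReal with hN
  set W : ℝ → ℝ := fun t => (eLpNorm u 2 (volume.restrict (ball x t))).toReal with hW
  have hN0 : ∀ t, 0 ≤ N t := fun t => ENNReal.toReal_nonneg
  have hW0 : ∀ t, 0 ≤ W t := fun t => ENNReal.toReal_nonneg
  have hus := hu.mono (ball_subset_ball hsρ.le)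
  have hcs : N s ≤ 10 * C₁ / ρ * W ρ := by
    have h1 := hcac d A hA x s ρ hs0 hsρ u Du hu
    have h2 := ENNReal.toReal_mono (ENNReal.mul_ne_top ENNReal.ofReal_ne_top hu.memLp.2.ne) h1
    rw [ENNReal.toReal_mul, ENNReal.toReal_ofReal (div_nonneg hC₁.le (by linarith))] at h2
    refine h2.trans (le_of_eq ?_)
    congr 1
    rw [show ρ - s = ρ / 10 by rw [hs]; ring]
    field_simp
  have hcs2 : N s ^ 2 ≤ (10 * C₁) ^ 2 / ρ ^ 2 * W ρ ^ 2 := by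
    calc N s ^ 2 ≤ (10 * C₁ / ρ * W ρ) ^ 2 := pow_le_pow_left₀ (hN0 _) hcs 2
      _ = _ := by rw [mul_pow, div_pow]
  have hscale : ∀ c : ℝ, 0 ≤ c → (c * rx / s) ^ d ≤ (2 * c) ^ d * (rx / ρ) ^ d := by
    intro c hc
    rw [← mul_pow]
    refine pow_le_pow_left₀ (by positivity) ?_ d
    rw [hs, div_le_iff₀ (by positivity)]
    calc c * rx ≤ 9 / 5 * (c * rx) := by nlinarith [mul_nonneg hc (by linarith : (0 : ℝ) ≤ rx)]
      _ = _ := by field_simp; ring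
  constructor
  · have h1 := hrx.energy_le hd le_rfl hs1 hus
    calc N 1 ^ 2 ≤ M * (1 * rx / s) ^ d * N s ^ 2 := h1
      _ ≤ M * ((2 * 1) ^ d * (rx / ρ) ^ d) * ((10 * C₁) ^ 2 / ρ ^ 2 * W ρ ^ 2) := by
          gcongr
          exact hscale 1 zero_le_one
      _ = (M * 2 ^ d * (10 * C₁) ^ 2) * (rx / ρ) ^ d / ρ ^ 2 * W ρ ^ 2 := by
          rw [mul_one]; ring
      _ ≤ _ := by
          gcongr
          exact le_add_of_nonneg_right (by positivity)
  · obtain ⟨k, hk1, hk2, hk3⟩ := exists_dyadic_scale hs1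
    -- A bound for the energies on the balls of radius `5 · 2^j`, normalised by `√((2^j)^d)`,
    -- uniform in `j`; this uniformity is the gain from the minimal radius.
    set D : ℝ := √(M * (5 * rx / s) ^ d) * N s with hD
    have hD0 : 0 ≤ D := mul_nonneg (Real.sqrt_nonneg _) (hN0 _)
    have hstep : ∀ j < k, W (2 ^ j) / √((2 ^ j) ^ d)
        ≤ W (2 ^ (j + 1)) / √((2 ^ (j + 1)) ^ d) + K * D * 2 ^ j := by
      intro j hj
      have hj1 : (1 : ℝ) ≤ 2 ^ j := one_le_pow₀ (by norm_num)
      have hj5 := hk3 j hj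
      have huj := hu.mono (ball_subset_ball (hj5.trans hsρ.le))
      have h1 := eLpNorm_div_sqrt_le hd (r := 2 ^ j) (s := 5 * 2 ^ j) (by positivity) (by linarith)
        huj.1 huj.2 huj.3
      rw [← hKdef] at h1
      have h2 := hrx.energy_le hd (by linarith : (1 : ℝ) ≤ 5 * 2 ^ j) hj5 hus
      have h3 : N (5 * 2 ^ j) / √((2 ^ j) ^ d) ≤ D := by
        have hsq : 0 < √(((2 : ℝ) ^ j) ^ d) := Real.sqrt_pos.2 (by positivity)
        rw [div_le_iff₀ hsq, hD]
        refine le_of_sq_le_sq ?_ (by positivity)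
        rw [mul_pow, mul_pow, Real.sq_sqrt (by positivity), Real.sq_sqrt (by positivity)]
        refine h2.trans (le_of_eq ?_)
        rw [show 5 * (2 : ℝ) ^ j * rx / s = (5 * rx / s) * 2 ^ j by ring, mul_pow]
        ring
      rw [pow_succ (2 : ℝ) j, mul_comm ((2 : ℝ) ^ j) 2]
      refine h1.trans (add_le_add_right ?_ _)
      calc K * 2 ^ j * (N (5 * 2 ^ j) / √((2 ^ j) ^ d)) ≤ K * 2 ^ j * D := by gcongr
        _ = _ := by ring
    -- Telescoping, with the geometric sum `1 + 2 + … + 2^{j-1} = 2^j - 1`. The largest scale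
    -- dominates, so no logarithm is lost.
    have hsum : ∀ j ≤ k, W 1 ≤ W (2 ^ j) / √((2 ^ j) ^ d) + K * D * (2 ^ j - 1) := by
      intro j
      induction j with
      | zero => intro _; simp
      | succ j ih =>
        intro hj
        have h1 := ih (by omega)
        have h2 := hstep j (by omega)
        rw [pow_succ] at h2 ⊢
        linarith
    have h1 := hsum k le_rfl
    have h2k : (0 : ℝ) < 2 ^ k := by positivity
    have hsq : 0 < √(((2 : ℝ) ^ k) ^ d) := Real.sqrt_pos.2 (by positivity)
    have h2 : W 1 ≤ W ρ / √((2 ^ k) ^ d) + K * D * s := by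
      refine h1.trans (add_le_add ?_ ?_)
      · gcongr
        exact ENNReal.toReal_mono hu.memLp.2.ne
          (eLpNorm_mono_measure _ (Measure.restrict_mono_set _ (ball_subset_ball (by linarith))))
      · gcongr
        linarith
    have h3 : W 1 ^ 2 ≤ 2 * (W ρ / √((2 ^ k) ^ d)) ^ 2 + 2 * (K * D * s) ^ 2 := by
      have h4 := pow_le_pow_left₀ (hW0 1) h2 2
      nlinarith [sq_nonneg (W ρ / √((2 ^ k) ^ d) - K * D * s)]
    -- From `2^k ≥ ρ / 10` and `rx ≥ 1`.
    have h5 : (W ρ / √((2 ^ k) ^ d)) ^ 2 ≤ 10 ^ d * (rx / ρ) ^ d * W ρ ^ 2 := by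
      rw [div_pow, Real.sq_sqrt (by positivity), div_le_iff₀ (by positivity)]
      have h6 : 1 ≤ 10 ^ d * (rx / ρ) ^ d * (2 ^ k) ^ d := by
        rw [← mul_pow, ← mul_pow]
        refine one_le_pow₀ ?_
        rw [mul_div_assoc', div_mul_eq_mul_div, le_div_iff₀ hρ0]
        have : ρ / 10 ≤ 2 ^ k := by rw [hs] at hk2; linarith
        nlinarith
      nlinarith [mul_le_mul_of_nonneg_right h6 (sq_nonneg (W ρ))]
    have h7 : (K * D * s) ^ 2 ≤ K ^ 2 * (M * 10 ^ d * (10 * C₁) ^ 2) * (rx / ρ) ^ d * W ρ ^ 2 := by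
      rw [hD, mul_pow, mul_pow, mul_pow, Real.sq_sqrt (by positivity)]
      calc _ ≤ K ^ 2 * (M * ((2 * 5) ^ d * (rx / ρ) ^ d) * ((10 * C₁) ^ 2 / ρ ^ 2 * W ρ ^ 2)) * ρ ^ 2 := by
            gcongr
            exact hscale 5 (by norm_num)
        _ = _ := by
            rw [show (2 * 5 : ℝ) = 10 by norm_num]
            field_simp
    have h8 : 0 ≤ (rx / ρ) ^ d * W ρ ^ 2 := by positivity
    have h9 : 0 ≤ M * 2 ^ d * (10 * C₁) ^ 2 := by positivity
    calc W 1 ^ 2 ≤ 2 * (10 ^ d * (rx / ρ) ^ d * W ρ ^ 2)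
          + 2 * (K ^ 2 * (M * 10 ^ d * (10 * C₁) ^ 2) * (rx / ρ) ^ d * W ρ ^ 2) := by linarith
      _ = (2 * 10 ^ d + 2 * K ^ 2 * (M * 10 ^ d * (10 * C₁) ^ 2)) * (rx / ρ) ^ d * W ρ ^ 2 := by ring
      _ ≤ _ := by
          gcongr ?_ * _ * _
          exact le_add_of_nonneg_left h9

end GreenEstimates

namespace GreenEstimates


/-! ### Hilbert-Schmidt kernels -/

section Kernel

variable {X Y X' : Type*} [MeasurableSpace X] [MeasurableSpace Y] [MeasurableSpace X']
  {μ : Measure X} {ν : Measure Y} {μ' : Measure X'} [IsFiniteMeasure μ] [IsFiniteMeasure ν]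
  [IsFiniteMeasure μ']

omit [IsFiniteMeasure μ] [IsFiniteMeasure ν] in
lemma memLp_tensor {f : X → ℝ} {g : Y → ℝ} (hf : MemLp f 2 μ) (hg : MemLp g 2 ν) :
    MemLp (fun q : X × Y => f q.1 * g q.2) 2 (μ.prod ν) := by
  have hm : AEStronglyMeasurable (fun q : X × Y => f q.1 * g q.2) (μ.prod ν) :=
    hf.1.comp_fst.mul hg.1.comp_snd
  rw [memLp_two_iff_integrable_sq hm]
  simp only [mul_pow]
  exact hf.integrable_sq.mul_prod hg.integrable_sq

/-- The tensor product of two square integrable functions. -/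
noncomputable def tensorLp (a : Lp ℝ 2 μ) (e : Lp ℝ 2 ν) : Lp ℝ 2 (μ.prod ν) :=
  (memLp_tensor (Lp.memLp a) (Lp.memLp e)).toLp

omit [IsFiniteMeasure μ] [IsFiniteMeasure ν] in
lemma tensorLp_coeFn (a : Lp ℝ 2 μ) (e : Lp ℝ 2 ν) :
    tensorLp a e =ᵐ[μ.prod ν] fun q => a q.1 * e q.2 :=
  (memLp_tensor (Lp.memLp a) (Lp.memLp e)).coeFn_toLp

omit [IsFiniteMeasure μ] [IsFiniteMeasure ν] in
lemma inner_tensorLp_right (K : Lp ℝ 2 (μ.prod ν)) (a : Lp ℝ 2 μ) (e : Lp ℝ 2 ν) :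
    inner ℝ K (tensorLp a e) = ∫ q, K q * (a q.1 * e q.2) ∂μ.prod ν := by
  rw [L2.inner_def]
  refine integral_congr_ae ?_
  filter_upwards [tensorLp_coeFn a e] with q hq
  rw [hq]; simp [mul_comm]

lemma inner_tensorLp (a a' : Lp ℝ 2 μ) (e e' : Lp ℝ 2 ν) :
    inner ℝ (tensorLp a e) (tensorLp a' e') = inner ℝ a a' * inner ℝ e e' := by
  rw [inner_tensorLp_right, L2.inner_def, L2.inner_def, ← integral_prod_mul]
  refine integral_congr_ae ?_
  filter_upwards [tensorLp_coeFn a e] with q hq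
  rw [hq]; simp; ring

/-- Tensoring with a fixed unit vector. -/
noncomputable def tensorIsometry (e : Lp ℝ 2 ν) (he : ‖e‖ = 1) : Lp ℝ 2 μ →ₗᵢ[ℝ] Lp ℝ 2 (μ.prod ν) where
  toFun a := tensorLp a e
  map_add' a b := by
    refine Lp.ext ?_
    filter_upwards [tensorLp_coeFn (a + b) e, tensorLp_coeFn a e, tensorLp_coeFn b e,
      Lp.coeFn_add (tensorLp a e) (tensorLp b e),
      Measure.quasiMeasurePreserving_fst.ae (Lp.coeFn_add a b)] with q h1 h2 h3 h4 h5
    rw [h1, h4, Pi.add_apply, h2, h3, h5, Pi.add_apply, add_mul]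
  map_smul' c a := by
    refine Lp.ext ?_
    filter_upwards [tensorLp_coeFn (c • a) e, tensorLp_coeFn a e,
      Lp.coeFn_smul c (tensorLp a e),
      Measure.quasiMeasurePreserving_fst.ae (Lp.coeFn_smul c a)] with q h1 h2 h4 h5
    rw [h1, RingHom.id_apply, h4, Pi.smul_apply, h2, h5, Pi.smul_apply, smul_eq_mul, smul_eq_mul, mul_assoc]
  norm_map' a := by
    have h := inner_tensorLp a a e e
    rw [real_inner_self_eq_norm_sq, real_inner_self_eq_norm_sq, real_inner_self_eq_norm_sq, he, one_pow,
      mul_one] at h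
    exact (sq_eq_sq₀ (norm_nonneg _) (norm_nonneg _)).1 h

lemma tensorIsometry_apply (e : Lp ℝ 2 ν) (he : ‖e‖ = 1) (a : Lp ℝ 2 μ) :
    tensorIsometry e he a = tensorLp a e := rfl

/-- `K` is the integral kernel of the operator `T`. -/
def IsKernel (K : Lp ℝ 2 (μ.prod ν)) (T : Lp ℝ 2 ν →L[ℝ] Lp ℝ 2 μ) : Prop :=
  ∀ a e, inner ℝ K (tensorLp a e) = inner ℝ (T e) a

/-- The slices `L²(μ) ⊗ b_k` are mutually orthogonal, so sums of tensors along an orthonormal family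
obey Pythagoras. -/
lemma orthogonalFamily_tensor {ι : Type*} {b : ι → Lp ℝ 2 ν} (hb : Orthonormal ℝ b) :
    OrthogonalFamily ℝ (fun _ : ι => Lp ℝ 2 μ) fun k => tensorIsometry (b k) (hb.1 k) := by
  intro i j hij a a'
  rw [tensorIsometry_apply, tensorIsometry_apply, inner_tensorLp, hb.2 hij, mul_zero]

/-- Let `w = ∑ T b_k ⊗ b_k`. Then `⟨K, w⟩` and `‖w‖²` both equal `∑ ‖T b_k‖²`, and Cauchy-Schwarz
gives `‖w‖ ≤ ‖K‖`. -/
lemma IsKernel.sum_norm_sq_le {K : Lp ℝ 2 (μ.prod ν)} {T : Lp ℝ 2 ν →L[ℝ] Lp ℝ 2 μ} (hK : IsKernel K T)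
    {ι : Type*} {b : ι → Lp ℝ 2 ν} (hb : Orthonormal ℝ b) (s : Finset ι) :
    ∑ k ∈ s, ‖T (b k)‖ ^ 2 ≤ ‖K‖ ^ 2 := by
  have h1 := (orthogonalFamily_tensor (μ := μ) hb).norm_sum (fun k => T (b k)) s
  have h2 : inner ℝ K (∑ k ∈ s, tensorIsometry (b k) (hb.1 k) (T (b k))) = ∑ k ∈ s, ‖T (b k)‖ ^ 2 := by
    rw [inner_sum]
    refine Finset.sum_congr rfl fun k _ => ?_
    rw [tensorIsometry_apply, hK, real_inner_self_eq_norm_sq]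
  set w := ∑ k ∈ s, tensorIsometry (b k) (hb.1 k) (T (b k))
  have h3 := real_inner_le_norm K w
  rw [h2, ← h1] at h3
  rw [← h1]
  nlinarith [sq_nonneg (‖K‖ - ‖w‖), norm_nonneg K, norm_nonneg w]

/-- An operator which is dominated by one with a square integrable kernel has one as well. -/
lemma IsKernel.exists_kernel {K : Lp ℝ 2 (μ.prod ν)} {T : Lp ℝ 2 ν →L[ℝ] Lp ℝ 2 μ} (hK : IsKernel K T)
    {ι : Type*} (b : HilbertBasis ι ℝ (Lp ℝ 2 ν)) (M : Lp ℝ 2 ν →L[ℝ] Lp ℝ 2 μ')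
    (hM : ∃ β : ℝ, ∀ e, ‖M e‖ ^ 2 ≤ β * ‖T e‖ ^ 2) :
    ∃ K' : Lp ℝ 2 (μ'.prod ν), IsKernel K' M ∧ HasSum (fun k => tensorLp (M (b k)) (b k)) K' ∧
      ∀ β : ℝ, 0 ≤ β → (∀ e, ‖M e‖ ^ 2 ≤ β * ‖T e‖ ^ 2) → ‖K'‖ ^ 2 ≤ β * ‖K‖ ^ 2 := by
  have hO := orthogonalFamily_tensor (μ := μ') b.orthonormal
  have hfin : ∀ β : ℝ, 0 ≤ β → (∀ e, ‖M e‖ ^ 2 ≤ β * ‖T e‖ ^ 2) → ∀ s : Finset ι,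
      ∑ k ∈ s, ‖M (b k)‖ ^ 2 ≤ β * ‖K‖ ^ 2 := by
    intro β hβ h s
    calc _ ≤ ∑ k ∈ s, β * ‖T (b k)‖ ^ 2 := Finset.sum_le_sum fun k _ => h _
      _ = β * ∑ k ∈ s, ‖T (b k)‖ ^ 2 := by rw [Finset.mul_sum]
      _ ≤ _ := mul_le_mul_of_nonneg_left (hK.sum_norm_sq_le b.orthonormal s) hβ
  -- Some finite bound suffices to build the kernel; sharper values of `β` are inserted afterwards.
  -- Thus the kernel can be fixed before any minimal radius is given.
  obtain ⟨β₀, hβ₀⟩ := hM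
  have hβ₁ : ∀ e, ‖M e‖ ^ 2 ≤ |β₀| * ‖T e‖ ^ 2 := fun e =>
    (hβ₀ e).trans (mul_le_mul_of_nonneg_right (le_abs_self _) (sq_nonneg _))
  -- The kernel is `∑ M b_k ⊗ b_k`, an orthogonal series whose squared norms are summable by
  -- domination.
  have hsum : Summable fun k => tensorIsometry (b k) (b.orthonormal.1 k) (M (b k)) := by
    rw [hO.summable_iff_norm_sq_summable]
    exact summable_of_sum_le (fun k => sq_nonneg _) (hfin _ (abs_nonneg _) hβ₁)
  obtain ⟨K', hK'⟩ := hsum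
  refine ⟨K', fun a e => ?_, hK', fun β hβ h => ?_⟩
  · have h1 : HasSum (fun k => inner ℝ (tensorLp (M (b k)) (b k)) (tensorLp a e))
        (inner ℝ K' (tensorLp a e)) := by
      have := hK'.mapL (innerSL ℝ (tensorLp a e))
      simp only [innerSL_apply_apply, tensorIsometry_apply] at this
      simp only [real_inner_comm (tensorLp a e)]
      exact this
    have h2 : HasSum (fun k => inner ℝ (tensorLp (M (b k)) (b k)) (tensorLp a e)) (inner ℝ (M e) a) := by
      have := ((b.hasSum_repr e).mapL M).mapL (innerSL ℝ a)
      simp only [innerSL_apply_apply, map_smul, b.repr_apply_apply] at this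
      have e1 : (fun k => inner ℝ (tensorLp (M (b k)) (b k)) (tensorLp a e))
          = fun k => inner ℝ (b k) e • inner ℝ a (M (b k)) := by
        ext k
        rw [inner_tensorLp, mul_comm, real_inner_comm a, smul_eq_mul]
      rw [e1, real_inner_comm]
      exact this
    exact h1.unique h2
  · have h1 : Filter.Tendsto (fun s : Finset ι =>
        ‖∑ k ∈ s, tensorIsometry (b k) (b.orthonormal.1 k) (M (b k))‖ ^ 2) Filter.atTop (𝓝 (‖K'‖ ^ 2)) :=
      (hK'.norm).pow 2
    refine le_of_tendsto' h1 fun s => ?_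
    rw [hO.norm_sum (fun k => M (b k)) s]
    exact hfin β hβ h s

/-- Tensors of indicators show that the integral of `K` over every measurable rectangle vanishes;
the rectangles form a π-system generating the product σ-algebra. -/
lemma eq_zero_of_inner_tensorLp (K : Lp ℝ 2 (μ.prod ν)) (hK : ∀ a e, inner ℝ K (tensorLp a e) = 0) :
    K = 0 := by
  have hint : Integrable K (μ.prod ν) := (Lp.memLp K).integrable (by norm_num)
  refine (Lp.eq_zero_iff_ae_eq_zero).2 (hint.ae_eq_zero_of_forall_setIntegral_eq_zero fun s hs _ => ?_)
  have hrect : ∀ (s : Set X) (t : Set Y), MeasurableSet s → MeasurableSet t →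
      ∫ q in s ×ˢ t, K q ∂μ.prod ν = 0 := by
    intro s t hs ht
    have h := hK (indicatorConstLp 2 hs (measure_ne_top μ s) (1 : ℝ))
      (indicatorConstLp 2 ht (measure_ne_top ν t) (1 : ℝ))
    rw [inner_tensorLp_right] at h
    rw [← integral_indicator (hs.prod ht), ← h]
    refine integral_congr_ae ?_
    filter_upwards [Measure.quasiMeasurePreserving_fst.ae
        (indicatorConstLp_coeFn (p := 2) (hs := hs) (hμs := measure_ne_top μ s) (c := (1 : ℝ))),
      Measure.quasiMeasurePreserving_snd.ae
        (indicatorConstLp_coeFn (p := 2) (hs := ht) (hμs := measure_ne_top ν t) (c := (1 : ℝ)))]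
      with q h1 h2
    rw [h1, h2]
    by_cases hq1 : q.1 ∈ s <;> by_cases hq2 : q.2 ∈ t <;>
      simp [hq1, hq2, Set.indicator]
  induction s, hs using MeasurableSpace.induction_on_inter generateFrom_prod.symm isPiSystem_prod with
  | empty => simp
  | basic t ht =>
    obtain ⟨s, hs, t, ht, rfl⟩ := ht
    exact hrect s t hs ht
  | compl t ht h =>
    have h1 := integral_add_compl ht hint
    have h2 := hrect Set.univ Set.univ MeasurableSet.univ MeasurableSet.univ
    rw [Set.univ_prod_univ, setIntegral_univ] at h2
    have h3 := h (measure_lt_top _ _)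
    rw [h2, h3, zero_add] at h1
    exact h1
  | iUnion f hdisj hf h =>
    rw [integral_iUnion hf hdisj hint.integrableOn]
    simp [h _ (measure_lt_top _ _)]

lemma IsKernel.unique {K K' : Lp ℝ 2 (μ.prod ν)} {T : Lp ℝ 2 ν →L[ℝ] Lp ℝ 2 μ} (hK : IsKernel K T)
    (hK' : IsKernel K' T) : K = K' := by
  rw [← sub_eq_zero]
  refine eq_zero_of_inner_tensorLp _ fun a e => ?_
  rw [inner_sub_left, hK, hK', sub_self]

/-- Exchange of the two variables. -/
noncomputable def swapLp : Lp ℝ 2 (μ.prod ν) →ₗᵢ[ℝ] Lp ℝ 2 (ν.prod μ) :=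
  Lp.compMeasurePreservingₗᵢ ℝ Prod.swap Measure.measurePreserving_swap

lemma swapLp_coeFn (K : Lp ℝ 2 (μ.prod ν)) : swapLp K =ᵐ[ν.prod μ] fun q => K q.swap :=
  Lp.coeFn_compMeasurePreserving K Measure.measurePreserving_swap

lemma swapLp_tensorLp (a : Lp ℝ 2 μ) (e : Lp ℝ 2 ν) : swapLp (tensorLp a e) = tensorLp e a := by
  refine Lp.ext ?_
  filter_upwards [swapLp_coeFn (tensorLp a e), tensorLp_coeFn e a,
    (Measure.measurePreserving_swap (μ := ν) (ν := μ)).quasiMeasurePreserving.ae (tensorLp_coeFn a e)]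
    with q h1 h2 h3
  rw [h1, h2, h3, mul_comm]
  rfl

/-- Transposition makes domination in the output variable usable for the input variable as well. -/
lemma IsKernel.swap {K : Lp ℝ 2 (μ.prod ν)} {T : Lp ℝ 2 ν →L[ℝ] Lp ℝ 2 μ} (hK : IsKernel K T) :
    IsKernel (swapLp K) T.adjoint := by
  intro e a
  rw [← swapLp_tensorLp a e, LinearIsometry.inner_map_map, hK, ContinuousLinearMap.adjoint_inner_left,
    real_inner_comm]

end Kernel

end GreenEstimates

namespace GreenEstimates


/-! ### Transfer of kernels and of identities between them -/

section Kernel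

variable {X Y X' Y' : Type*} [MeasurableSpace X] [MeasurableSpace Y] [MeasurableSpace X']
  [MeasurableSpace Y'] {μ : Measure X} {ν : Measure Y} {μ' : Measure X'} {ν' : Measure Y'}
  [IsFiniteMeasure μ] [IsFiniteMeasure ν] [IsFiniteMeasure μ'] [IsFiniteMeasure ν']

/-- If `ρx S ρy†` has a square integrable kernel, then so does `R₁ S R₂†`, as long as `R₁` is
dominated by `ρx` and `R₂` by `ρy` on the relevant ranges of `S` and its adjoint `S'`. -/
lemma exists_kernel_conj {E : Type*} [NormedAddCommGroup E] [InnerProductSpace ℝ E] [CompleteSpace E]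
    {S S' : E →L[ℝ] E} (hS : ∀ x y, inner ℝ (S' x) y = inner ℝ x (S y))
    {ρx : E →L[ℝ] Lp ℝ 2 μ} {ρy : E →L[ℝ] Lp ℝ 2 ν} (R₁ : E →L[ℝ] Lp ℝ 2 μ') (R₂ : E →L[ℝ] Lp ℝ 2 ν')
    {K : Lp ℝ 2 (μ.prod ν)} (hK : IsKernel K (ρx ∘L S ∘L ρy.adjoint))
    (h₁ : ∃ β : ℝ, ∀ e, ‖R₁ (S (R₂.adjoint e))‖ ^ 2 ≤ β * ‖ρx (S (R₂.adjoint e))‖ ^ 2)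
    (h₂ : ∃ β : ℝ, ∀ a, ‖R₂ (S' (ρx.adjoint a))‖ ^ 2 ≤ β * ‖ρy (S' (ρx.adjoint a))‖ ^ 2) :
    ∃ K' : Lp ℝ 2 (μ'.prod ν'), IsKernel K' (R₁ ∘L S ∘L R₂.adjoint) ∧ ∀ β₁ β₂ : ℝ, 0 ≤ β₁ → 0 ≤ β₂ →
      (∀ e, ‖R₁ (S (R₂.adjoint e))‖ ^ 2 ≤ β₁ * ‖ρx (S (R₂.adjoint e))‖ ^ 2) →
      (∀ a, ‖R₂ (S' (ρx.adjoint a))‖ ^ 2 ≤ β₂ * ‖ρy (S' (ρx.adjoint a))‖ ^ 2) →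
      ‖K'‖ ^ 2 ≤ β₁ * β₂ * ‖K‖ ^ 2 := by
  have hS' : S' = S.adjoint := (ContinuousLinearMap.eq_adjoint_iff S' S).2 hS
  have e1 : (ρx ∘L S ∘L ρy.adjoint).adjoint = ρy ∘L S' ∘L ρx.adjoint := by
    rw [ContinuousLinearMap.adjoint_comp, ContinuousLinearMap.adjoint_comp,
      ContinuousLinearMap.adjoint_adjoint, hS', ContinuousLinearMap.comp_assoc]
  have e2 : (R₂ ∘L S' ∘L ρx.adjoint).adjoint = ρx ∘L S ∘L R₂.adjoint := by
    rw [ContinuousLinearMap.adjoint_comp, ContinuousLinearMap.adjoint_comp,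
      ContinuousLinearMap.adjoint_adjoint, hS', ContinuousLinearMap.adjoint_adjoint,
      ContinuousLinearMap.comp_assoc]
  obtain ⟨_, b, _⟩ := exists_hilbertBasis ℝ (Lp ℝ 2 μ)
  obtain ⟨_, b', _⟩ := exists_hilbertBasis ℝ (Lp ℝ 2 ν')
  -- Two passes: on the transposed side `ρy` is replaced by `R₂`; then, back on the original side,
  -- `ρx` is replaced by `R₁`.
  have hK1 := hK.swap
  rw [e1] at hK1
  obtain ⟨K₂, hK₂, -, hb₂⟩ := hK1.exists_kernel b (R₂ ∘L S' ∘L ρx.adjoint) h₂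
  have hK3 := hK₂.swap
  rw [e2] at hK3
  obtain ⟨K₁, hK₁, -, hb₁⟩ := hK3.exists_kernel b' (R₁ ∘L S ∘L R₂.adjoint) h₁
  refine ⟨K₁, hK₁, fun β₁ β₂ hβ₁ hβ₂ hc₁ hc₂ => ?_⟩
  have i1 := hb₁ β₁ hβ₁ hc₁
  have i2 := hb₂ β₂ hβ₂ hc₂
  rw [LinearIsometry.norm_map] at i1 i2
  calc _ ≤ _ := i1
    _ ≤ β₁ * (β₂ * ‖K‖ ^ 2) := mul_le_mul_of_nonneg_left i2 hβ₁
    _ = _ := by ring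

lemma IsKernel.hasSum_tensorLp {K : Lp ℝ 2 (μ.prod ν)} {T : Lp ℝ 2 ν →L[ℝ] Lp ℝ 2 μ} (hK : IsKernel K T)
    {ι : Type*} (b : HilbertBasis ι ℝ (Lp ℝ 2 ν)) : HasSum (fun k => tensorLp (T (b k)) (b k)) K := by
  obtain ⟨K₁, h1, h2, -⟩ := hK.exists_kernel b T ⟨1, fun e => by rw [one_mul]⟩
  rwa [hK.unique h1]

omit [IsFiniteMeasure μ] in
lemma innerSL_toLp {ψ : X → ℝ} (hψ : MemLp ψ 2 μ) (K : Lp ℝ 2 μ) :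
    innerSL ℝ hψ.toLp K = ∫ q, K q * ψ q ∂μ := by
  rw [innerSL_apply_apply, L2.inner_def]
  refine integral_congr_ae ?_
  filter_upwards [hψ.coeFn_toLp] with q hq
  rw [hq]; simp

omit [IsFiniteMeasure μ] [IsFiniteMeasure ν] in
lemma innerSL_toLp_tensorLp {ψ : X × Y → ℝ} (hψ : MemLp ψ 2 (μ.prod ν)) (a : Lp ℝ 2 μ) (e : Lp ℝ 2 ν) :
    innerSL ℝ hψ.toLp (tensorLp a e) = ∫ q, (a q.1 * e q.2) * ψ q ∂μ.prod ν := by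
  rw [innerSL_toLp]
  refine integral_congr_ae ?_
  filter_upwards [tensorLp_coeFn a e] with q hq
  rw [hq]

/-- Both sides are continuous linear functionals of the kernels, which expand as `∑ T b_k ⊗ b_k` and
`∑ M b_k ⊗ b_k` over one and the same basis; the hypothesis compares them term by term. -/
lemma IsKernel.integral_mul_eq_neg {K K' : Lp ℝ 2 (μ.prod ν)} {T M : Lp ℝ 2 ν →L[ℝ] Lp ℝ 2 μ}
    (hK : IsKernel K T) (hK' : IsKernel K' M) {ψ χ : X × Y → ℝ} (hψ : MemLp ψ 2 (μ.prod ν))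
    (hχ : MemLp χ 2 (μ.prod ν))
    (h : ∀ e, ∫ q, (T e q.1 * e q.2) * ψ q ∂μ.prod ν = -∫ q, (M e q.1 * e q.2) * χ q ∂μ.prod ν) :
    ∫ q, K q * ψ q ∂μ.prod ν = -∫ q, K' q * χ q ∂μ.prod ν := by
  obtain ⟨_, b, _⟩ := exists_hilbertBasis ℝ (Lp ℝ 2 ν)
  have s1 := (hK.hasSum_tensorLp b).mapL (innerSL ℝ hψ.toLp)
  have s2 := ((hK'.hasSum_tensorLp b).mapL (innerSL ℝ hχ.toLp)).neg
  have e1 : (fun k => innerSL ℝ hψ.toLp (tensorLp (T (b k)) (b k)))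
      = fun k => -innerSL ℝ hχ.toLp (tensorLp (M (b k)) (b k)) := by
    ext k
    rw [innerSL_toLp_tensorLp, innerSL_toLp_tensorLp]
    exact h _
  rw [← innerSL_toLp hψ, ← innerSL_toLp hχ]
  rw [e1] at s1
  exact s1.unique s2

end Kernel

/-! ### Weak derivatives of kernels -/

variable {d : ℕ}

lemma IsTestFunction.slice {U U' : Set (Space d)} {φ : Space d × Space d → ℝ}
    (h : IsTestFunction (U ×ˢ U') φ) (y : Space d) : IsTestFunction U fun x => φ (x, y) := by
  have hsub : tsupport (fun x => φ (x, y)) ⊆ (fun x => (x, y)) ⁻¹' tsupport φ :=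
    closure_minimal (fun x hx => subset_tsupport _ hx) ((isClosed_tsupport φ).preimage (by fun_prop))
  refine ⟨h.1.comp (contDiff_id.prodMk contDiff_const), ?_, fun x hx => (h.2.2 (hsub hx)).1⟩
  exact HasCompactSupport.intro' (h.2.1.isCompact.image continuous_fst)
    (h.2.1.isCompact.image continuous_fst).isClosed fun x hx => by
      by_contra hne
      exact hx ⟨(x, y), subset_tsupport _ hne, rfl⟩

lemma IsTestFunction.memLp_prod {U : Set (Space d × Space d)} {φ : Space d × Space d → ℝ}
    (h : IsTestFunction U φ) {s t : Set (Space d)} :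
    MemLp φ 2 ((volume.restrict s).prod (volume.restrict t)) := by
  rw [Measure.prod_restrict]
  exact (h.continuous.memLp_of_hasCompactSupport h.2.1).restrict _

lemma setIntegral_prod_eq (f : Space d × Space d → ℝ) (s t : Set (Space d)) :
    ∫ q in s ×ˢ t, f q = ∫ q, f q ∂(volume.restrict s).prod (volume.restrict t) := by
  rw [Measure.prod_restrict]; rfl

lemma integrableOn_prod_iff (f : Space d × Space d → ℝ) (s t : Set (Space d)) :
    IntegrableOn f (s ×ˢ t) ↔ Integrable f ((volume.restrict s).prod (volume.restrict t)) := by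
  rw [Measure.prod_restrict]; rfl

/-- Fubini: for fixed `y` the slice of `φ` is a test function in `x`, and `e y` is a constant. -/
lemma integral_tensor_mul_fderiv {z z' : Space d} {r r' : ℝ} {v : Space d} {f g e : Space d → ℝ}
    (hf : MemLp f 2 (volume.restrict (ball z r))) (hg : MemLp g 2 (volume.restrict (ball z r)))
    (he : MemLp e 2 (volume.restrict (ball z' r'))) (hfg : HasWeakDeriv (ball z r) v f g)
    {φ : Space d × Space d → ℝ} (hφ : IsTestFunction (ball z r ×ˢ ball z' r') φ) :
    ∫ q, (f q.1 * e q.2) * fderiv ℝ φ q (v, 0) ∂(volume.restrict (ball z r)).prod (volume.restrict (ball z' r'))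
      = -∫ q, (g q.1 * e q.2) * φ q ∂(volume.restrict (ball z r)).prod (volume.restrict (ball z' r')) := by
  have i1 : Integrable (fun q : Space d × Space d => (f q.1 * e q.2) * fderiv ℝ φ q (v, 0))
      ((volume.restrict (ball z r)).prod (volume.restrict (ball z' r'))) :=
    (memLp_tensor hf he).integrable_mul (hφ.fderiv_apply (v, 0)).memLp_prod
  have i2 : Integrable (fun q : Space d × Space d => (g q.1 * e q.2) * φ q)
      ((volume.restrict (ball z r)).prod (volume.restrict (ball z' r'))) :=
    (memLp_tensor hg he).integrable_mul hφ.memLp_prod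
  rw [integral_prod_symm _ i1, integral_prod_symm _ i2, ← integral_neg]
  refine integral_congr_ae (Filter.Eventually.of_forall fun y => ?_)
  have h := hfg.2.2 _ (hφ.slice y)
  have e1 : ∀ x, fderiv ℝ (fun x => φ (x, y)) x v = fderiv ℝ φ (x, y) (v, 0) := by
    intro x
    have h1 : HasFDerivAt (fun x : Space d => (x, y)) (ContinuousLinearMap.inl ℝ (Space d) (Space d)) x :=
      hasFDerivAt_prodMk_left x y
    have h2 : HasFDerivAt (fun x => φ (x, y))
        (fderiv ℝ φ (x, y) ∘L ContinuousLinearMap.inl ℝ (Space d) (Space d)) x :=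
      (hφ.differentiable (x, y)).hasFDerivAt.comp x h1
    rw [h2.fderiv]
    rfl
  simp only [e1] at h
  simp only [mul_right_comm _ (e y)]
  rw [integral_mul_const, integral_mul_const, h, neg_mul]

/-- Integration by parts in the first variable for kernels. -/
lemma IsKernel.integral_mul_fderiv {z z' : Space d} {r r' : ℝ} {v : Space d}
    {K K' : Lp ℝ 2 ((volume.restrict (ball z r)).prod (volume.restrict (ball z' r')))}
    {T M : Lp ℝ 2 (volume.restrict (ball z' r')) →L[ℝ] Lp ℝ 2 (volume.restrict (ball z r))}
    (hK : IsKernel K T) (hK' : IsKernel K' M) (hTM : ∀ e, HasWeakDeriv (ball z r) v (T e) (M e))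
    {φ : Space d × Space d → ℝ} (hφ : IsTestFunction (ball z r ×ˢ ball z' r') φ) :
    ∫ q, K q * fderiv ℝ φ q (v, 0) ∂(volume.restrict (ball z r)).prod (volume.restrict (ball z' r'))
      = -∫ q, K' q * φ q ∂(volume.restrict (ball z r)).prod (volume.restrict (ball z' r')) := by
  exact hK.integral_mul_eq_neg hK' (hφ.fderiv_apply (v, 0)).memLp_prod hφ.memLp_prod fun e =>
    integral_tensor_mul_fderiv (Lp.memLp _) (Lp.memLp _) (Lp.memLp _) (hTM e) hφ

lemma locallyIntegrableOn_kernel {z z' : Space d} {r r' : ℝ}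
    (K : Lp ℝ 2 ((volume.restrict (ball z r)).prod (volume.restrict (ball z' r')))) :
    LocallyIntegrableOn K (ball z r ×ˢ ball z' r') := by
  refine IntegrableOn.locallyIntegrableOn ?_
  rw [integrableOn_prod_iff]
  exact (Lp.memLp K).integrable (by norm_num)

lemma IsKernel.hasWeakDeriv_fst {z z' : Space d} {r r' : ℝ} {v : Space d}
    {K K' : Lp ℝ 2 ((volume.restrict (ball z r)).prod (volume.restrict (ball z' r')))}
    {T M : Lp ℝ 2 (volume.restrict (ball z' r')) →L[ℝ] Lp ℝ 2 (volume.restrict (ball z r))}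
    (hK : IsKernel K T) (hK' : IsKernel K' M) (hTM : ∀ e, HasWeakDeriv (ball z r) v (T e) (M e)) :
    HasWeakDeriv (ball z r ×ˢ ball z' r') ((v, 0) : Space d × Space d) K K' := by
  refine ⟨locallyIntegrableOn_kernel K, locallyIntegrableOn_kernel K', fun φ hφ => ?_⟩
  rw [setIntegral_prod_eq, setIntegral_prod_eq]
  exact hK.integral_mul_fderiv hK' hTM hφ

/-- Transposing the kernels reduces to the first variable, at the price of passing to adjoint
operators. -/
lemma IsKernel.hasWeakDeriv_snd {z z' : Space d} {r r' : ℝ} {v : Space d}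
    {K K' : Lp ℝ 2 ((volume.restrict (ball z r)).prod (volume.restrict (ball z' r')))}
    {T M : Lp ℝ 2 (volume.restrict (ball z' r')) →L[ℝ] Lp ℝ 2 (volume.restrict (ball z r))}
    (hK : IsKernel K T) (hK' : IsKernel K' M)
    (hTM : ∀ a, HasWeakDeriv (ball z' r') v (T.adjoint a) (M.adjoint a)) :
    HasWeakDeriv (ball z r ×ˢ ball z' r') ((0, v) : Space d × Space d) K K' := by
  refine ⟨locallyIntegrableOn_kernel K, locallyIntegrableOn_kernel K', fun φ hφ => ?_⟩
  set σ := ContinuousLinearEquiv.prodComm ℝ (Space d) (Space d) with hσ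
  have hφ' : IsTestFunction (ball z' r' ×ˢ ball z r) fun q => φ q.swap := by
    have hs : tsupport (fun q : Space d × Space d => φ q.swap) ⊆ Prod.swap ⁻¹' tsupport φ :=
      closure_minimal (fun x hx => subset_tsupport _ hx) ((isClosed_tsupport φ).preimage continuous_swap)
    refine ⟨hφ.1.comp σ.contDiff, hφ.2.1.comp_homeomorph σ.toHomeomorph, fun q hq => ?_⟩
    have := hφ.2.2 (hs hq)
    exact ⟨this.2, this.1⟩
  have h := hK.swap.integral_mul_fderiv hK'.swap hTM hφ'
  have hd : ∀ q, fderiv ℝ (fun q : Space d × Space d => φ q.swap) q (v, 0) = fderiv ℝ φ q.swap (0, v) := by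
    intro q
    have h1 : HasFDerivAt (fun q : Space d × Space d => φ q.swap) (fderiv ℝ φ q.swap ∘L σ) q :=
      (hφ.differentiable q.swap).hasFDerivAt.comp q σ.hasFDerivAt
    rw [h1.fderiv]
    rfl
  have key : ∀ (K : Lp ℝ 2 ((volume.restrict (ball z r)).prod (volume.restrict (ball z' r'))))
      (ψ : Space d × Space d → ℝ),
      ∫ q, swapLp K q * ψ q.swap ∂(volume.restrict (ball z' r')).prod (volume.restrict (ball z r))
        = ∫ q in ball z r ×ˢ ball z' r', K q * ψ q := by
    intro K ψ
    rw [setIntegral_prod_eq]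
    refine Eq.trans ?_ (integral_prod_swap (μ := volume.restrict (ball z r))
      (ν := volume.restrict (ball z' r')) (fun q => K q * ψ q))
    refine integral_congr_ae ?_
    filter_upwards [swapLp_coeFn K] with q hq
    rw [hq]
  simp only [hd] at h
  rw [key K (fun q => fderiv ℝ φ q (0, v)), key K' φ] at h
  exact h

end GreenEstimates

namespace GreenEstimates


/-! ### Jets of potentials, and the Green's function as a kernel -/

variable {d : ℕ} {lam : ℝ} {A : Space d → Space d →L[ℝ] Space d}

lemma norm_restrictGradLp_le (z : Space d) (i : Fin d) (F : energySpace d) :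
    ‖restrictGradLp z 1 i F‖ ≤ (eLpNorm F.1 2 (volume.restrict (ball z 1))).toReal := by
  rw [Lp.norm_def, eLpNorm_congr_ae (restrictGradLp_coeFn z 1 i F)]
  refine ENNReal.toReal_mono ((Lp.memLp F.1).restrict _).2.ne ?_
  exact eLpNorm_mono fun x => PiLp.norm_apply_le _ i

variable [hd : Fact (3 ≤ d)]

lemma norm_restrictLp (z : Space d) (r : ℝ) (F : energySpace d) :
    ‖restrictLp z r F‖ = (eLpNorm (potential d F) 2 (volume.restrict (ball z r))).toReal := by
  rw [Lp.norm_def, eLpNorm_congr_ae (restrictLp_coeFn z r F)]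

/-- Restriction to a unit ball of the potential and of the components of its gradient. -/
noncomputable def jetLp (z : Space d) :
    Option (Fin d) → energySpace d →L[ℝ] Lp ℝ 2 (volume.restrict (ball z 1))
  | none => restrictLp z 1
  | some i => restrictGradLp z 1 i

/-- The scaling weight of a component of the jet. -/
noncomputable def jetWeight (ρ : ℝ) : Option (Fin d) → ℝ
  | none => 1
  | some _ => (ρ ^ 2)⁻¹

omit hd in
lemma jetWeight_nonneg (ρ : ℝ) (o : Option (Fin d)) : 0 ≤ jetWeight ρ o := by
  cases o with
  | none => exact zero_le_one
  | some i => exact inv_nonneg.2 (sq_nonneg ρ)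

lemma hasWeakDeriv_jetLp (z : Space d) (i : Fin d) (F : energySpace d) :
    HasWeakDeriv (ball z 1) (basisVec i) (jetLp z none F) (jetLp z (some i) F) :=
  ((hasWeakGradient_potential F i).mono (Set.subset_univ _)).congr_ae (restrictLp_coeFn z 1 F).symm
    (restrictGradLp_coeFn z 1 i F).symm

lemma vanishesOn_jetLp_adjoint {U : Set (Space d)} {z : Space d} (h : Disjoint (ball z 1) U)
    (o : Option (Fin d)) (e : Lp ℝ 2 (volume.restrict (ball z 1))) :
    VanishesOn U ((jetLp z o).adjoint e) := by
  cases o with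
  | none => exact vanishesOn_restrictLp_adjoint h e
  | some i => exact vanishesOn_restrictGradLp_adjoint h e

/-- Interior estimates for harmonic potentials. -/
lemma exists_jetLp_bound (hlam0 : 0 < lam) (hlam1 : lam < 1) (C₀ : ℝ) : ∃ C : ℝ, 0 < C ∧
    ∀ A : Space d → Space d →L[ℝ] Space d, IsUniformlyElliptic lam A →
    ∀ (z : Space d) (ρ : ℝ), 5 / 4 ≤ ρ → ∀ F : energySpace d,
      IsHarmonicOn A (ball z ρ) (potential d F) F.1 → ∀ o : Option (Fin d),
      ‖jetLp z o F‖ ^ 2 ≤ C * ‖restrictLp z ρ F‖ ^ 2 ∧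
      ∀ rx, IsMinimalRadius C₀ A z rx →
        ‖jetLp z o F‖ ^ 2 ≤ C * (rx / ρ) ^ d * jetWeight ρ o * ‖restrictLp z ρ F‖ ^ 2 := by
  obtain ⟨C₁, hC₁, h1⟩ := exists_minimalRadius_bound hlam0 hlam1 (by have := hd.out; omega : 0 < d) C₀
  obtain ⟨C₂, hC₂, h2⟩ := exists_caccioppoli hlam0 hlam1
  -- `C₁` serves the bounds with a minimal radius; `1` and the square of the Caccioppoli constant
  -- over a gap of at least `1 / 4` serve the qualitative bound, which needs no minimal radius and
  -- guarantees that the kernels exist.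
  refine ⟨C₁ + (1 + (C₂ / (1 / 4)) ^ 2), by positivity, fun A hA z ρ hρ F hF o => ⟨?_, fun rx hrx => ?_⟩⟩
  · have hn := norm_restrictLp z ρ F
    cases o with
    | none =>
      have : ‖jetLp z none F‖ ≤ ‖restrictLp z ρ F‖ := by
        rw [hn, jetLp, norm_restrictLp]
        exact ENNReal.toReal_mono (memLp_potential F z ρ).2.ne
          (eLpNorm_mono_measure _ (Measure.restrict_mono_set _ (ball_subset_ball (by linarith))))
      calc _ ≤ 1 * ‖restrictLp z ρ F‖ ^ 2 := by rw [one_mul]; gcongr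
        _ ≤ _ := by gcongr; nlinarith [sq_nonneg (C₂ / (1 / 4))]
    | some i =>
      have : ‖jetLp z (some i) F‖ ≤ C₂ / (1 / 4) * ‖restrictLp z ρ F‖ := by
        rw [hn]
        refine (norm_restrictGradLp_le z i F).trans ?_
        have h := h2 d A hA z 1 ρ one_pos (by linarith) _ _ hF
        have h' := ENNReal.toReal_mono (ENNReal.mul_ne_top ENNReal.ofReal_ne_top
          (memLp_potential F z ρ).2.ne) h
        rw [ENNReal.toReal_mul, ENNReal.toReal_ofReal (div_nonneg hC₂.le (by linarith))] at h'
        refine h'.trans ?_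
        gcongr
        linarith
      calc _ ≤ (C₂ / (1 / 4) * ‖restrictLp z ρ F‖) ^ 2 := by gcongr
        _ = (C₂ / (1 / 4)) ^ 2 * ‖restrictLp z ρ F‖ ^ 2 := by rw [mul_pow]
        _ ≤ _ := by gcongr; linarith
  · have hrx0 : 0 ≤ rx / ρ := div_nonneg (zero_le_one.trans hrx.1) (by linarith)
    have hle : ∀ w : ℝ, 0 ≤ w → C₁ * (rx / ρ) ^ d * w * ‖restrictLp z ρ F‖ ^ 2
        ≤ (C₁ + (1 + (C₂ / (1 / 4)) ^ 2)) * (rx / ρ) ^ d * w * ‖restrictLp z ρ F‖ ^ 2 := by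
      intro w hw
      have : C₁ ≤ C₁ + (1 + (C₂ / (1 / 4)) ^ 2) := le_add_of_nonneg_right (by positivity)
      gcongr
    obtain ⟨hb1, hb2⟩ := h1 A hA z rx hrx ρ hρ _ _ hF
    rw [← norm_restrictLp] at hb1 hb2
    refine le_trans ?_ (hle _ (jetWeight_nonneg ρ o))
    cases o with
    | none =>
      rw [← norm_restrictLp] at hb2
      rw [jetLp, jetWeight, mul_one]
      exact hb2
    | some i =>
      rw [jetLp, jetWeight]
      have := norm_restrictGradLp_le z i F
      refine (pow_le_pow_left₀ (norm_nonneg _) this 2).trans ?_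
      rw [div_eq_mul_inv _ (ρ ^ 2)] at hb1
      exact hb1

omit hd in
lemma inner_conj_apply {E H H' : Type*} [NormedAddCommGroup E] [InnerProductSpace ℝ E] [CompleteSpace E]
    [NormedAddCommGroup H] [InnerProductSpace ℝ H] [CompleteSpace H] [NormedAddCommGroup H']
    [InnerProductSpace ℝ H'] [CompleteSpace H'] {S S' : E →L[ℝ] E}
    (hS : ∀ x y, inner ℝ (S' x) y = inner ℝ x (S y)) (R : E →L[ℝ] H) (R' : E →L[ℝ] H') (e : H') (a : H) :
    inner ℝ ((R ∘L S ∘L R'.adjoint) e) a = inner ℝ (R'.adjoint e) (S' (R.adjoint a)) := by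
  rw [ContinuousLinearMap.comp_apply, ContinuousLinearMap.comp_apply,
    ← ContinuousLinearMap.adjoint_inner_right, real_inner_comm, ← hS, real_inner_comm]

omit hd in
lemma integral_green_tensor {G : Space d → Space d → ℝ} {z z' : Space d} {r r' : ℝ} {v : Space d → ℝ}
    (hm : MemLp (fun q : Space d × Space d => G q.1 q.2) 2
      ((volume.restrict (ball z r)).prod (volume.restrict (ball z' r'))))
    (a : Lp ℝ 2 (volume.restrict (ball z r))) (e : Lp ℝ 2 (volume.restrict (ball z' r')))
    (hae : ∀ᵐ y ∂volume.restrict (ball z' r'), ∫ x in ball z r, a x * G x y = v y) :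
    inner ℝ hm.toLp (tensorLp a e) = ∫ y in ball z' r', e y * v y := by
  have h := innerSL_toLp_tensorLp hm a e
  rw [innerSL_apply_apply] at h
  have hi : Integrable (fun q : Space d × Space d => (a q.1 * e q.2) * G q.1 q.2)
      ((volume.restrict (ball z r)).prod (volume.restrict (ball z' r'))) :=
    (memLp_tensor (Lp.memLp a) (Lp.memLp e)).integrable_mul hm
  rw [h, integral_prod_symm _ hi]
  refine integral_congr_ae ?_
  filter_upwards [hae] with y hy
  rw [← hy, ← integral_const_mul]
  refine integral_congr_ae (Filter.Eventually.of_forall fun x => ?_)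
  simp only
  ring

/-- The operator whose kernel is the Green's function. -/
noncomputable def greenOp (hlam : 0 < lam) (hA : IsUniformlyElliptic lam A) (z z' : Space d) (r r' : ℝ) :
    Lp ℝ 2 (volume.restrict (ball z' r')) →L[ℝ] Lp ℝ 2 (volume.restrict (ball z r)) :=
  restrictLp z r ∘L solOp hlam hA ∘L (restrictLp z' r').adjoint

lemma inner_greenOp (hlam : 0 < lam) (hA : IsUniformlyElliptic lam A) (z z' : Space d) (r r' : ℝ)
    (a : Lp ℝ 2 (volume.restrict (ball z r))) (e : Lp ℝ 2 (volume.restrict (ball z' r')))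
    {F : energySpace d} (hF : F = ballSol hlam hA.adjoint z r a) :
    inner ℝ (greenOp hlam hA z z' r r' e) a = ∫ y in ball z' r', e y * potential d F y := by
  have h : inner ℝ (greenOp hlam hA z z' r r' e) a = inner ℝ ((restrictLp z' r').adjoint e) F := by
    subst hF
    exact inner_conj_apply (inner_solOp_adjoint hlam hA) (restrictLp z r) (restrictLp z' r') e a
  exact h.trans (inner_restrictLp_adjoint z' r' e F)

/-- Away from the diagonal, the Green's function is the kernel of the solution operator. -/
lemma IsGreenFunction.isKernel {G : Space d → Space d → ℝ} (hlam0 : 0 < lam) (hlam1 : lam < 1)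
    (hA : IsUniformlyElliptic lam A) (hG : IsGreenFunction A G) {z z' : Space d} {r r' : ℝ}
    (hdisj : Disjoint (ball z r) (ball z' r'))
    (hm : MemLp (fun q : Space d × Space d => G q.1 q.2) 2
      ((volume.restrict (ball z r)).prod (volume.restrict (ball z' r')))) :
    IsKernel hm.toLp (greenOp hlam0 hA z z' r r') := by
  refine fun a e => ?_
  obtain ⟨F, hF⟩ : ∃ F, F = ballSol hlam0 hA.adjoint z r a := ⟨_, rfl⟩
  have hae := hG.ae_integral_mul_eq_potential hlam0 hlam1 hA hdisj a F hF
  exact (integral_green_tensor hm a e hae).trans (inner_greenOp hlam0 hA z z' r r' a e hF).symm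

end GreenEstimates

namespace GreenEstimates


/-! ### Kernels of the derivatives, and the conclusion -/

variable {d : ℕ} {lam : ℝ} {A : Space d → Space d →L[ℝ] Space d} [hd : Fact (3 ≤ d)]

lemma exists_norm_green_le (hlam0 : 0 < lam) (hlam1 : lam < 1) : ∃ C : ℝ, 0 < C ∧
    ∀ (A : Space d → Space d →L[ℝ] Space d), IsUniformlyElliptic lam A →
      ∀ G : Space d → Space d → ℝ, IsGreenFunction A G → ∀ (x₀ y₀ : Space d) (L : ℝ), 0 < L →
      2 * L < ‖x₀ - y₀‖ →
      ∃ hm : MemLp (fun q : Space d × Space d => G q.1 q.2) 2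
        ((volume.restrict (ball x₀ (L / 2))).prod (volume.restrict (ball y₀ (L / 2)))),
        ‖hm.toLp‖ ^ 2 ≤ C * L ^ 4 := by
  obtain ⟨C, hC, h⟩ := exists_lintegral_green_sq_le hlam0 hlam1 (d := d)
  refine ⟨C, hC, fun A hA G hG x₀ y₀ L hL hLR => ?_⟩
  have h1 := h A hA G hG x₀ y₀ L hL hLR
  have hmeas : AEStronglyMeasurable (fun q : Space d × Space d => G q.1 q.2)
      ((volume.restrict (ball x₀ (L / 2))).prod (volume.restrict (ball y₀ (L / 2)))) := by
    rw [Measure.prod_restrict]; exact hG.1.restrict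
  have h2 : eLpNorm (fun q : Space d × Space d => G q.1 q.2) 2
      ((volume.restrict (ball x₀ (L / 2))).prod (volume.restrict (ball y₀ (L / 2)))) ^ 2
      ≤ ENNReal.ofReal (C * L ^ 4) := by
    rw [← lintegral_enorm_sq, lintegral_prod_symm _ (hmeas.enorm.pow_const 2)]
    refine le_trans ?_ h1
    exact lintegral_mono' (Measure.restrict_mono_set _ (ball_subset_ball (by linarith))) le_rfl
  have hne : eLpNorm (fun q : Space d × Space d => G q.1 q.2) 2
      ((volume.restrict (ball x₀ (L / 2))).prod (volume.restrict (ball y₀ (L / 2)))) ≠ ⊤ := by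
    intro htop
    rw [htop] at h2
    simp at h2
  have hm : MemLp (fun q : Space d × Space d => G q.1 q.2) 2
      ((volume.restrict (ball x₀ (L / 2))).prod (volume.restrict (ball y₀ (L / 2)))) :=
    ⟨hmeas, hne.lt_top⟩
  refine ⟨hm, ?_⟩
  rw [Lp.norm_toLp, ← ENNReal.toReal_pow]
  exact ENNReal.toReal_le_of_le_ofReal (by positivity) h2

/-- The operator from the component `o'` of the jet at `z'` to the component `o` of the jet at `z`
which is induced by the solution operator. -/
noncomputable def jetOp (hlam : 0 < lam) (hA : IsUniformlyElliptic lam A) (z z' : Space d)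
    (o o' : Option (Fin d)) :
    Lp ℝ 2 (volume.restrict (ball z' 1)) →L[ℝ] Lp ℝ 2 (volume.restrict (ball z 1)) :=
  jetLp z o ∘L solOp hlam hA ∘L (jetLp z' o').adjoint

lemma hasWeakDeriv_jetOp (hlam : 0 < lam) (hA : IsUniformlyElliptic lam A) (z z' : Space d) (i : Fin d)
    (o' : Option (Fin d)) (e : Lp ℝ 2 (volume.restrict (ball z' 1))) :
    HasWeakDeriv (ball z 1) (basisVec i) (jetOp hlam hA z z' none o' e) (jetOp hlam hA z z' (some i) o' e) :=
  hasWeakDeriv_jetLp z i (solOp hlam hA ((jetLp z' o').adjoint e))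

omit hd in
lemma adjoint_conj {E H H' : Type*} [NormedAddCommGroup E] [InnerProductSpace ℝ E] [CompleteSpace E]
    [NormedAddCommGroup H] [InnerProductSpace ℝ H] [CompleteSpace H] [NormedAddCommGroup H']
    [InnerProductSpace ℝ H'] [CompleteSpace H'] {S S' : E →L[ℝ] E}
    (hS : ∀ x y, inner ℝ (S' x) y = inner ℝ x (S y)) (R : E →L[ℝ] H) (R' : E →L[ℝ] H') :
    (R ∘L S ∘L R'.adjoint).adjoint = R' ∘L S' ∘L R.adjoint := by
  have hS' : S' = S.adjoint := (ContinuousLinearMap.eq_adjoint_iff S' S).2 hS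
  rw [ContinuousLinearMap.adjoint_comp, ContinuousLinearMap.adjoint_comp,
    ContinuousLinearMap.adjoint_adjoint, hS', ContinuousLinearMap.comp_assoc]

lemma adjoint_jetOp (hlam : 0 < lam) (hA : IsUniformlyElliptic lam A) (z z' : Space d)
    (o o' : Option (Fin d)) : (jetOp hlam hA z z' o o').adjoint = jetOp hlam hA.adjoint z' z o' o :=
  adjoint_conj (inner_solOp_adjoint hlam hA) (jetLp z o) (jetLp z' o')

lemma hasWeakDeriv_adjoint_jetOp (hlam : 0 < lam) (hA : IsUniformlyElliptic lam A) (z z' : Space d)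
    (i : Fin d) (o : Option (Fin d)) (a : Lp ℝ 2 (volume.restrict (ball z 1))) :
    HasWeakDeriv (ball z' 1) (basisVec i) ((jetOp hlam hA z z' o none).adjoint a)
      ((jetOp hlam hA z z' o (some i)).adjoint a) := by
  rw [adjoint_jetOp, adjoint_jetOp]
  exact hasWeakDeriv_jetOp hlam hA.adjoint z' z i o a

/-- Right-hand sides in `ball y₀ 1` give functions that are `A`-harmonic in `ball x₀ ρ`, and those
in `ball x₀ ρ` give functions that are `A^t`-harmonic in `ball y₀ ρ`. Hence on both sides the
unit-ball jets are dominated by `L²` norms on balls of radius `ρ`, as `exists_kernel_conj` requires.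
-/
lemma exists_jetKernel (hlam0 : 0 < lam) (hlam1 : lam < 1) (C₀ : ℝ) : ∃ C : ℝ, 0 < C ∧
    ∀ (A : Space d → Space d →L[ℝ] Space d) (hA : IsUniformlyElliptic lam A)
      (x₀ y₀ : Space d) (ρ : ℝ), 5 / 4 ≤ ρ → 2 * ρ ≤ ‖x₀ - y₀‖ →
      ∀ (K₀ : Lp ℝ 2 ((volume.restrict (ball x₀ ρ)).prod (volume.restrict (ball y₀ ρ)))),
      IsKernel K₀ (greenOp hlam0 hA x₀ y₀ ρ ρ) → ∀ o o' : Option (Fin d),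
      ∃ K : Lp ℝ 2 ((volume.restrict (ball x₀ 1)).prod (volume.restrict (ball y₀ 1))),
        IsKernel K (jetOp hlam0 hA x₀ y₀ o o') ∧ ∀ rx ry', IsMinimalRadius C₀ A x₀ rx →
          IsMinimalRadius C₀ (adjointField A) y₀ ry' →
          ‖K‖ ^ 2 ≤ (C * (rx / ρ) ^ d * jetWeight ρ o) * (C * (ry' / ρ) ^ d * jetWeight ρ o') * ‖K₀‖ ^ 2 := by
  obtain ⟨C, hC, hb⟩ := exists_jetLp_bound hlam0 hlam1 C₀ (d := d)
  refine ⟨C, hC, fun A hA x₀ y₀ ρ hρ hR K₀ hK₀ o o' => ?_⟩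
  have hd1 : Disjoint (ball y₀ 1) (ball x₀ ρ) := by
    refine ball_disjoint_ball ?_
    rw [dist_comm, dist_eq_norm]; linarith
  have hd2 : Disjoint (ball x₀ ρ) (ball y₀ ρ) := by
    refine ball_disjoint_ball ?_
    rw [dist_eq_norm]; linarith
  have hx : ∀ e, _ := fun e => hb A hA x₀ ρ hρ _
    (isHarmonicOn_solOp hlam0 hA (vanishesOn_jetLp_adjoint hd1 o' e)) o
  have hy : ∀ a, _ := fun a => hb (adjointField A) hA.adjoint y₀ ρ hρ _
    (isHarmonicOn_solOp hlam0 hA.adjoint (vanishesOn_restrictLp_adjoint hd2 a)) o'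
  obtain ⟨K, hK, hbd⟩ := exists_kernel_conj (inner_solOp_adjoint hlam0 hA) (ρx := restrictLp x₀ ρ)
    (ρy := restrictLp y₀ ρ) (jetLp x₀ o) (jetLp y₀ o') hK₀ ⟨C, fun e => (hx e).1⟩ ⟨C, fun a => (hy a).1⟩
  refine ⟨K, hK, fun rx ry' hrx hry => ?_⟩
  have h0 : ∀ {r : ℝ}, 1 ≤ r → ∀ o : Option (Fin d), 0 ≤ C * (r / ρ) ^ d * jetWeight ρ o := by
    intro r hr o
    have : 0 ≤ r / ρ := div_nonneg (zero_le_one.trans hr) (by linarith)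
    exact mul_nonneg (mul_nonneg hC.le (pow_nonneg this d)) (jetWeight_nonneg ρ o)
  exact hbd _ _ (h0 hrx.1 o) (h0 hry.1 o') (fun e => (hx e).2 rx hrx) fun a => (hy a).2 ry' hry

omit hd in
lemma ae_prod_iff {p : Space d × Space d → Prop} {s t : Set (Space d)} :
    (∀ᵐ q ∂(volume.restrict s).prod (volume.restrict t), p q) ↔ ∀ᵐ q ∂volume.restrict (s ×ˢ t), p q := by
  rw [Measure.prod_restrict]; rfl

/-- The Green's function and its first and mixed derivatives near a pair of distant points. -/
lemma exists_green_derivatives (hlam0 : 0 < lam) (hlam1 : lam < 1) (C₀ : ℝ) : ∃ C : ℝ, 0 < C ∧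
    ∀ A : Space d → Space d →L[ℝ] Space d, IsUniformlyElliptic lam A →
    ∀ G : Space d → Space d → ℝ, IsGreenFunction A G → ∀ x₀ y₀ : Space d, 10 ≤ ‖x₀ - y₀‖ →
    ∃ K : Option (Fin d) → Option (Fin d) →
        Lp ℝ 2 ((volume.restrict (ball x₀ 1)).prod (volume.restrict (ball y₀ 1))),
      (K none none =ᵐ[volume.restrict (ball x₀ 1 ×ˢ ball y₀ 1)] fun q => G q.1 q.2) ∧
      (∀ i o, HasWeakDeriv (ball x₀ 1 ×ˢ ball y₀ 1) ((basisVec i, 0) : Space d × Space d)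
        (K none o) (K (some i) o)) ∧
      (∀ i o, HasWeakDeriv (ball x₀ 1 ×ˢ ball y₀ 1) ((0, basisVec i) : Space d × Space d)
        (K o none) (K o (some i))) ∧
      ∀ rx ry', IsMinimalRadius C₀ A x₀ rx → IsMinimalRadius C₀ (adjointField A) y₀ ry' → ∀ o o',
        ‖K o o'‖ ^ 2 ≤ C * (rx * ry' / ‖x₀ - y₀‖ ^ 2) ^ d
          * (jetWeight ‖x₀ - y₀‖ o * jetWeight ‖x₀ - y₀‖ o' * ‖x₀ - y₀‖ ^ 4) := by
  obtain ⟨C₁, hC₁, h1⟩ := exists_norm_green_le hlam0 hlam1 (d := d)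
  obtain ⟨C₂, hC₂, h2⟩ := exists_jetKernel hlam0 hlam1 C₀ (d := d)
  refine ⟨C₁ * C₂ ^ 2 * 64 ^ (d + 2), by positivity, fun A hA G hG x₀ y₀ hR => ?_⟩
  set R := ‖x₀ - y₀‖
  -- The large balls have radius `R / 8`, and `R ≥ 10` is exactly what makes it at least `5 / 4`.
  have hρ : 5 / 4 ≤ R / 4 / 2 := by linarith
  have hρR : 2 * (R / 4 / 2) ≤ R := by linarith
  obtain ⟨hm, hmK⟩ := h1 A hA G hG x₀ y₀ (R / 4) (by linarith) (by linarith)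
  have hdisj : ∀ {r : ℝ}, 2 * r ≤ R → Disjoint (ball x₀ r) (ball y₀ r) := fun {r} hr =>
    ball_disjoint_ball (by rw [dist_eq_norm]; linarith)
  have hK₀ := hG.isKernel hlam0 hlam1 hA (hdisj hρR) hm
  choose K hK hKb using h2 A hA x₀ y₀ _ hρ hρR hm.toLp hK₀
  have hm1 : MemLp (fun q : Space d × Space d => G q.1 q.2) 2
      ((volume.restrict (ball x₀ 1)).prod (volume.restrict (ball y₀ 1))) :=
    hm.mono_measure (Measure.prod_mono (Measure.restrict_mono_set _ (ball_subset_ball (by linarith)))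
      (Measure.restrict_mono_set _ (ball_subset_ball (by linarith))))
  have hK1 := hG.isKernel hlam0 hlam1 hA (hdisj (r := 1) (by linarith)) hm1
  refine ⟨K, ?_, fun i o => ?_, fun i o => ?_, fun rx ry' hrx hry o o' => ?_⟩
  · refine ae_prod_iff.1 ?_
    -- The undifferentiated jet operator is `greenOp` on unit balls, whose kernel is `G`; uniqueness
    -- of kernels identifies the two.
    rw [(hK none none).unique hK1]
    exact hm1.coeFn_toLp
  · exact (hK none o).hasWeakDeriv_fst (hK (some i) o) (hasWeakDeriv_jetOp hlam0 hA x₀ y₀ i o)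
  · exact (hK o none).hasWeakDeriv_snd (hK o (some i)) (hasWeakDeriv_adjoint_jetOp hlam0 hA x₀ y₀ i o)
  · have hrx0 : 0 ≤ rx := zero_le_one.trans hrx.1
    have hry0 : 0 ≤ ry' := zero_le_one.trans hry.1
    have hRpos : 0 < R := by linarith
    have hw : ∀ o : Option (Fin d), jetWeight (R / 4 / 2) o ≤ 64 * jetWeight R o := by
      intro o
      cases o with
      | none => norm_num [jetWeight]
      | some i => simp only [jetWeight]; refine le_of_eq ?_; field_simp; norm_num
    have hw0 := fun o => jetWeight_nonneg (d := d) (R / 4 / 2) o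
    have hw1 := fun o => jetWeight_nonneg (d := d) R o
    -- Replacing `R / 8` by `R` costs `64` per dimension for the two radii together, and at most
    -- `64` for each of the two weights.
    have e1 : (rx / (R / 4 / 2)) ^ d * (ry' / (R / 4 / 2)) ^ d = 64 ^ d * (rx * ry' / R ^ 2) ^ d := by
      rw [← mul_pow, ← mul_pow]
      congr 1
      field_simp
      ring
    have hq : 0 ≤ (rx * ry' / R ^ 2) ^ d := by positivity
    calc ‖K o o'‖ ^ 2 ≤ _ := hKb o o' rx ry' hrx hry
      _ ≤ (C₂ * (rx / (R / 4 / 2)) ^ d * (64 * jetWeight R o))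
          * (C₂ * (ry' / (R / 4 / 2)) ^ d * (64 * jetWeight R o')) * (C₁ * R ^ 4) := by
        have h4 : (R / 4) ^ 4 ≤ R ^ 4 := by gcongr; linarith
        have := hw o
        have := hw o'
        have := hw0 o
        have := hw0 o'
        have := hw1 o
        have := hw1 o'
        have h5 : ‖hm.toLp‖ ^ 2 ≤ C₁ * R ^ 4 := hmK.trans (by gcongr)
        gcongr
      _ = C₁ * C₂ ^ 2 * 64 ^ 2 * ((rx / (R / 4 / 2)) ^ d * (ry' / (R / 4 / 2)) ^ d)
          * (jetWeight R o * jetWeight R o' * R ^ 4) := by ring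
      _ = _ := by rw [e1, pow_add]; ring

omit hd in
lemma lintegral_sum_sq_le {ι X : Type*} [Fintype ι] [MeasurableSpace X] {μ : Measure X}
    (f : ι → Lp ℝ 2 μ) {b : ℝ} (hf : ∀ i, ‖f i‖ ^ 2 ≤ b) :
    ∫⁻ x, ENNReal.ofReal (∑ i, f i x ^ 2) ∂μ ≤ ENNReal.ofReal (Fintype.card ι * b) := by
  have e : ∀ x, ENNReal.ofReal (∑ i, f i x ^ 2) = ∑ i, ‖f i x‖ₑ ^ 2 := by
    intro x
    rw [ENNReal.ofReal_sum_of_nonneg fun i _ => sq_nonneg _]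
    refine Finset.sum_congr rfl fun i _ => ?_
    rw [← ofReal_norm, ← ENNReal.ofReal_pow (norm_nonneg _), Real.norm_eq_abs, sq_abs]
  simp only [e]
  rw [lintegral_finsetSum' _ fun i _ => (Lp.aestronglyMeasurable (f i)).enorm.pow_const 2]
  calc ∑ i, ∫⁻ x, ‖f i x‖ₑ ^ 2 ∂μ ≤ ∑ _i : ι, ENNReal.ofReal b := by
        refine Finset.sum_le_sum fun i _ => ?_
        rw [lintegral_enorm_sq, ← ENNReal.ofReal_toReal (Lp.eLpNorm_ne_top (f i)), ← Lp.norm_def,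
          ← ENNReal.ofReal_pow (norm_nonneg _)]
        exact ENNReal.ofReal_le_ofReal (hf i)
    _ = _ := by
        rw [Finset.sum_const, Finset.card_univ, nsmul_eq_mul, ENNReal.ofReal_mul (Nat.cast_nonneg _),
          ENNReal.ofReal_natCast]

end GreenEstimates

theorem theorem1 (d : ℕ) (hd : 3 ≤ d) (lam : ℝ) (hlam0 : 0 < lam) (hlam1 : lam < 1) (C₀ : ℝ) :
    ∃ C : ℝ, 0 < C ∧
      ∀ (A : GreenEstimates.Space d → GreenEstimates.Space d →L[ℝ] GreenEstimates.Space d),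
        GreenEstimates.IsUniformlyElliptic lam A →
      ∀ (G : GreenEstimates.Space d → GreenEstimates.Space d → ℝ),
        GreenEstimates.IsGreenFunction A G →
      ∀ x₀ y₀ : GreenEstimates.Space d, 10 ≤ ‖x₀ - y₀‖ →
      ∃ (Gx Gy : GreenEstimates.Space d × GreenEstimates.Space d → GreenEstimates.Space d)
        (Gxy : GreenEstimates.Space d × GreenEstimates.Space d → Matrix (Fin d) (Fin d) ℝ),
        -- `Gx = ∇_x G`, `Gy = ∇_y G` and `Gxy i j = ∂_{x_i} ∂_{y_j} G` on `B_1(x₀) × B_1(y₀)`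
        GreenEstimates.HasWeakGradientFst (ball x₀ 1 ×ˢ ball y₀ 1) (fun p => G p.1 p.2) Gx ∧
        GreenEstimates.HasWeakGradientSnd (ball x₀ 1 ×ˢ ball y₀ 1) (fun p => G p.1 p.2) Gy ∧
        (∀ i j : Fin d, GreenEstimates.HasWeakDeriv (ball x₀ 1 ×ˢ ball y₀ 1)
          ((GreenEstimates.basisVec i, 0) : GreenEstimates.Space d × GreenEstimates.Space d)
          (fun p => Gy p j) (fun p => Gxy p i j)) ∧
        ∀ rx ry' : ℝ,
          GreenEstimates.IsMinimalRadius C₀ A x₀ rx →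
          GreenEstimates.IsMinimalRadius C₀ (GreenEstimates.adjointField A) y₀ ry' →
          (∫⁻ p in ball x₀ 1 ×ˢ ball y₀ 1, ENNReal.ofReal (∑ i, ∑ j, Gxy p i j ^ 2)
            ≤ ENNReal.ofReal (C * (rx * ry' / ‖x₀ - y₀‖ ^ 2) ^ d)) ∧
          (∫⁻ p in ball x₀ 1 ×ˢ ball y₀ 1, ENNReal.ofReal (‖Gy p‖ ^ 2)
            ≤ ENNReal.ofReal (C * ‖x₀ - y₀‖ ^ 2 * (rx * ry' / ‖x₀ - y₀‖ ^ 2) ^ d)) ∧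
          (∫⁻ p in ball x₀ 1 ×ˢ ball y₀ 1, ENNReal.ofReal (‖Gx p‖ ^ 2)
            ≤ ENNReal.ofReal (C * ‖x₀ - y₀‖ ^ 2 * (rx * ry' / ‖x₀ - y₀‖ ^ 2) ^ d)) ∧
          ∀ rx' ry : ℝ,
            GreenEstimates.IsMinimalRadius C₀ (GreenEstimates.adjointField A) x₀ rx' →
            GreenEstimates.IsMinimalRadius C₀ A y₀ ry →
            ∫⁻ p in ball x₀ 1 ×ˢ ball y₀ 1, ENNReal.ofReal (G p.1 p.2 ^ 2)
              ≤ ENNReal.ofReal (C * ‖x₀ - y₀‖ ^ 4 *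
                  ((rx * ry' + rx' * ry) / ‖x₀ - y₀‖ ^ 2) ^ d) := by
  have hfact : Fact (3 ≤ d) := ⟨hd⟩
  obtain ⟨C, hC, h⟩ := GreenEstimates.exists_green_derivatives (d := d) hlam0 hlam1 C₀
  -- There are `d²` entries in the mixed derivative and `d ≤ d²` in each gradient.
  refine ⟨d ^ 2 * C, by positivity, fun A hA G hG x₀ y₀ hR => ?_⟩
  obtain ⟨K, hKG, hfst, hsnd, hb⟩ := h A hA G hG x₀ y₀ hR
  have hR0 : 0 < ‖x₀ - y₀‖ := by linarith
  have hd1 : (1 : ℝ) ≤ d := by exact_mod_cast (by omega : 1 ≤ d)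
  refine ⟨fun p => WithLp.toLp 2 fun i => K (some i) none p, fun p => WithLp.toLp 2 fun j => K none (some j) p,
    fun p => Matrix.of fun i j => K (some i) (some j) p, fun i => ?_, fun j => ?_, fun i j => ?_,
    fun rx ry' hrx hry' => ?_⟩
  · exact (hfst i none).congr_ae hKG Filter.EventuallyEq.rfl
  · exact (hsnd j none).congr_ae hKG Filter.EventuallyEq.rfl
  · exact hfst i (some j)
  have hb := hb rx ry' hrx hry'
  have hrx0 : 0 ≤ rx := zero_le_one.trans hrx.1
  have hry0 : 0 ≤ ry' := zero_le_one.trans hry'.1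
  have hmeas : (volume : MeasureTheory.Measure (GreenEstimates.Space d × GreenEstimates.Space d)).restrict
      (ball x₀ 1 ×ˢ ball y₀ 1) = (volume.restrict (ball x₀ 1)).prod (volume.restrict (ball y₀ 1)) :=
    (Measure.prod_restrict _ _).symm
  obtain ⟨R, hR1⟩ : ∃ R, R = ‖x₀ - y₀‖ := ⟨_, rfl⟩
  rw [← hR1] at hb hR0 ⊢
  -- Each derivative carries a weight `R⁻²` against the common `R⁴`, which leaves `1`, `R²`, `R²`
  -- and `R⁴`.
  have hxy : ∀ i j, ‖K (some i) (some j)‖ ^ 2 ≤ C * (rx * ry' / R ^ 2) ^ d := fun i j =>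
    (hb _ _).trans (le_of_eq (by simp only [GreenEstimates.jetWeight]; field_simp))
  have hx : ∀ i, ‖K (some i) none‖ ^ 2 ≤ C * R ^ 2 * (rx * ry' / R ^ 2) ^ d := fun i =>
    (hb _ _).trans (le_of_eq (by simp only [GreenEstimates.jetWeight]; field_simp))
  have hy : ∀ i, ‖K none (some i)‖ ^ 2 ≤ C * R ^ 2 * (rx * ry' / R ^ 2) ^ d := fun i =>
    (hb _ _).trans (le_of_eq (by simp only [GreenEstimates.jetWeight]; field_simp))
  have hG0 : ‖K none none‖ ^ 2 ≤ C * R ^ 4 * (rx * ry' / R ^ 2) ^ d :=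
    (hb _ _).trans (le_of_eq (by simp only [GreenEstimates.jetWeight]; ring))
  have hdsq : (d : ℝ) ≤ d ^ 2 := le_self_pow₀ hd1 two_ne_zero
  refine ⟨?_, ?_, ?_, fun rx' ry hrx' hry => ?_⟩
  · rw [hmeas]
    have h1 := GreenEstimates.lintegral_sum_sq_le (fun q : Fin d × Fin d => K (some q.1) (some q.2))
      (fun q => hxy q.1 q.2)
    simp only [Fintype.sum_prod_type] at h1
    refine h1.trans (ENNReal.ofReal_le_ofReal (le_of_eq ?_))
    rw [Fintype.card_prod, Fintype.card_fin]
    push_cast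
    ring
  · rw [hmeas]
    simp only [EuclideanSpace.real_norm_sq_eq]
    refine (GreenEstimates.lintegral_sum_sq_le (fun j : Fin d => K none (some j)) hy).trans
      (ENNReal.ofReal_le_ofReal ?_)
    rw [Fintype.card_fin]
    calc _ ≤ (d : ℝ) ^ 2 * (C * R ^ 2 * (rx * ry' / R ^ 2) ^ d) := by gcongr
      _ = _ := by ring
  · rw [hmeas]
    simp only [EuclideanSpace.real_norm_sq_eq]
    refine (GreenEstimates.lintegral_sum_sq_le (fun i : Fin d => K (some i) none) hx).trans
      (ENNReal.ofReal_le_ofReal ?_)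
    rw [Fintype.card_fin]
    calc _ ≤ (d : ℝ) ^ 2 * (C * R ^ 2 * (rx * ry' / R ^ 2) ^ d) := by gcongr
      _ = _ := by ring
  · have hle : rx * ry' ≤ rx * ry' + rx' * ry :=
      le_add_of_nonneg_right (mul_nonneg (zero_le_one.trans hrx'.1) (zero_le_one.trans hry.1))
    have e : ∫⁻ p in ball x₀ 1 ×ˢ ball y₀ 1, ENNReal.ofReal (G p.1 p.2 ^ 2)
        = ∫⁻ p in ball x₀ 1 ×ˢ ball y₀ 1, ENNReal.ofReal (∑ _i : Unit, K none none p ^ 2) := by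
      refine lintegral_congr_ae ?_
      filter_upwards [hKG] with p hp
      simp [hp]
    rw [e, hmeas]
    refine (GreenEstimates.lintegral_sum_sq_le (fun _ : Unit => K none none) fun _ => hG0).trans
      (ENNReal.ofReal_le_ofReal ?_)
    rw [Fintype.card_unit, Nat.cast_one, one_mul]
    calc C * R ^ 4 * (rx * ry' / R ^ 2) ^ d ≤ (1 * C) * R ^ 4 * ((rx * ry' + rx' * ry) / R ^ 2) ^ d := by
          rw [one_mul]; gcongr
      _ ≤ _ := by
          have : 0 ≤ rx * ry' + rx' * ry := (mul_nonneg hrx0 hry0).trans hle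
          gcongr
          exact one_le_pow₀ hd1
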